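/- **Conventions.** A hyperkähler manifold is a (Hausdorff) smooth manifold with a Riemannian metric $g$ and complex structures $I_1,I_2,I_3=I_1I_2$ such that $g$ is Kähler for each of them; $\omega_a=g(I_a\cdot,\cdot)$ are the Kähler forms. A local action of $\mathbb R^n$ on $M$ is a smooth map $(t,p)\mapsto t\cdot p\in M$ on an open neighbourhood of $\{0\}\times M$ in $\mathbb R^n\times M$ with $0\cdot p=p$ and $s\cdot(t\cdot p)=(s+t)\cdot p$ whenever all terms are defined. It is free if for every $p$ there is a neighbourhood of $0\in\mathbb R^n$ in which only $t=0$ satisfies $t\cdot p=p$. Let $X_1,\dots,X_n$ be the vector fields generating it. The action is tri-Hamiltonian if it has a moment map $\mu=(\mu_1,\mu_2,\mu_3):M\to\mathbb R^3\otimes\mathbb R^n$, i.e. a smooth map, invariant under the local action (for all $t$ near $0$, depending on the point), with $d(\mu_a)_i=\omega_a(X_i,\cdot)$ for $a=1,2,3$ and $i=1,\dots,n$. Identify $\mathbb R^3\otimes\mathbb R^n$ with $\mathbb R^n\times\mathbb C^n$ by the coordinates $(x_i,\operatorname{Re}z_i,\operatorname{Im}z_i)$. A function on an open set $U\subset\mathbb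 R^3\otimes\mathbb R^n$ is polyharmonic if its restriction to $U\cap(a+\mathbb R^3\otimes\mathbb R v)$ is harmonic for all $a\in\mathbb R^3\otimes\mathbb R^n$ and $v\in\mathbb R^n$. **Proposition.** Let $M$ be a hyperkähler manifold of real dimension $4n$ with a free local tri-Hamiltonian action of $\mathbb R^n$ with moment map $\mu$. Then $M$ is locally given by the Lindström–Roček Legendre transform of a polyharmonic function. That is, every point of $M$ has an open neighbourhood $V$ on which there are smooth $I_1$-holomorphic coordinates $(u_1,\dots,u_n,z_1,\dots,z_n)$, forming a diffeomorphism of $V$ onto an open set $W\subset\mathbb C^{2n}$, and there is a smooth polyharmonic function $F:U\to\mathbb R$ on an open set $U\subset\mathbb R^3\otimes\mathbb R^n$ with $\bigl(\tfrac14 F_{x_ix_j}\bigr)$ positive definite on $U$, such that: 1. for every $(u,z)\in W$ there is exactly one $x=x(u,z)\in\mathbb R^n$ with $(x,z)\in U$ and $\dfrac{\partial F}{\partial x_i}(x,z)=2(u_i+\bar u_i)$ for all $i$; moreover $U=\{(x(u,z),z):(u,z)\in W\}$; 2. $K(u,z)=F(x,z)-2\sum_i(u_i+\bar u_i)x_i$,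 with $x=x(u,z)$, is a smooth function on $W$ and is a potential of $\omega_1$: writing $\zeta=(u,z)$, $\ \omega_1=-\tfrac{i}{2}\sum_{\alpha,\beta}K_{\zeta_\alpha\bar\zeta_\beta}\,d\zeta_\alpha\wedge d\bar\zeta_\beta$ on $V$; 3. $\omega_2+i\omega_3=\sum_i du_i\wedge dz_i$ on $V$; 4. $X_i=\sqrt{-1}\,(\partial/\partial\bar u_i-\partial/\partial u_i)$ on $V$; 5. on $V$ the moment map is given by $x_i=(\mu_1)_i$ and $z_i=\sqrt{-1}\,\bigl((\mu_2)_i+\sqrt{-1}\,(\mu_3)_i\bigr)$. -/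

import Mathlib

open Manifold ContDiff Topology Bundle VectorField ComplexConjugate

noncomputable section

/-! ### Hyperkähler manifolds -/

section Hyperkahler

variable {m : ℕ} {M : Type*} [TopologicalSpace M]
  [ChartedSpace (EuclideanSpace ℝ (Fin m)) M] [IsManifold (𝓡 m) ∞ M]

/-- The vector field `X` is smooth near the point `p`. -/
def SmoothFieldAt (X : ∀ p : M, TangentSpace (𝓡 m) p) (p : M) : Prop :=
  ContMDiffAt (𝓡 m) (𝓡 m).tangent ∞ (fun q => (⟨q, X q⟩ : TangentBundle (𝓡 m) M)) p

/-- The derivative `v f` of a real function `f` along a tangent vector `v`. -/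
def dirDeriv (f : M → ℝ) {p : M} (v : TangentSpace (𝓡 m) p) : ℝ :=
  mfderiv (𝓡 m) 𝓘(ℝ, ℝ) f p v

/-- The Nijenhuis tensor of a field `J` of endomorphisms of the tangent bundle vanishes:
`[JX, JY] - J[JX, Y] - J[X, JY] - [X, Y] = 0`. -/
def NijenhuisVanishes
    (J : ∀ p : M, TangentSpace (𝓡 m) p →L[ℝ] TangentSpace (𝓡 m) p) : Prop :=
  ∀ (p : M) (X Y : ∀ q : M, TangentSpace (𝓡 m) q), SmoothFieldAt X p → SmoothFieldAt Y p →
    mlieBracket (𝓡 m) (fun q => J q (X q)) (fun q => J q (Y q)) p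
      - J p (mlieBracket (𝓡 m) (fun q => J q (X q)) Y p)
      - J p (mlieBracket (𝓡 m) X (fun q => J q (Y q)) p)
      - mlieBracket (𝓡 m) X Y p = 0

/-- The 2-form `σ` is closed: `dσ(X, Y, Z) = 0`, where `dσ` is given by the invariant formula
`X σ(Y,Z) + Y σ(Z,X) + Z σ(X,Y) - σ([X,Y],Z) - σ([Y,Z],X) - σ([Z,X],Y)`. -/
def IsClosedTwoForm
    (σ : ∀ p : M, TangentSpace (𝓡 m) p → TangentSpace (𝓡 m) p → ℝ) : Prop :=
  ∀ (p : M) (X Y Z : ∀ q : M, TangentSpace (𝓡 m) q),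
    SmoothFieldAt X p → SmoothFieldAt Y p → SmoothFieldAt Z p →
    dirDeriv (fun q => σ q (Y q) (Z q)) (X p)
      + dirDeriv (fun q => σ q (Z q) (X q)) (Y p)
      + dirDeriv (fun q => σ q (X q) (Y q)) (Z p)
      - σ p (mlieBracket (𝓡 m) X Y p) (Z p)
      - σ p (mlieBracket (𝓡 m) Y Z p) (X p)
      - σ p (mlieBracket (𝓡 m) Z X p) (Y p) = 0

variable (m M) in
/-- A hyperkähler structure on the smooth `m`-manifold `M`: a Riemannian metric `g` and three
complex structures `I₁, I₂, I₃` (the fields `I 0, I 1, I 2`) with `I₁ I₂ = I₃`, such that `g` is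
Kähler with respect to each of them. -/
structure HyperkahlerStructure where
  /-- the Riemannian metric -/
  g : ContMDiffRiemannianMetric (𝓡 m) ∞ (EuclideanSpace ℝ (Fin m))
    (fun p : M => TangentSpace (𝓡 m) p)
  /-- the three complex structures -/
  I : Fin 3 → ∀ p : M, TangentSpace (𝓡 m) p →L[ℝ] TangentSpace (𝓡 m) p
  smooth_I : ∀ a, ContMDiff (𝓡 m)
    ((𝓡 m).prod 𝓘(ℝ, EuclideanSpace ℝ (Fin m) →L[ℝ] EuclideanSpace ℝ (Fin m))) ∞
    (fun p => TotalSpace.mk' (EuclideanSpace ℝ (Fin m) →L[ℝ] EuclideanSpace ℝ (Fin m))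
      (E := fun p : M => TangentSpace (𝓡 m) p →L[ℝ] TangentSpace (𝓡 m) p) p (I a p))
  I_sq : ∀ a p (v : TangentSpace (𝓡 m) p), I a p (I a p v) = -v
  I_mul : ∀ p (v : TangentSpace (𝓡 m) p), I 0 p (I 1 p v) = I 2 p v
  I_orthogonal : ∀ a p (v w : TangentSpace (𝓡 m) p),
    g.inner p (I a p v) (I a p w) = g.inner p v w
  integrable : ∀ a, NijenhuisVanishes (I a)
  closed : ∀ a, IsClosedTwoForm (fun p v w => g.inner p (I a p v) w)

/-- The Kähler forms `ω_a(v, w) = g(I_a v, w)`. -/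
def HyperkahlerStructure.kahlerForm (H : HyperkahlerStructure m M)
    (a : Fin 3) (p : M) (v w : TangentSpace (𝓡 m) p) : ℝ :=
  H.g.inner p (H.I a p v) w

/-! ### Local actions of `ℝⁿ` and moment maps -/

variable (m M) in
/-- A smooth local action of `ℝⁿ` on `M`: `act t p` is meaningful for `(t, p)` in an open
neighbourhood `dom` of `{0} × M`. -/
structure LocalAction (n : ℕ) where
  /-- the domain of the action -/
  dom : Set (EuclideanSpace ℝ (Fin n) × M)
  /-- the action -/
  act : EuclideanSpace ℝ (Fin n) → M → M
  isOpen_dom : IsOpen dom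
  zero_mem : ∀ p, ((0 : EuclideanSpace ℝ (Fin n)), p) ∈ dom
  smooth : ContMDiffOn ((𝓡 n).prod (𝓡 m)) (𝓡 m) ∞
    (fun q : EuclideanSpace ℝ (Fin n) × M => act q.1 q.2) dom
  act_zero : ∀ p, act 0 p = p
  act_add : ∀ s t p, (t, p) ∈ dom → (s, act t p) ∈ dom → (s + t, p) ∈ dom →
    act s (act t p) = act (s + t) p

/-- A local action is free if no point is fixed by a non-zero `t`. Since only the germ of the
action along `{0} × M` matters, `t` is restricted to some neighbourhood of `0` (which may depend on
the point); every free action of `ℝⁿ`, and every local action induced by a free action of a torus,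
is free in this sense. -/
def LocalAction.IsFree {n : ℕ} (A : LocalAction m M n) : Prop :=
  ∀ p, ∀ᶠ t in 𝓝 (0 : EuclideanSpace ℝ (Fin n)), A.act t p = p → t = 0

/-- The vector field `X_i` on `M` generating the action of the `i`-th factor of `ℝⁿ`. -/
def LocalAction.field {n : ℕ} (A : LocalAction m M n) (i : Fin n) (p : M) :
    TangentSpace (𝓡 m) p :=
  mfderiv (𝓡 n) (𝓡 m) (fun t : EuclideanSpace ℝ (Fin n) => A.act t p) 0
    (EuclideanSpace.single i (1 : ℝ) : EuclideanSpace ℝ (Fin n))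

/-- `μ : M → ℝ³ ⊗ ℝⁿ` is a hyperkähler moment map of the local action `A`: it is smooth and
invariant under the action (equivariance for an abelian group), and its components satisfy
`d(μ_a)_i = ω_a(X_i, ·)` for `a = 1, 2, 3`. The component `(μ_a)_i` at `p` is `μ p i (a - 1)`. -/
structure IsTriMomentMap (H : HyperkahlerStructure m M) {n : ℕ}
    (A : LocalAction m M n) (μ : M → Fin n → EuclideanSpace ℝ (Fin 3)) : Prop where
  smooth : ContMDiff (𝓡 m) 𝓘(ℝ, Fin n → EuclideanSpace ℝ (Fin 3)) ∞ μ
  invariant : ∀ p, ∀ᶠ t in 𝓝 (0 : EuclideanSpace ℝ (Fin n)), μ (A.act t p) = μ p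
  deriv_eq : ∀ (i : Fin n) (a : Fin 3) (p : M) (v : TangentSpace (𝓡 m) p),
    dirDeriv (fun q => μ q i a) v = H.kahlerForm a p (A.field i p) v

end Hyperkahler

/-! ### The Legendre transform -/

section Legendre

variable {n : ℕ}

/-- `F` is polyharmonic on the subset `U` of `ℝ³ ⊗ ℝⁿ` (viewed as `n`-tuples of vectors of `ℝ³`):
it is harmonic on `U ∩ (a + ℝ³ ⊗ ℝ v)` for all `a ∈ ℝ³ ⊗ ℝⁿ` and `v ∈ ℝⁿ`. -/
def IsPolyharmonicOn (F : (Fin n → EuclideanSpace ℝ (Fin 3)) → ℝ)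
    (U : Set (Fin n → EuclideanSpace ℝ (Fin 3))) : Prop :=
  ∀ (a : Fin n → EuclideanSpace ℝ (Fin 3)) (v : Fin n → ℝ),
    InnerProductSpace.HarmonicOnNhd
      (fun q : EuclideanSpace ℝ (Fin 3) => F (fun i => a i + v i • q))
      {q : EuclideanSpace ℝ (Fin 3) | (fun i => a i + v i • q) ∈ U}

/-- The point of `ℝ³ ⊗ ℝⁿ` with coordinates `x ∈ ℝⁿ`, `z ∈ ℂⁿ`, under the identification
`ℝ³ ⊗ ℝⁿ = ℝⁿ × ℂⁿ`, `(x_i, Re z_i, Im z_i)`. -/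
def ptXZ (x : Fin n → ℝ) (z : Fin n → ℂ) : Fin n → EuclideanSpace ℝ (Fin 3) :=
  fun i => !₂[x i, (z i).re, (z i).im]

/-- The partial derivative `∂F/∂x_i`. -/
def partialX (F : (Fin n → EuclideanSpace ℝ (Fin 3)) → ℝ) (i : Fin n)
    (w : Fin n → EuclideanSpace ℝ (Fin 3)) : ℝ :=
  fderiv ℝ F w (Pi.single i (EuclideanSpace.single 0 (1 : ℝ)))

/-- The Wirtinger derivative `∂f/∂ζ_α`. -/
def wirtinger {ι : Type*} [Fintype ι] [DecidableEq ι] (f : (ι → ℂ) → ℂ) (α : ι)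
    (ζ : ι → ℂ) : ℂ :=
  (1 / 2) * (fderiv ℝ f ζ (Pi.single α 1) - Complex.I * fderiv ℝ f ζ (Pi.single α Complex.I))

/-- The Wirtinger derivative `∂f/∂ζ̄_α`. -/
def wirtingerBar {ι : Type*} [Fintype ι] [DecidableEq ι] (f : (ι → ℂ) → ℂ) (α : ι)
    (ζ : ι → ℂ) : ℂ :=
  (1 / 2) * (fderiv ℝ f ζ (Pi.single α 1) + Complex.I * fderiv ℝ f ζ (Pi.single α Complex.I))

/-- The mixed second derivative `K_{ζ_α ζ̄_β}` of a real function `K`. -/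
def mixedDeriv {ι : Type*} [Fintype ι] [DecidableEq ι] (K : (ι → ℂ) → ℝ) (α β : ι)
    (ζ : ι → ℂ) : ℂ :=
  wirtinger (wirtingerBar (fun ξ => ((K ξ : ℝ) : ℂ)) β) α ζ

/-- `K` is the Legendre transform, with respect to `x`, of the function `F` on `U`. The space `ℂ²ⁿ`
has the coordinates `ζ = (u, z)`, `u_i = ζ (.inl i)`, `z_i = ζ (.inr i)`. For every `(u, z) ∈ W`
there is exactly one `x = x(u, z)` with `(x, z) ∈ U` and `∂F/∂x_i (x, z) = 2 (u_i + ū_i)`, and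
`K(u, z) = F(x, z) - 2 ∑ (u_i + ū_i) x_i`. The matrix `¼ F_{x_i x_j}` is positive definite on `U`,
and every point of `U` is of the form `(x(u, z), z)`. -/
structure IsLegendreTransform (F : (Fin n → EuclideanSpace ℝ (Fin 3)) → ℝ)
    (U : Set (Fin n → EuclideanSpace ℝ (Fin 3))) (W : Set (Fin n ⊕ Fin n → ℂ))
    (x : (Fin n ⊕ Fin n → ℂ) → Fin n → ℝ) (K : (Fin n ⊕ Fin n → ℂ) → ℝ) : Prop where
  hessian_posDef : ∀ w ∈ U,
    (Matrix.of fun i j : Fin n => (1 / 4) * partialX (partialX F j) i w).PosDef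
  mem : ∀ ζ ∈ W, ptXZ (x ζ) (fun i => ζ (.inr i)) ∈ U
  deriv_eq : ∀ ζ ∈ W, ∀ i,
    ((partialX F i (ptXZ (x ζ) (fun i => ζ (.inr i))) : ℝ) : ℂ)
      = 2 * (ζ (.inl i) + conj (ζ (.inl i)))
  unique : ∀ ζ ∈ W, ∀ x' : Fin n → ℝ, ptXZ x' (fun i => ζ (.inr i)) ∈ U →
    (∀ i, ((partialX F i (ptXZ x' (fun i => ζ (.inr i))) : ℝ) : ℂ)
      = 2 * (ζ (.inl i) + conj (ζ (.inl i)))) → x' = x ζ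
  surj : ∀ w ∈ U, ∃ ζ ∈ W, ptXZ (x ζ) (fun i => ζ (.inr i)) = w
  potential : ∀ ζ ∈ W, ((K ζ : ℝ) : ℂ) = F (ptXZ (x ζ) (fun i => ζ (.inr i)))
    - 2 * ∑ i, (ζ (.inl i) + conj (ζ (.inl i))) * (x ζ i : ℂ)

variable {m : ℕ} {M : Type*} [TopologicalSpace M]
  [ChartedSpace (EuclideanSpace ℝ (Fin m)) M] [IsManifold (𝓡 m) ∞ M]

/-- The differential `dζ_α(v)` of the `α`-th complex coordinate of the local chart `ψ`. -/
def dCoord {ι : Type*} [Fintype ι] (ψ : OpenPartialHomeomorph M (ι → ℂ)) {p : M} (α : ι)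
    (v : TangentSpace (𝓡 m) p) : ℂ :=
  (mfderiv (𝓡 m) 𝓘(ℝ, ι → ℂ) ψ p v : ι → ℂ) α

/-- On the domain of the local chart `ψ = (u, z)` the hyperkähler structure, the local action and
the moment map are those determined by the potential `K` and the functions `x_i` of `(u, z)`. -/
structure IsGivenByPotential (H : HyperkahlerStructure m M)
    (A : LocalAction m M n) (μ : M → Fin n → EuclideanSpace ℝ (Fin 3))
    (ψ : OpenPartialHomeomorph M (Fin n ⊕ Fin n → ℂ))
    (x : (Fin n ⊕ Fin n → ℂ) → Fin n → ℝ) (K : (Fin n ⊕ Fin n → ℂ) → ℝ) : Prop where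
  /-- `ψ` is a diffeomorphism of its domain onto an open subset of `ℂ²ⁿ` -/
  smooth : ContMDiffOn (𝓡 m) 𝓘(ℝ, Fin n ⊕ Fin n → ℂ) ∞ ψ ψ.source
  smooth_symm : ContMDiffOn 𝓘(ℝ, Fin n ⊕ Fin n → ℂ) (𝓡 m) ∞ ψ.symm ψ.target
  /-- the coordinates are holomorphic for `I₁` -/
  holomorphic : ∀ p ∈ ψ.source, ∀ (v : TangentSpace (𝓡 m) p) (α : Fin n ⊕ Fin n),
    dCoord ψ α (H.I 0 p v) = Complex.I * dCoord ψ α v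
  /-- `K` is smooth -/
  smooth_K : ContDiffOn ℝ ∞ K ψ.target
  /-- `ω₁ = -(i/2) ∑ K_{ζ_α ζ̄_β} dζ_α ∧ dζ̄_β` -/
  kahlerForm_one : ∀ p ∈ ψ.source, ∀ v w : TangentSpace (𝓡 m) p,
    ((H.kahlerForm 0 p v w : ℝ) : ℂ) = -(Complex.I / 2) * ∑ α, ∑ β, mixedDeriv K α β (ψ p) *
      (dCoord ψ α v * conj (dCoord ψ β w) - dCoord ψ α w * conj (dCoord ψ β v))
  /-- `ω₂ + i ω₃ = ∑ du_i ∧ dz_i` -/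
  kahlerForm_two_three : ∀ p ∈ ψ.source, ∀ v w : TangentSpace (𝓡 m) p,
    ((H.kahlerForm 1 p v w : ℝ) : ℂ) + Complex.I * ((H.kahlerForm 2 p v w : ℝ) : ℂ) =
      ∑ i : Fin n, (dCoord ψ (.inl i) v * dCoord ψ (.inr i) w
        - dCoord ψ (.inl i) w * dCoord ψ (.inr i) v)
  /-- `X_i = √-1 (∂/∂ū_i - ∂/∂u_i)`: the vector with `du_j = -√-1 δ_ij`, `dz_j = 0` -/
  field_u : ∀ p ∈ ψ.source, ∀ i j : Fin n,
    dCoord ψ (.inl j) (A.field i p) = if i = j then -Complex.I else 0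
  field_z : ∀ p ∈ ψ.source, ∀ i j : Fin n, dCoord ψ (.inr j) (A.field i p) = 0
  /-- the moment map: `x_i = (μ₁)_i` and `z_i = √-1 ((μ₂)_i + √-1 (μ₃)_i)` -/
  moment_x : ∀ p ∈ ψ.source, ∀ i : Fin n, x (ψ p) i = μ p i 0
  moment_z : ∀ p ∈ ψ.source, ∀ i : Fin n,
    ψ p (.inr i) = Complex.I * ((μ p i 1 : ℂ) + Complex.I * (μ p i 2 : ℂ))

end Legendre

end

/-! Write Ω = ω₂ + √-1 ω₃. Since μ is invariant, the span of the X_i is isotropic for all three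
Kähler forms. Freeness makes the X_i independent, and in dimension 4n the tangent space is the sum
of this span and its images under I₁, I₂, I₃. With z taken from μ₂, μ₃ one has dz_i = √-1 Ω(X_i, ·),
and the decomposition shows that Ω lies in the ideal generated by the dz_i.

Let x = μ₁ and let τ be a time function, τ(t·q) = τ(q) + t. In the coordinates (x - √-1 τ, z) the
action is generated by X_i = -∂/∂Im u_i. The closed form Ω - ∑ du_i ∧ dz_i lies in the ideal of the
dz_i and is killed by the X_i, so it equals ∑ dh_k ∧ dz_k with invariant h_k
(`exists_darboux_shift`), and (u + h, z) are Darboux coordinates for Ω. They are I₁-holomorphic by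
pure algebra, Ω being of type (2,0) (`IsDarbouxChart.deriv_I`). This takes the place of the
Newlander–Nirenberg theorem.

The analysis sits in a constant coefficient system D_α f = B_α along the commuting frame ∂/∂Im u,
∂/∂Re u, ∂/∂z̄. Each equation is solved by convolution with a Heaviside or Cauchy kernel in its own
coordinate, without disturbing the others. The system yields the functions h_k, and also a potential
K of ω₁ which is invariant under the action and has ∂K/∂Re u_i = -4 x_i (`exists_kahler_potential`).

F is the Legendre dual of K in Re u, F = K + 4 ∑ Re u_i x_i, whence F_{x_i} = 4 Re u_i. Given v ∈
ℝⁿ, let Y be the combination of the X_i with g(X_i, Y) = v_i. Then I₁Y has dx = v and dz = 0, while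
w = -I₃Y and I₁w = I₂Y have dx = 0 and dz = v, √-1 v. The first vector gives F_xx(v, v) = 4|Y|², so
¼F_xx is positive definite. The other two contribute D²K(w, w) + D²K(I₁w, I₁w) = -4 ω₁(w, I₁w) =
-4|Y|², so the Laplacian of F along ℝ³ ⊗ ℝv is zero. -/

noncomputable section

/-! ### Smooth dependence of integrals on a parameter -/

section ParametricIntegral

open MeasureTheory

variable {E G F : Type*} [NormedAddCommGroup E] [NormedSpace ℝ E]
  [NormedAddCommGroup G] [NormedSpace ℝ G] [MeasurableSpace G] [BorelSpace G]
  [NormedAddCommGroup F] [NormedSpace ℂ F] {μ : Measure G} {k : G → ℂ} {H : E × G → F}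
  {s : Set E} {K : Set G}

/-- The integral is the value at 0 of the convolution of `k` with the parametrised function x ↦ H(q,
-x). A kernel that is merely locally integrable suffices, because the smooth factor vanishes outside
one compact set for all parameters in `s`. -/
theorem contDiffOn_integral_smul (hk : LocallyIntegrable k μ) (hH : ContDiff ℝ ∞ H)
    (hs : IsOpen s) (hK : IsCompact K) (hsupp : ∀ q ∈ s, ∀ w ∉ K, H (q, w) = 0) :
    ContDiffOn ℝ ∞ (fun q => ∫ w, k w • H (q, w) ∂μ) s := by
  have h := contDiffOn_convolution_right_with_param_comp (μ := μ) (n := ⊤)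
    (ContinuousLinearMap.lsmul ℝ ℂ : ℂ →L[ℝ] F →L[ℝ] F) (s := s) (v := fun _ => (0 : G))
    contDiffOn_const (f := k) (g := fun p x => H (p, -x)) (k := Neg.neg '' K) hs
    (hK.image continuous_neg) (fun p x hp hx => hsupp p hp _ fun h => hx ⟨-x, h, by simp⟩) hk
    (hH.comp (contDiff_fst.prodMk contDiff_snd.neg)).contDiffOn
  simpa [convolution_def] using h

theorem hasFDerivAt_integral_smul (hk : LocallyIntegrable k μ) (hH : ContDiff ℝ ∞ H)
    (hs : IsOpen s) (hK : IsCompact K) (hsupp : ∀ q ∈ s, ∀ w ∉ K, H (q, w) = 0)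
    {q : E} (hq : q ∈ s) (v : E) :
    fderiv ℝ (fun q => ∫ w, k w • H (q, w) ∂μ) q v
      = ∫ w, k w • fderiv ℝ H (q, w) (v, 0) ∂μ := by
  have hg : ContDiff ℝ ∞ (fun p : E × G => H (p.1, -p.2)) :=
    hH.comp (contDiff_fst.prodMk contDiff_snd.neg)
  have h := hasFDerivAt_convolution_right_with_param (μ := μ)
    (ContinuousLinearMap.lsmul ℝ ℂ : ℂ →L[ℝ] F →L[ℝ] F) (s := s)
    (f := k) (g := fun p x => H (p, -x)) (k := Neg.neg '' K) hs
    (hK.image continuous_neg) (fun p x hp hx => hsupp p hp _ fun h => hx ⟨-x, h, by simp⟩) hk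
    (hg.contDiffOn.of_le (by exact_mod_cast le_top)) (q, 0) hq
  have h2 := HasFDerivAt.comp q (f := fun q : E => (id q, (0 : G))) h
    ((hasFDerivAt_id q).prodMk (hasFDerivAt_const (0 : G) q))
  have h3 : (fun q => ∫ w, k w • H (q, w) ∂μ) =
      (fun q : E × G => (convolution k (fun x => H (q.1, -x))
        (ContinuousLinearMap.lsmul ℝ ℂ : ℂ →L[ℝ] F →L[ℝ] F) μ) q.2) ∘ fun q => (id q, 0) := by
    ext q; simp [convolution_def]
  rw [h3, h2.fderiv]
  have hd : ∀ w, fderiv ℝ (fun p : E × G => H (p.1, -p.2)) (q, -w) (v, 0)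
      = fderiv ℝ H (q, w) (v, 0) := fun w => by
    have e1 : HasFDerivAt (fun p : E × G => H (p.1, -p.2)) _ (q, -w) :=
      HasFDerivAt.comp (q, -w) (g := H) (f := fun p : E × G => (p.1, -p.2))
        ((hH.differentiable (by simp)) _).hasFDerivAt
        (hasFDerivAt_fst.prodMk hasFDerivAt_snd.neg)
    rw [e1.fderiv]; simp
  have hcont : Continuous fun x : G => fderiv ℝ (fun p : E × G => H (p.1, -p.2)) (q, x) :=
    (hg.continuous_fderiv (by simp)).comp (by fun_prop)
  have hcs : HasCompactSupport fun x : G => fderiv ℝ (fun p : E × G => H (p.1, -p.2)) (q, x) := by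
    refine HasCompactSupport.intro (hK.image continuous_neg) fun x hx => ?_
    have : (fun p : E × G => H (p.1, -p.2)) =ᶠ[𝓝 (q, x)] fun _ => 0 := by
      have hc : IsOpen ((Neg.neg '' K)ᶜ : Set G) :=
        (hK.image continuous_neg).isClosed.isOpen_compl
      filter_upwards [(hs.prod hc).mem_nhds (x := (q, x)) ⟨hq, hx⟩] with p hp
      exact hsupp _ hp.1 _ fun h => hp.2 ⟨_, h, by simp⟩
    rw [this.fderiv_eq]; simp
  simp only [ContinuousLinearMap.comp_apply]
  have := convolution_precompR_apply (μ := μ)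
    (L := (ContinuousLinearMap.lsmul ℝ ℂ : ℂ →L[ℝ] F →L[ℝ] F)) hk hcs hcont 0 (v, (0 : G))
  erw [this]
  simp [convolution_def, hd]

end ParametricIntegral

/-! ### The Cauchy kernel as a fundamental solution -/

section FundamentalSolution

open MeasureTheory

/-- The singularity |w|⁻¹ is integrable in real dimension two. -/
theorem locallyIntegrable_cauchyKernel :
    LocallyIntegrable (fun w : ℂ => (2 * Real.pi * w)⁻¹) volume := by
  refine locallyIntegrable_of_norm_le_rpow (C := (2 * Real.pi)⁻¹) (α := 1) (by simp) (by simp)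
    (Filter.Eventually.of_forall fun x => ?_) (by fun_prop)
  simp [Real.rpow_neg_one, abs_of_pos Real.pi_pos, mul_comm]

/-- In polar coordinates w = r e(θ) the operator is e(θ)(∂_r + (√-1/r) ∂_θ). After multiplication by
the kernel and the Jacobian r the integrand becomes (2π)⁻¹(a + b), where a = ∂_r φ and r b = ∂_θ(√-1
φ). Radial integration of a gives -φ(0) for every θ, and the angular integral of b vanishes by
periodicity. The constant is 2π rather than π because the operator is 2 ∂/∂w̄. -/
theorem integral_cauchyKernel_mul_dbar {φ : ℂ → ℂ} (hφ : ContDiff ℝ 1 φ)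
    (hc : HasCompactSupport φ) :
    ∫ w : ℂ, (2 * Real.pi * w)⁻¹ * (fderiv ℝ φ w 1 + Complex.I * fderiv ℝ φ w Complex.I)
      = -φ 0 := by
  rw [← Complex.integral_comp_polarCoord_symm, polarCoord_target]
  have hd : Continuous (fderiv ℝ φ) := hφ.continuous_fderiv (by simp)
  set e : ℝ → ℂ := fun θ => Real.cos θ + Real.sin θ * Complex.I with he
  set e' : ℝ → ℂ := fun θ => -Real.sin θ + Real.cos θ * Complex.I with he'
  have hcurve : ∀ θ, HasDerivAt e (e' θ) θ := fun θ => by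
    have h1 := (Real.hasDerivAt_cos θ).ofReal_comp
    have h2 := ((Real.hasDerivAt_sin θ).ofReal_comp).mul_const Complex.I
    exact (h1.add h2).congr_deriv (by simp [he'])
  have hec : Continuous e := by rw [he]; fun_prop
  have hec' : Continuous e' := by rw [he']; fun_prop
  have hen : ∀ θ, ‖e θ‖ = 1 := fun θ => by
    simp only [he]
    rw [Complex.ofReal_cos, Complex.ofReal_sin, Complex.cos_add_sin_I, Complex.norm_exp_ofReal_mul_I]
  set a : ℝ × ℝ → ℂ := fun p => fderiv ℝ φ (p.1 * e p.2) (e p.2) with ha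
  set b : ℝ × ℝ → ℂ := fun p => Complex.I * fderiv ℝ φ (p.1 * e p.2) (e' p.2) with hb
  have hac : Continuous a := by
    have : Continuous fun p : ℝ × ℝ => fderiv ℝ φ (p.1 * e p.2) := hd.comp (by fun_prop)
    exact this.clm_apply (by fun_prop)
  have hbc : Continuous b := by
    have : Continuous fun p : ℝ × ℝ => fderiv ℝ φ (p.1 * e p.2) := hd.comp (by fun_prop)
    exact continuous_const.mul (this.clm_apply (by fun_prop))
  obtain ⟨R, hR⟩ := (hc.fderiv ℝ).isCompact.isBounded.subset_closedBall 0
  have hz : ∀ p : ℝ × ℝ, p.1 ∈ Set.Ioi (0 : ℝ) → p.1 ∉ Set.Icc 0 R →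
      fderiv ℝ φ (p.1 * e p.2) = 0 := fun p hp0 hp => by
    by_contra h
    have h1 := hR (subset_tsupport _ (Function.mem_support.2 h))
    simp only [mem_closedBall_zero_iff, norm_mul, hen, mul_one, Complex.norm_real] at h1
    exact hp ⟨le_of_lt hp0, (le_abs_self _).trans h1⟩
  have hint : ∀ f : ℝ × ℝ → ℂ, Continuous f → (∀ p, p.1 ∈ Set.Ioi (0 : ℝ) →
      p.1 ∉ Set.Icc 0 R → f p = 0) →
      IntegrableOn f (Set.Ioi (0 : ℝ) ×ˢ Set.Ioo (-Real.pi) Real.pi) := fun f hf h0 => by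
    have h1 : IntegrableOn f (Set.Icc 0 R ×ˢ Set.Icc (-Real.pi) Real.pi) :=
      hf.continuousOn.integrableOn_compact (isCompact_Icc.prod isCompact_Icc)
    refine (h1.of_forall_sdiff_eq_zero (by measurability) (t := Set.Ioi (0 : ℝ) ×ˢ Set.Ioo (-Real.pi) Real.pi) fun p hp => ?_)
    refine h0 p hp.1.1 fun h => hp.2 ⟨h, hp.1.2.1.le, hp.1.2.2.le⟩
  have hai := hint a hac fun p h h' => by simp [ha, hz p h h']
  have hbi := hint b hbc fun p h h' => by simp [hb, hz p h h']
  have key : ∀ p ∈ Set.Ioi (0 : ℝ) ×ˢ Set.Ioo (-Real.pi) Real.pi,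
      p.1 • ((2 * Real.pi * Complex.polarCoord.symm p)⁻¹ *
        (fderiv ℝ φ (Complex.polarCoord.symm p) 1
          + Complex.I * fderiv ℝ φ (Complex.polarCoord.symm p) Complex.I))
      = (2 * Real.pi : ℂ)⁻¹ * (a p + b p) := fun p hp => by
    have hp0 : (p.1 : ℂ) ≠ 0 := by exact_mod_cast (ne_of_gt hp.1)
    have hpe : e p.2 ≠ 0 := fun h => by simpa [h] using hen p.2
    have h1 : e p.2 = Real.cos p.2 • (1 : ℂ) + Real.sin p.2 • Complex.I := by simp [he]
    have h2 : e' p.2 = (-Real.sin p.2) • (1 : ℂ) + Real.cos p.2 • Complex.I := by simp [he']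
    have hs : Complex.polarCoord.symm p = p.1 * e p.2 := by simp [he]
    have hpi : (Real.pi : ℂ) ≠ 0 := by exact_mod_cast Real.pi_ne_zero
    rw [hs]
    set T := fderiv ℝ φ (p.1 * e p.2) with hT
    have h3 : a p + b p = (e p.2)⁻¹ * (T 1 + Complex.I * T Complex.I) := by
      have hcs : (Real.cos p.2 : ℂ) ^ 2 + (Real.sin p.2 : ℂ) ^ 2 = 1 := by
        exact_mod_cast Real.cos_sq_add_sin_sq p.2
      have hinv : (e p.2)⁻¹ = Real.cos p.2 - Real.sin p.2 * Complex.I := by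
        refine inv_eq_of_mul_eq_one_left ?_
        simp only [he]
        linear_combination hcs - (Real.sin p.2 : ℂ) ^ 2 * Complex.I_sq
      simp only [ha, hb, ← hT]
      rw [hinv, h1, h2, map_add, map_add, map_smul, map_smul, map_smul, map_smul]
      simp only [Complex.real_smul, Complex.ofReal_neg]
      linear_combination (-(Real.sin p.2 : ℂ) * T Complex.I) * Complex.I_sq * (-1)
    rw [h3, Complex.real_smul]
    field_simp
  rw [setIntegral_congr_fun (by measurability) key]
  rw [integral_const_mul, integral_add hai hbi]
  have hA : ∫ p in Set.Ioi (0 : ℝ) ×ˢ Set.Ioo (-Real.pi) Real.pi, a p = -(2 * Real.pi) * φ 0 := by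
    have h1 : ∀ θ, ∫ r in Set.Ioi (0 : ℝ), a (r, θ) = -φ 0 := fun θ => by
      have h2 : ContDiff ℝ 1 fun r : ℝ => φ (r * e θ) :=
        hφ.comp (Complex.ofRealCLM.contDiff.mul contDiff_const)
      have h3 : HasCompactSupport fun r : ℝ => φ (r * e θ) := by
        obtain ⟨R', hR'⟩ := hc.isCompact.isBounded.subset_closedBall 0
        refine HasCompactSupport.intro (isCompact_closedBall (0 : ℝ) R') fun r hr => ?_
        by_contra h
        have h1 := hR' (subset_tsupport _ (Function.mem_support.2 h))
        simp only [mem_closedBall_zero_iff, norm_mul, hen, mul_one, Complex.norm_real] at h1 hr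
        exact hr h1
      have h4 := h3.integral_Ioi_deriv_eq h2 0
      simp only [Complex.ofReal_zero, zero_mul] at h4
      rw [← h4]
      refine integral_congr_ae (Filter.Eventually.of_forall fun r => ?_)
      have h5 : HasDerivAt (fun r : ℝ => (r : ℂ) * e θ) (e θ) r := by
        simpa using (Complex.ofRealCLM.hasDerivAt (x := r)).mul_const (e θ)
      exact (((hφ.differentiable (by simp)) _).hasFDerivAt.comp_hasDerivAt r h5).deriv.symm
    rw [Measure.volume_eq_prod, ← setIntegral_prod_swap, setIntegral_prod]
    · simp only [Prod.swap, h1]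
      simp [Real.pi_pos.le, two_mul]
      ring
    · exact hai.swap
  have hB : ∫ p in Set.Ioi (0 : ℝ) ×ˢ Set.Ioo (-Real.pi) Real.pi, b p = 0 := by
    rw [Measure.volume_eq_prod, setIntegral_prod _ hbi]
    refine setIntegral_eq_zero_of_forall_eq_zero fun r hr => ?_
    have hr0 : (r : ℂ) ≠ 0 := by exact_mod_cast (ne_of_gt hr)
    have h1 : ∀ θ, HasDerivAt (fun θ => Complex.I * φ (r * e θ)) (r * b (r, θ)) θ := fun θ => by
      have h2 : HasDerivAt (fun θ => (r : ℂ) * e θ) (r * e' θ) θ := (hcurve θ).const_mul _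
      have h3 := (((hφ.differentiable (by simp)) _).hasFDerivAt.comp_hasDerivAt θ h2).const_mul
        Complex.I
      refine h3.congr_deriv ?_
      have : (r : ℂ) * e' θ = r • e' θ := by simp
      rw [this, map_smul]
      simp only [hb, Complex.real_smul]
      ring
    rw [← integral_Ioc_eq_integral_Ioo,
      ← intervalIntegral.integral_of_le (by linarith [Real.pi_pos])]
    have h4 := intervalIntegral.integral_eq_sub_of_hasDerivAt (a := -Real.pi) (b := Real.pi)
      (fun θ _ => h1 θ)
      ((continuous_const.mul (hbc.comp (by fun_prop))).intervalIntegrable _ _)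
    rw [intervalIntegral.integral_const_mul] at h4
    have h5 : e (-Real.pi) = e Real.pi := by simp [he]
    rw [h5, sub_self] at h4
    exact (mul_eq_zero.1 h4).resolve_left hr0
  rw [hA, hB]
  have hpi : (Real.pi : ℂ) ≠ 0 := by exact_mod_cast Real.pi_ne_zero
  field_simp
  simp

end FundamentalSolution

/-! ### Germs of smooth functions and derivatives along complexified vectors -/

section Germs

open Filter

variable {E F F' : Type*} [NormedAddCommGroup E] [NormedSpace ℝ E]
  [NormedAddCommGroup F] [NormedSpace ℝ F] [NormedAddCommGroup F'] [NormedSpace ℝ F'] {q₀ : E}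

/-- `f` is smooth in a neighbourhood of `q₀`. -/
def SmoothNear (f : E → F) (q₀ : E) : Prop :=
  ∀ᶠ q in 𝓝 q₀, ContDiffAt ℝ ∞ f q

/-- The derivative of `f` along the complexified vector `D.1 + √-1 D.2`. -/
def cDeriv (D : E × E) (f : E → ℂ) (q : E) : ℂ :=
  fderiv ℝ f q D.1 + Complex.I * fderiv ℝ f q D.2

theorem SmoothNear.fderiv {f : E → F} (hf : SmoothNear f q₀) : SmoothNear (fderiv ℝ f) q₀ :=
  hf.mono fun _ h => h.fderiv_right (m := ∞) (by simp)

theorem SmoothNear.clm_apply {f : E → F →L[ℝ] F'} {g : E → F} (hf : SmoothNear f q₀)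
    (hg : SmoothNear g q₀) : SmoothNear (fun q => f q (g q)) q₀ := by
  filter_upwards [hf, hg] with q h1 h2 using h1.clm_apply h2

theorem smoothNear_const (c : F) : SmoothNear (fun _ : E => c) q₀ :=
  Eventually.of_forall fun _ => contDiffAt_const

theorem SmoothNear.add {f g : E → F} (hf : SmoothNear f q₀) (hg : SmoothNear g q₀) :
    SmoothNear (fun q => f q + g q) q₀ := by
  filter_upwards [hf, hg] with q h1 h2 using h1.add h2

theorem SmoothNear.sub {f g : E → F} (hf : SmoothNear f q₀) (hg : SmoothNear g q₀) :
    SmoothNear (fun q => f q - g q) q₀ := by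
  filter_upwards [hf, hg] with q h1 h2 using h1.sub h2

theorem SmoothNear.clm_comp (L : F →L[ℝ] F') {f : E → F} (hf : SmoothNear f q₀) :
    SmoothNear (fun q => L (f q)) q₀ :=
  hf.mono fun _ h => L.contDiff.contDiffAt.comp _ h

theorem SmoothNear.differentiable {f : E → F} (hf : SmoothNear f q₀) :
    ∀ᶠ q in 𝓝 q₀, DifferentiableAt ℝ f q :=
  hf.mono fun _ h => h.differentiableAt (by simp)

theorem SmoothNear.cDeriv {f : E → ℂ} (hf : SmoothNear f q₀) (D : E × E) :
    SmoothNear (cDeriv D f) q₀ :=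
  (hf.fderiv.clm_apply (smoothNear_const _)).add
    ((hf.fderiv.clm_apply (smoothNear_const D.2)).clm_comp (ContinuousLinearMap.mul ℝ ℂ Complex.I))

theorem cDeriv_add {f g : E → ℂ} (D : E × E) {q : E} (hf : DifferentiableAt ℝ f q)
    (hg : DifferentiableAt ℝ g q) : cDeriv D (fun q => f q + g q) q = cDeriv D f q + cDeriv D g q := by
  simp only [cDeriv, fderiv_fun_add hf hg, add_apply]
  ring

theorem cDeriv_sub {f g : E → ℂ} (D : E × E) {q : E} (hf : DifferentiableAt ℝ f q)
    (hg : DifferentiableAt ℝ g q) : cDeriv D (fun q => f q - g q) q = cDeriv D f q - cDeriv D g q := by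
  simp only [cDeriv, fderiv_fun_sub hf hg, sub_apply]
  ring

theorem cDeriv_congr {f g : E → ℂ} (D : E × E) (h : f =ᶠ[𝓝 q₀] g) :
    cDeriv D f =ᶠ[𝓝 q₀] cDeriv D g := by
  filter_upwards [h.eventually_nhds] with q hq
  simp only [cDeriv, EventuallyEq.fderiv_eq hq]

theorem fderiv_fderiv_apply {f : E → F} {q : E} (hf : ContDiffAt ℝ ∞ f q) (v w : E) :
    fderiv ℝ (fun y => fderiv ℝ f y v) q w = fderiv ℝ (fderiv ℝ f) q w v := by
  have h : DifferentiableAt ℝ (fderiv ℝ f) q :=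
    (hf.fderiv_right (m := ∞) (by simp)).differentiableAt (by simp)
  rw [fderiv_clm_apply h (differentiableAt_const v)]
  simp

theorem fderiv_fderiv_symm {f : E → F} {q : E} (hf : ContDiffAt ℝ ∞ f q) (v w : E) :
    fderiv ℝ (fderiv ℝ f) q v w = fderiv ℝ (fderiv ℝ f) q w v :=
  (hf.isSymmSndFDerivAt (by
    simpa [minSmoothness_of_isRCLikeNormedField] using ENat.LEInfty.out)).eq v w

theorem cDeriv_cDeriv {f : E → ℂ} {q : E} (hf : ContDiffAt ℝ ∞ f q) (D D' : E × E) :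
    cDeriv D (cDeriv D' f) q = fderiv ℝ (fderiv ℝ f) q D.1 D'.1
      + Complex.I * fderiv ℝ (fderiv ℝ f) q D.1 D'.2
      + Complex.I * (fderiv ℝ (fderiv ℝ f) q D.2 D'.1
        + Complex.I * fderiv ℝ (fderiv ℝ f) q D.2 D'.2) := by
  have h : DifferentiableAt ℝ (fderiv ℝ f) q :=
    (hf.fderiv_right (m := ∞) (by simp)).differentiableAt (by simp)
  have h1 : ∀ v, DifferentiableAt ℝ (fun y => fderiv ℝ f y v) q := fun v =>
    h.clm_apply (differentiableAt_const v)
  have h2 : ∀ w, fderiv ℝ (cDeriv D' f) q w = fderiv ℝ (fderiv ℝ f) q w D'.1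
      + Complex.I * fderiv ℝ (fderiv ℝ f) q w D'.2 := fun w => by
    unfold cDeriv
    rw [fderiv_fun_add (h1 _) ((h1 _).const_mul _), fderiv_const_mul (h1 _)]
    simp [fderiv_fderiv_apply hf]
  rw [cDeriv, h2, h2]

theorem cDeriv_comm {f : E → ℂ} {q : E} (hf : ContDiffAt ℝ ∞ f q) (D D' : E × E) :
    cDeriv D (cDeriv D' f) q = cDeriv D' (cDeriv D f) q := by
  rw [cDeriv_cDeriv hf, cDeriv_cDeriv hf, fderiv_fderiv_symm hf D.1 D'.1,
    fderiv_fderiv_symm hf D.1 D'.2, fderiv_fderiv_symm hf D.2 D'.1, fderiv_fderiv_symm hf D.2 D'.2]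
  ring

/-- Multiplication by a bump function. Convolution needs global, compactly supported representatives
of germs. -/
theorem SmoothNear.exists_contDiff [FiniteDimensional ℝ E] {f : E → F} (hf : SmoothNear f q₀) :
    ∃ g : E → F, ContDiff ℝ ∞ g ∧ HasCompactSupport g ∧ g =ᶠ[𝓝 q₀] f := by
  obtain ⟨R, hR, h⟩ := Metric.eventually_nhds_iff_ball.1 hf
  let χ : ContDiffBump q₀ := ⟨R / 3, R / 2, by positivity, by linarith⟩
  refine ⟨fun q => χ q • f q, ?_, ?_, ?_⟩
  · rw [contDiff_iff_contDiffAt]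
    intro q
    by_cases hq : q ∈ Metric.ball q₀ R
    · exact χ.contDiffAt.smul (h q hq)
    · refine (contDiffAt_const (c := (0 : F))).congr_of_eventuallyEq ?_
      have h1 : q ∉ tsupport χ := by
        rw [χ.tsupport_eq]
        intro h2
        simp only [Metric.mem_closedBall, Metric.mem_ball, not_lt, χ] at h2 hq
        linarith
      filter_upwards [(isClosed_tsupport χ).isOpen_compl.mem_nhds h1] with y hy
      rw [image_eq_zero_of_notMem_tsupport hy, zero_smul]
  · exact χ.hasCompactSupport.smul_right
  · filter_upwards [χ.eventuallyEq_one] with q hq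
    simp [hq]

end Germs

/-! ### One equation, solved by convolution along its own directions -/

section Solver

open Filter MeasureTheory

variable {E G : Type*} [NormedAddCommGroup E] [NormedSpace ℝ E] [FiniteDimensional ℝ E]
  [NormedAddCommGroup G] [NormedSpace ℝ G] [FiniteDimensional ℝ G] [MeasurableSpace G]
  [BorelSpace G] {μ : Measure G} {k : G → ℂ}

/-- The partial differential operator along `D`, acting in the directions `A`, has the fundamental
solution `k`. -/
def IsFundamental (μ : Measure G) (k : G → ℂ) (A : G →L[ℝ] E) (D : E × E) : Prop :=
  LocallyIntegrable k μ ∧ ∀ g : E → ℂ, ContDiff ℝ ∞ g → HasCompactSupport g → ∀ q,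
    ∫ w, k w * cDeriv D g (q - A w) ∂μ = g q

/-- The solution is the convolution of `k` along the range of `A` with a cut-off of `g`. Operators
D' along ker P commute with this convolution and do not see a cut-off which depends only on P q.
Hence D' f = 0 near q₀, provided D' g = 0 at those points of the fibre q - A(G) which the cut-off
retains. The cut-off is narrow enough to keep these points near q₀. -/
theorem IsFundamental.exists_solution {A : G →L[ℝ] E} {P : E →L[ℝ] G} (hPA : ∀ w, P (A w) = w)
    {D : E × E} (hk : IsFundamental μ k A D) {q₀ : E} {g : E → ℂ} (hg : SmoothNear g q₀)
    (S : Finset (E × E)) (hSP : ∀ D' ∈ S, P D'.1 = 0 ∧ P D'.2 = 0)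
    (hS : ∀ D' ∈ S, ∀ᶠ q in 𝓝 q₀, cDeriv D' g q = 0) :
    ∃ f, SmoothNear f q₀ ∧ (∀ᶠ q in 𝓝 q₀, cDeriv D f q = g q) ∧
      ∀ D' ∈ S, ∀ᶠ q in 𝓝 q₀, cDeriv D' f q = 0 := by
  obtain ⟨g', hg's, hg'c, hg'⟩ := hg.exists_contDiff
  have hS' : ∀ᶠ q in 𝓝 q₀, ∀ D' ∈ S, cDeriv D' g' q = 0 := by
    refine (S.eventually_all).2 fun D' hD' => ?_
    filter_upwards [hS D' hD', cDeriv_congr D' hg'] with q h1 h2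
    rw [h2, h1]
  obtain ⟨R, hR, hball⟩ := Metric.eventually_nhds_iff_ball.1 hS'
  -- δ is the width of the cut-off in P q, and the radius `r` below bounds q. The retained points q
  -- - A w are at distance at most (1 + ‖A‖‖P‖) r + ‖A‖ δ < R/2 + R/2 from q₀.
  set δ : ℝ := R / (2 * (‖A‖ + 1)) with hδ
  have hδ0 : 0 < δ := by positivity
  let χ : ContDiffBump (P q₀) := ⟨δ / 2, δ, by positivity, by linarith⟩
  set g₁ : E → ℂ := fun q => (χ (P q) : ℂ) * g' q with hg₁
  have hχs : ContDiff ℝ ∞ fun q => (χ (P q) : ℂ) :=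
    Complex.ofRealCLM.contDiff.comp (χ.contDiff.comp P.contDiff)
  have hg₁s : ContDiff ℝ ∞ g₁ := hχs.mul hg's
  have hg₁c : HasCompactSupport g₁ := hg'c.mul_left
  have hg₁g : ∀ᶠ q in 𝓝 q₀, g₁ q = g q := by
    have h1 : ∀ᶠ q in 𝓝 q₀, χ (P q) = 1 :=
      (P.continuous.tendsto q₀).eventually χ.eventuallyEq_one
    filter_upwards [h1, hg'] with q h1 h2
    simp [hg₁, h1, h2]
  set r : ℝ := R / (2 * (1 + ‖A‖ * ‖P‖)) with hr
  have hr0 : 0 < r := by positivity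
  have hgD : ∀ D' ∈ S, ∀ q ∈ Metric.ball q₀ r, ∀ w, cDeriv D' g₁ (q - A w) = 0 := by
    intro D' hD' q hq w
    have h1 : cDeriv D' g₁ (q - A w) = χ (P (q - A w)) * cDeriv D' g' (q - A w) := by
      have h2 : ∀ v, P v = 0 → fderiv ℝ g₁ (q - A w) v
          = χ (P (q - A w)) * fderiv ℝ g' (q - A w) v := by
        intro v hv
        have e1 : HasFDerivAt (fun q => (χ (P q) : ℂ)) _ (q - A w) :=
          Complex.ofRealCLM.hasFDerivAt.comp (q - A w)
            (((χ.contDiff (n := 1)).differentiable (by simp) _).hasFDerivAt.comp (q - A w)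
              P.hasFDerivAt)
        have e2 := (hg's.differentiable (by simp) (q - A w)).hasFDerivAt
        have e3 : HasFDerivAt g₁ _ (q - A w) := e1.mul e2
        rw [e3.fderiv]
        simp [hv]
      rw [cDeriv, cDeriv, h2 _ (hSP D' hD').1, h2 _ (hSP D' hD').2]
      ring
    rw [h1]
    by_cases hw : P (q - A w) ∈ Metric.ball (P q₀) δ
    · rw [hball (q - A w) ?_ D' hD', mul_zero]
      -- Splitting along ker P ⊕ range A: the ker P part comes from q - q₀ alone, and the other part
      -- is controlled by the cut-off, however large w is.
      have e1 : q - A w - q₀ = (q - q₀) - A (P (q - q₀)) + A (P (q - A w) - P q₀) := by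
        simp only [map_sub, hPA]; abel
      rw [Metric.mem_ball, dist_eq_norm] at hq hw ⊢
      rw [e1]
      have b1 : ‖A (P (q - q₀))‖ ≤ ‖A‖ * ‖P‖ * ‖q - q₀‖ := by
        refine (A.le_opNorm _).trans ?_
        rw [mul_assoc]
        exact mul_le_mul_of_nonneg_left (P.le_opNorm _) (norm_nonneg _)
      have b2 : ‖A (P (q - A w) - P q₀)‖ ≤ ‖A‖ * δ :=
        (A.le_opNorm _).trans (mul_le_mul_of_nonneg_left hw.le (norm_nonneg _))
      have b3 : ‖A‖ * δ < R / 2 := by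
        rw [hδ, ← mul_div_assoc, div_lt_div_iff₀ (by positivity) (by positivity)]
        nlinarith [norm_nonneg A]
      have b4 : (1 + ‖A‖ * ‖P‖) * ‖q - q₀‖ ≤ R / 2 := by
        have : (1 + ‖A‖ * ‖P‖) * ‖q - q₀‖ ≤ (1 + ‖A‖ * ‖P‖) * r :=
          mul_le_mul_of_nonneg_left hq.le (by positivity)
        refine this.trans (le_of_eq ?_)
        rw [hr]
        have : 1 + ‖A‖ * ‖P‖ ≠ 0 := by positivity
        field_simp
      have b5 := norm_add_le ((q - q₀) - A (P (q - q₀))) (A (P (q - A w) - P q₀))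
      have b6 := norm_sub_le (q - q₀) (A (P (q - q₀)))
      linarith
    · have : χ (P (q - A w)) = 0 := χ.zero_of_le_dist (by simpa [χ] using hw)
      rw [this, Complex.ofReal_zero, zero_mul]
  -- the solution
  set K : Set G := (fun p : E × E => P p.1 - P p.2) '' (Metric.closedBall q₀ 1 ×ˢ tsupport g₁)
  have hK : IsCompact K := by
    have := ((isCompact_closedBall q₀ 1).prod hg₁c.isCompact).image
      (f := fun p : E × E => P p.1 - P p.2) (by fun_prop)
    exact this
  set H : E × G → ℂ := fun p => g₁ (p.1 - A p.2) with hH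
  have hHs : ContDiff ℝ ∞ H := hg₁s.comp (contDiff_fst.sub (A.contDiff.comp contDiff_snd))
  have hsupp : ∀ q ∈ Metric.ball q₀ 1, ∀ w ∉ K, H (q, w) = 0 := by
    intro q hq w hw
    by_contra h
    exact hw ⟨(q, q - A w), ⟨Metric.ball_subset_closedBall hq,
      subset_tsupport _ (Function.mem_support.2 h)⟩, by simp [hPA]⟩
  have hfd : ∀ q ∈ Metric.ball q₀ 1, ∀ v,
      fderiv ℝ (fun q => ∫ w, k w • H (q, w) ∂μ) q v = ∫ w, k w * fderiv ℝ g₁ (q - A w) v ∂μ := by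
    intro q hq v
    rw [hasFDerivAt_integral_smul hk.1 hHs Metric.isOpen_ball hK hsupp hq]
    refine integral_congr_ae (Eventually.of_forall fun w => ?_)
    have e1 : HasFDerivAt H _ (q, w) :=
      HasFDerivAt.comp (q, w) (g := g₁) (f := fun p : E × G => p.1 - A p.2)
        ((hg₁s.differentiable (by simp)) _).hasFDerivAt
        (hasFDerivAt_fst.sub (A.hasFDerivAt.comp (q, w) hasFDerivAt_snd))
    simp only [e1.fderiv]
    simp
  have hint : ∀ q ∈ Metric.ball q₀ 1, ∀ v,
      Integrable (fun w => k w * fderiv ℝ g₁ (q - A w) v) μ := by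
    intro q hq v
    have h1 : Continuous fun w => fderiv ℝ g₁ (q - A w) v :=
      ((hg₁s.continuous_fderiv (by simp)).comp (by fun_prop)).clm_apply continuous_const
    have h2 : HasCompactSupport fun w => fderiv ℝ g₁ (q - A w) v := by
      refine HasCompactSupport.intro hK fun w hw => ?_
      have : q - A w ∉ tsupport g₁ := fun h =>
        hw ⟨(q, q - A w), ⟨Metric.ball_subset_closedBall hq, h⟩, by simp [hPA]⟩
      rw [image_eq_zero_of_notMem_tsupport fun h => this (tsupport_fderiv_subset ℝ h)]
      rfl
    simpa [mul_comm] using hk.1.integrable_smul_left_of_hasCompactSupport h1 h2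
  have hcd : ∀ q ∈ Metric.ball q₀ 1, ∀ D',
      cDeriv D' (fun q => ∫ w, k w • H (q, w) ∂μ) q = ∫ w, k w * cDeriv D' g₁ (q - A w) ∂μ := by
    intro q hq D'
    rw [cDeriv, hfd q hq, hfd q hq, ← integral_const_mul, ← integral_add (hint q hq _)
      ((hint q hq _).const_mul _)]
    refine integral_congr_ae (Eventually.of_forall fun w => ?_)
    simp only [cDeriv]
    ring
  refine ⟨fun q => ∫ w, k w • H (q, w) ∂μ, ?_, ?_, fun D' hD' => ?_⟩
  · have := contDiffOn_integral_smul hk.1 hHs Metric.isOpen_ball hK hsupp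
    filter_upwards [Metric.isOpen_ball.mem_nhds (Metric.mem_ball_self one_pos)] with q hq
    exact this.contDiffAt (Metric.isOpen_ball.mem_nhds hq)
  · filter_upwards [Metric.isOpen_ball.mem_nhds (Metric.mem_ball_self one_pos), hg₁g] with q hq h
    rw [hcd q hq, hk.2 g₁ hg₁s hg₁c, h]
  · filter_upwards [Metric.isOpen_ball.mem_nhds (Metric.mem_ball_self one_pos),
      Metric.isOpen_ball.mem_nhds (Metric.mem_ball_self hr0)] with q hq hq'
    rw [hcd q hq]
    simp [hgD D' hD' q hq']

/-- The Heaviside function inverts d/dt: integrating the derivative of g along the half-line q - t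
e, t > 0, leaves g(q). The functional `P` bounds t on the support of g, so g has compact support on
the line. -/
theorem isFundamental_line {E : Type*} [NormedAddCommGroup E] [NormedSpace ℝ E]
    {e : E} {P : E →L[ℝ] ℝ} (hP : P e = 1) :
    IsFundamental volume (Set.indicator (Set.Ioi (0 : ℝ)) fun _ => (1 : ℂ))
      (ContinuousLinearMap.toSpanSingleton ℝ e) (e, 0) := by
  refine ⟨(locallyIntegrable_const (1 : ℂ)).indicator measurableSet_Ioi, fun g hg hc q => ?_⟩
  set φ : ℝ → ℂ := fun t => g (q - t • e) with hφ
  have h1 : ContDiff ℝ 1 φ := (hg.of_le (by exact_mod_cast le_top)).comp (by fun_prop)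
  have h2 : HasCompactSupport φ := by
    refine HasCompactSupport.intro (hc.isCompact.image (f := fun y => P q - P y) (by fun_prop))
      fun t ht => ?_
    by_contra h
    exact ht ⟨q - t • e, subset_tsupport _ (Function.mem_support.2 h), by simp [hP]⟩
  have h3 := h2.integral_Ioi_deriv_eq h1 0
  have h4 : ∀ t, deriv φ t = -cDeriv (e, 0) g (q - t • e) := fun t => by
    have h5 : HasDerivAt (fun t : ℝ => q - t • e) (-e) t := by
      simpa using ((hasDerivAt_id t).smul_const e).const_sub q
    have h6 := ((hg.differentiable (by simp)) _).hasFDerivAt.comp_hasDerivAt t h5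
    have h7 : φ = g ∘ fun t : ℝ => q - t • e := rfl
    rw [h7, h6.deriv, cDeriv]
    simp
  simp only [h4, integral_neg, neg_inj] at h3
  have h7 : ∀ t : ℝ, Set.indicator (Set.Ioi (0 : ℝ)) (fun _ => (1 : ℂ)) t *
      cDeriv (e, 0) g (q - (ContinuousLinearMap.toSpanSingleton ℝ e) t)
      = Set.indicator (Set.Ioi (0 : ℝ)) (fun t => cDeriv (e, 0) g (q - t • e)) t := fun t => by
    by_cases ht : t ∈ Set.Ioi (0 : ℝ) <;> simp [ht]
  simp only [h7]
  rw [integral_indicator measurableSet_Ioi, h3]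
  simp [hφ]

/-- On the complex line q - ℂ e the operator along (e, √-1 e) is 2 ∂̄ up to sign, and the Cauchy
kernel inverts it. -/
theorem isFundamental_dbar {E : Type*} [NormedAddCommGroup E] [NormedSpace ℂ E]
    {e : E} {P : E →L[ℂ] ℂ} (hP : P e = 1) :
    IsFundamental volume (fun w : ℂ => (2 * Real.pi * w)⁻¹)
      ((ContinuousLinearMap.toSpanSingleton ℂ e).restrictScalars ℝ) (e, Complex.I • e) := by
  refine ⟨locallyIntegrable_cauchyKernel, fun g hg hc q => ?_⟩
  set φ : ℂ → ℂ := fun t => g (q - t • e) with hφ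
  have h1 : ContDiff ℝ 1 φ := by
    refine (hg.of_le (by exact_mod_cast le_top)).comp (contDiff_const.sub ?_)
    exact ((ContinuousLinearMap.toSpanSingleton ℂ e).restrictScalars ℝ).contDiff
  have h2 : HasCompactSupport φ := by
    refine HasCompactSupport.intro (hc.isCompact.image (f := fun y => P q - P y) (by fun_prop))
      fun t ht => ?_
    by_contra h
    exact ht ⟨q - t • e, subset_tsupport _ (Function.mem_support.2 h), by simp [hP]⟩
  have h3 := integral_cauchyKernel_mul_dbar h1 h2
  have h4 : ∀ t v, fderiv ℝ φ t v = -fderiv ℝ g (q - t • e) (v • e) := fun t v => by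
    have h5 : HasFDerivAt (fun t : ℂ => q - t • e)
        (-((ContinuousLinearMap.toSpanSingleton ℂ e).restrictScalars ℝ)) t :=
      ((ContinuousLinearMap.toSpanSingleton ℂ e).restrictScalars ℝ).hasFDerivAt.const_sub q
    have h6 := HasFDerivAt.comp t ((hg.differentiable (by simp)) _).hasFDerivAt h5
    have h7 : φ = g ∘ fun t : ℂ => q - t • e := rfl
    rw [h7, h6.fderiv]
    simp
  simp only [h4, one_smul] at h3
  rw [← neg_inj, ← integral_neg]
  simp only [hφ, zero_smul, sub_zero] at h3
  rw [← h3]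
  refine integral_congr_ae (Eventually.of_forall fun w => ?_)
  simp only [cDeriv, ContinuousLinearMap.coe_restrictScalars',
    ContinuousLinearMap.toSpanSingleton_apply]
  ring

end Solver

/-! ### Compatible systems of equations -/

section System

open Filter

variable {E : Type*} [NormedAddCommGroup E] [NormedSpace ℝ E] {q₀ : E}

/-- A compatible system `D_α f = B_α` is solvable near `q₀` if each single equation is solvable
within the solutions of the other homogeneous equations. -/
theorem exists_solution_of_system {ι : Type*} [Finite ι] {D : ι → E × E}
    (hD : ∀ (α : ι) (s : Finset ι), α ∉ s → ∀ g : E → ℂ, SmoothNear g q₀ →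
      (∀ β ∈ s, ∀ᶠ q in 𝓝 q₀, cDeriv (D β) g q = 0) →
      ∃ f, SmoothNear f q₀ ∧ (∀ᶠ q in 𝓝 q₀, cDeriv (D α) f q = g q) ∧
        ∀ β ∈ s, ∀ᶠ q in 𝓝 q₀, cDeriv (D β) f q = 0)
    {B : ι → E → ℂ} (hB : ∀ α, SmoothNear (B α) q₀)
    (hcomp : ∀ α β, ∀ᶠ q in 𝓝 q₀, cDeriv (D α) (B β) q = cDeriv (D β) (B α) q) :
    ∃ f, SmoothNear f q₀ ∧ ∀ α, ∀ᶠ q in 𝓝 q₀, cDeriv (D α) f q = B α q := by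
  classical
  have := Fintype.ofFinite ι
  have key : ∀ s : Finset ι, ∃ f, SmoothNear f q₀ ∧
      ∀ α ∈ s, ∀ᶠ q in 𝓝 q₀, cDeriv (D α) f q = B α q := by
    intro s
    induction s using Finset.induction_on with
    | empty => exact ⟨fun _ => 0, smoothNear_const 0, by simp⟩
    | insert α s hα ih =>
      obtain ⟨f, hf, hfs⟩ := ih
      -- The defect of f in the new equation is annihilated by the operators already treated, by
      -- compatibility and because constant coefficient operators commute. A correction f' can
      -- therefore be chosen inside the solutions of their homogeneous equations.
      have hg : SmoothNear (fun q => B α q - cDeriv (D α) f q) q₀ := (hB α).sub (hf.cDeriv _)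
      obtain ⟨f', hf', h1, h2⟩ := hD α s hα _ hg fun β hβ => by
        have e1 := cDeriv_congr (D α) (hfs β hβ)
        filter_upwards [hcomp β α, (hB α).differentiable, (hf.cDeriv (D α)).differentiable, hf, e1]
          with q a1 a2 a3 a4 a5
        rw [cDeriv_sub _ a2 a3, cDeriv_comm a4, a1, sub_eq_zero]
        exact a5.symm
      refine ⟨fun q => f q + f' q, hf.add hf', fun β hβ => ?_⟩
      rcases Finset.mem_insert.1 hβ with rfl | hβ
      · filter_upwards [hf.differentiable, hf'.differentiable, h1] with q a1 a2 a3
        rw [cDeriv_add _ a1 a2, a3, add_sub_cancel]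
      · filter_upwards [hf.differentiable, hf'.differentiable, h2 β hβ, hfs β hβ] with q a1 a2 a3 a4
        rw [cDeriv_add _ a1 a2, a3, a4, add_zero]
  obtain ⟨f, hf, h⟩ := key Finset.univ
  exact ⟨f, hf, fun α => h α (Finset.mem_univ α)⟩

end System

/-! ### The Poincaré lemma -/

section Poincare

open Filter MeasureTheory

variable {E : Type*} [NormedAddCommGroup E] [NormedSpace ℝ E] [FiniteDimensional ℝ E] {q₀ : E}

/-- The 2-form `κ` is alternating and closed near `q₀`. -/
def ClosedNear (κ : E → E →L[ℝ] E →L[ℝ] ℂ) (q₀ : E) : Prop :=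
  ∀ᶠ q in 𝓝 q₀, (∀ v w, κ q v w = -κ q w v) ∧
    ∀ u v w, fderiv ℝ κ q u v w + fderiv ℝ κ q v w u + fderiv ℝ κ q w u v = 0

-- The radial homotopy formula β_q(v) = ∫₀¹ s κ(q₀ + s(q - q₀))(q - q₀, v) ds. The explicit formula
-- also gives the last clause: a direction contracting κ to zero near q₀ is annihilated by β. This
-- later keeps primitives horizontal for the action.
set_option synthInstance.maxHeartbeats 400000 in
set_option maxHeartbeats 1000000 in
theorem exists_primitive_of_closed {κ : E → E →L[ℝ] E →L[ℝ] ℂ} (hκ : SmoothNear κ q₀)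
    (hc : ClosedNear κ q₀) :
    ∃ β : E → E →L[ℝ] ℂ, SmoothNear β q₀ ∧
      (∀ᶠ q in 𝓝 q₀, ∀ v w, fderiv ℝ β q v w - fderiv ℝ β q w v = κ q v w) ∧
      ∀ e, (∀ᶠ q in 𝓝 q₀, ∀ v, κ q e v = 0) → ∀ᶠ q in 𝓝 q₀, β q e = 0 := by
  obtain ⟨κ', hs, -, heq⟩ := hκ.exists_contDiff
  obtain ⟨R, hR, hball⟩ := Metric.eventually_nhds_iff_ball.1 (hc.and heq.eventually_nhds)
  have hpt : ∀ q ∈ Metric.ball q₀ R, ∀ s ∈ Set.Icc (0 : ℝ) 1, q₀ + s • (q - q₀) ∈ Metric.ball q₀ R := by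
    intro q hq s hs
    rw [Metric.mem_ball, dist_eq_norm] at hq ⊢
    rw [add_sub_cancel_left, norm_smul, Real.norm_of_nonneg hs.1]
    nlinarith [hs.2, norm_nonneg (q - q₀)]
  -- The bump function equals 1 on [0, 1], so it does not change the integral. It gives the
  -- integrand the compact support in s that the parametric integral lemmas require.
  let χ : ContDiffBump (0 : ℝ) := ⟨1, 2, by norm_num, by norm_num⟩
  have hχ : ∀ s ∈ Set.Icc (0 : ℝ) 1, χ s = 1 := fun s hs => χ.one_of_mem_closedBall (by
    rw [mem_closedBall_zero_iff, Real.norm_of_nonneg hs.1]; exact hs.2)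
  set k : ℝ → ℂ := Set.indicator (Set.Ioc (0 : ℝ) 1) fun _ => 1 with hkdef
  have hk : LocallyIntegrable k volume := (locallyIntegrable_const (1 : ℂ)).indicator measurableSet_Ioc
  have hkint : ∀ h : ℝ → E →L[ℝ] ℂ,
      ∫ s, k s • h s = ∫ s in (0 : ℝ)..1, h s := by
    intro h
    rw [intervalIntegral.integral_of_le zero_le_one, ← integral_indicator measurableSet_Ioc]
    congr 1
    ext s
    by_cases hs : s ∈ Set.Ioc (0 : ℝ) 1 <;> simp [hkdef, hs]
  set H : E × ℝ → E →L[ℝ] ℂ := fun p =>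
    (χ p.2 * p.2) • κ' (q₀ + p.2 • (p.1 - q₀)) (p.1 - q₀) with hH
  have hHs : ContDiff ℝ ∞ H := by
    refine ContDiff.smul ((χ.contDiff.comp contDiff_snd).mul contDiff_snd) ?_
    exact (hs.comp (by fun_prop)).clm_apply (by fun_prop)
  have hsupp : ∀ q ∈ Metric.ball q₀ R, ∀ s ∉ Metric.closedBall (0 : ℝ) 2, H (q, s) = 0 := by
    intro q _ s hs
    have : χ s = 0 := χ.zero_of_le_dist (by
      simp only [Metric.mem_closedBall, not_le] at hs
      exact hs.le)
    change (χ s * s) • _ = (0 : E →L[ℝ] ℂ)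
    rw [this, zero_mul]
    ext w
    simp
  have hK := isCompact_closedBall (0 : ℝ) 2
  have hβ := contDiffOn_integral_smul hk hHs Metric.isOpen_ball hK hsupp
  have hdβ := fun q (hq : q ∈ Metric.ball q₀ R) v =>
    hasFDerivAt_integral_smul hk hHs Metric.isOpen_ball hK hsupp hq v
  simp only [hkint] at hβ hdβ
  have hnhds := Metric.isOpen_ball.mem_nhds (Metric.mem_ball_self hR : q₀ ∈ Metric.ball q₀ R)
  refine ⟨fun q => ∫ s in (0 : ℝ)..1, H (q, s), ?_, ?_, fun e he => ?_⟩
  · filter_upwards [hnhds] with q hq using hβ.contDiffAt (Metric.isOpen_ball.mem_nhds hq)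
  · filter_upwards [hnhds] with q hq v w
    have hcont : ∀ v w, Continuous fun s => fderiv ℝ H (q, s) (v, 0) w := fun v w =>
      (((hHs.continuous_fderiv (by simp)).comp (by fun_prop)).clm_apply
        continuous_const).clm_apply continuous_const
    have hd : ∀ v w, fderiv ℝ (fun q => ∫ s in (0 : ℝ)..1, H (q, s)) q v w
        = ∫ s in (0 : ℝ)..1, fderiv ℝ H (q, s) (v, 0) w := by
      intro v w
      rw [hdβ q hq v, ContinuousLinearMap.intervalIntegral_apply]
      exact (((hHs.continuous_fderiv (by simp)).comp (by fun_prop)).clm_apply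
        continuous_const).intervalIntegrable _ _
    rw [hd, hd, ← intervalIntegral.integral_sub ((hcont v w).intervalIntegrable _ _)
      ((hcont w v).intervalIntegrable _ _)]
    have hdH : ∀ s ∈ Set.Icc (0 : ℝ) 1, ∀ v w, fderiv ℝ H (q, s) (v, 0) w
        = s * (s * fderiv ℝ κ' (q₀ + s • (q - q₀)) v (q - q₀) w
          + κ' (q₀ + s • (q - q₀)) v w) := by
      intro s hs' v w
      have e1 : HasFDerivAt (fun y : E => q₀ + s • (y - q₀)) (s • ContinuousLinearMap.id ℝ E) q :=
        (((hasFDerivAt_id q).sub_const q₀).const_smul s).const_add q₀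
      have e2 : HasFDerivAt (fun y : E => κ' (q₀ + s • (y - q₀))) _ q :=
        HasFDerivAt.comp q ((hs.differentiable (by simp)) _).hasFDerivAt e1
      have e3 := e2.clm_apply ((hasFDerivAt_id q).sub_const q₀)
      have e4 := e3.const_smul (χ s * s)
      have e5 : HasFDerivAt (fun y : E => H (y, s)) ((fderiv ℝ H (q, s)).comp
          ((ContinuousLinearMap.id ℝ E).prod 0)) q :=
        HasFDerivAt.comp q (f := fun y : E => (y, s)) ((hHs.differentiable (by simp)) _).hasFDerivAt
          ((hasFDerivAt_id q).prodMk (hasFDerivAt_const s q))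
      have e6 := congrArg (fun T => T v w) (e5.unique e4)
      simp only [ContinuousLinearMap.comp_apply, ContinuousLinearMap.prod_apply,
        ContinuousLinearMap.id_apply, zero_apply] at e6
      rw [e6, hχ s hs']
      simp
      ring
    -- Closedness turns the antisymmetrised derivative of the integrand into the radial derivative
    -- of κ, and the whole becomes d/ds (s² κ(v, w)).
    have hder : ∀ s ∈ Set.uIcc (0 : ℝ) 1, HasDerivAt
        (fun s : ℝ => ((s : ℂ) ^ 2) * κ' (q₀ + s • (q - q₀)) v w)
        (fderiv ℝ H (q, s) (v, 0) w - fderiv ℝ H (q, s) (w, 0) v) s := by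
      intro s hs'
      rw [Set.uIcc_of_le zero_le_one] at hs'
      have hy := hpt q hq s hs'
      obtain ⟨⟨halt, hcl⟩, hnear⟩ := hball _ hy
      replace hnear : κ' =ᶠ[𝓝 (q₀ + s • (q - q₀))] κ := hnear
      have e1 : HasDerivAt (fun s : ℝ => q₀ + s • (q - q₀)) (q - q₀) s := by
        simpa using ((hasDerivAt_id s).smul_const (q - q₀)).const_add q₀
      have e2 := ((hs.differentiable (by simp)) (q₀ + s • (q - q₀))).hasFDerivAt.comp_hasDerivAt s e1
      have e3 := (e2.clm_apply (hasDerivAt_const s v)).clm_apply (hasDerivAt_const s w)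
      have e4 : HasDerivAt (fun s : ℝ => (s : ℂ) ^ 2) (2 * s) s := by
        exact ((Complex.ofRealCLM.hasDerivAt (x := s)).pow 2).congr_deriv (by simp)
      refine (e4.mul e3).congr_deriv ?_
      rw [hdH s hs', hdH s hs']
      have hfd := hnear.fderiv_eq (𝕜 := ℝ)
      have halt' : ∀ u a b, fderiv ℝ κ' (q₀ + s • (q - q₀)) u a b
          = -fderiv ℝ κ' (q₀ + s • (q - q₀)) u b a := by
        intro u a b
        have hdiff := (hs.differentiable (by simp)) (q₀ + s • (q - q₀))
        have a1 : ∀ a b, fderiv ℝ (fun y => κ' y a b) (q₀ + s • (q - q₀)) u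
            = fderiv ℝ κ' (q₀ + s • (q - q₀)) u a b := fun a b => by
          have := (hdiff.hasFDerivAt.clm_apply (hasFDerivAt_const a _)).clm_apply
            (hasFDerivAt_const b _)
          rw [this.fderiv]
          simp
        rw [← a1, ← a1, ← neg_apply, ← fderiv_fun_neg]
        refine congrArg (fun T : E →L[ℝ] ℂ => T u) (Filter.EventuallyEq.fderiv_eq ?_)
        filter_upwards [hnear, Metric.isOpen_ball.mem_nhds hy] with y h1 h2
        rw [h1, (hball y h2).1.1 a b]
      have hcl' := hcl v (q - q₀) w
      rw [← hfd] at hcl'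
      have hκ2 : κ' (q₀ + s • (q - q₀)) w v = -κ' (q₀ + s • (q - q₀)) v w := by
        rw [hnear.eq_of_nhds]; exact halt w v
      simp only [Function.comp_apply, map_zero, add_zero]
      have h1 := halt' w v (q - q₀)
      have h2 := halt' (q - q₀) w v
      rw [hκ2]
      linear_combination (-(s : ℂ) ^ 2) * hcl' + (s : ℂ) ^ 2 * h1 + (s : ℂ) ^ 2 * h2
    rw [intervalIntegral.integral_eq_sub_of_hasDerivAt hder
      (((hcont v w).sub (hcont w v)).intervalIntegrable _ _)]
    have : κ' q = κ q := Filter.EventuallyEq.eq_of_nhds (hball q hq).2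
    simp [this]
  · obtain ⟨r, hr, hr'⟩ := Metric.eventually_nhds_iff_ball.1 (he.and heq)
    have hint : ∀ q, IntervalIntegrable (fun s => H (q, s)) volume 0 1 := fun q =>
      (hHs.continuous.comp (by fun_prop)).intervalIntegrable _ _
    filter_upwards [hc, Metric.isOpen_ball.mem_nhds (Metric.mem_ball_self hr), hnhds] with q hq hqr hqR
    rw [ContinuousLinearMap.intervalIntegral_apply (hint q)]
    refine (intervalIntegral.integral_congr (g := fun _ => (0 : ℂ)) fun s hs' => ?_).trans (by simp)
    rw [Set.uIcc_of_le zero_le_one] at hs'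
    have hy : q₀ + s • (q - q₀) ∈ Metric.ball q₀ r := by
      rw [Metric.mem_ball, dist_eq_norm] at hqr ⊢
      rw [add_sub_cancel_left, norm_smul, Real.norm_of_nonneg hs'.1]
      nlinarith [hs'.2, norm_nonneg (q - q₀)]
    have h1 := hr' _ hy
    have h2 := (hball _ (hpt q hqR s hs')).1.1 (q - q₀) e
    change ((χ s * s) • κ' (q₀ + s • (q - q₀)) (q - q₀)) e = 0
    rw [h1.2, smul_apply, h2, h1.1, neg_zero, smul_zero]

end Poincare

/-! ### Real derivatives in complex coordinates and the Levi form -/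

section ComplexCoordinates

variable {ι : Type*} [DecidableEq ι]

theorem I_smul_single (α : ι) : Complex.I • (Pi.single α (1 : ℂ) : ι → ℂ) = Pi.single α Complex.I := by
  rw [← Pi.single_smul]; simp

theorem I_smul_single_I (α : ι) :
    Complex.I • (Pi.single α Complex.I : ι → ℂ) = -Pi.single α (1 : ℂ) := by
  rw [← Pi.single_smul, ← Pi.single_neg]; simp

variable [Fintype ι]

theorem eq_sum_re_im (v : ι → ℂ) :
    v = ∑ α, ((v α).re • (Pi.single α 1 : ι → ℂ) + (v α).im • (Pi.single α Complex.I : ι → ℂ)) := by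
  ext β
  simp only [Finset.sum_apply, Pi.add_apply, Pi.smul_apply]
  rw [Finset.sum_eq_single β (fun b _ hb => by simp [Pi.single_eq_of_ne hb.symm]) (by simp)]
  simp [Complex.re_add_im]

theorem map_eq_sum_re_im {F : Type*} [AddCommGroup F] [Module ℝ F] {T : Type*}
    [FunLike T (ι → ℂ) F] [LinearMapClass T ℝ (ι → ℂ) F] (L : T) (v : ι → ℂ) :
    L v = ∑ α, ((v α).re • L (Pi.single α 1) + (v α).im • L (Pi.single α Complex.I)) := by
  conv_lhs => rw [eq_sum_re_im v]
  simp only [map_sum, map_add, map_smul]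

theorem clm_ext_single {F : Type*} [NormedAddCommGroup F] [NormedSpace ℝ F]
    {L L' : (ι → ℂ) →L[ℝ] F} (h1 : ∀ α, L (Pi.single α 1) = L' (Pi.single α 1))
    (h2 : ∀ α, L (Pi.single α Complex.I) = L' (Pi.single α Complex.I)) : L = L' := by
  ext v
  rw [map_eq_sum_re_im L, map_eq_sum_re_im L']
  simp only [h1, h2]

theorem fderiv_clm_apply₂ {E F G H : Type*} [NormedAddCommGroup E] [NormedSpace ℝ E]
    [NormedAddCommGroup F] [NormedSpace ℝ F] [NormedAddCommGroup G] [NormedSpace ℝ G]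
    [NormedAddCommGroup H] [NormedSpace ℝ H]
    {κ : E → F →L[ℝ] G →L[ℝ] H} {q : E} (h : DifferentiableAt ℝ κ q) (u : E) (v : F) (w : G) :
    fderiv ℝ (fun y => κ y v w) q u = fderiv ℝ κ q u v w := by
  have := (h.hasFDerivAt.clm_apply (hasFDerivAt_const v _)).clm_apply (hasFDerivAt_const w _)
  rw [this.fderiv]
  simp

theorem fderiv_clm_apply₁ {E F G : Type*} [NormedAddCommGroup E] [NormedSpace ℝ E]
    [NormedAddCommGroup F] [NormedSpace ℝ F] [NormedAddCommGroup G] [NormedSpace ℝ G]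
    {β : E → F →L[ℝ] G} {q : E} (h : DifferentiableAt ℝ β q) (u : E) (v : F) :
    fderiv ℝ (fun y => β y v) q u = fderiv ℝ β q u v := by
  have := h.hasFDerivAt.clm_apply (hasFDerivAt_const v _)
  rw [this.fderiv]
  simp

theorem mixedDeriv_eq {K : (ι → ℂ) → ℝ} {ζ : ι → ℂ} (hK : ContDiffAt ℝ ∞ K ζ) (α β : ι) :
    mixedDeriv K α β ζ = (1 / 4) *
      ((fderiv ℝ (fderiv ℝ K) ζ (Pi.single α 1) (Pi.single β 1) : ℝ)
        + Complex.I * (fderiv ℝ (fderiv ℝ K) ζ (Pi.single α 1) (Pi.single β Complex.I) : ℝ)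
        - Complex.I * ((fderiv ℝ (fderiv ℝ K) ζ (Pi.single α Complex.I) (Pi.single β 1) : ℝ)
        + Complex.I * (fderiv ℝ (fderiv ℝ K) ζ (Pi.single α Complex.I)
          (Pi.single β Complex.I) : ℝ))) := by
  have hK2 : ContDiffAt ℝ 2 K ζ := hK.of_le ENat.LEInfty.out
  have hd : ∀ᶠ y in 𝓝 ζ, DifferentiableAt ℝ K y := by
    filter_upwards [hK2.eventually (by simp)] with y hy using hy.differentiableAt (by simp)
  have hfd : DifferentiableAt ℝ (fderiv ℝ K) ζ :=
    (hK.fderiv_right (m := ∞) (by simp)).differentiableAt (by simp)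
  have h1 : wirtingerBar (fun ξ => ((K ξ : ℝ) : ℂ)) β =ᶠ[𝓝 ζ] fun y =>
      (1 / 2) * ((fderiv ℝ K y (Pi.single β 1) : ℂ)
        + Complex.I * (fderiv ℝ K y (Pi.single β Complex.I) : ℂ)) := by
    filter_upwards [hd] with y hy
    have e : HasFDerivAt (fun ξ => ((K ξ : ℝ) : ℂ)) _ y :=
      Complex.ofRealCLM.hasFDerivAt.comp y hy.hasFDerivAt
    rw [wirtingerBar, e.fderiv]
    simp
  have h2 : ∀ v, HasFDerivAt (fun y => (fderiv ℝ K y v : ℂ))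
      (Complex.ofRealCLM.comp ((fderiv ℝ (fderiv ℝ K) ζ).flip v)) ζ := fun v => by
    refine Complex.ofRealCLM.hasFDerivAt.comp ζ ?_
    refine (hfd.hasFDerivAt.clm_apply (hasFDerivAt_const v ζ)).congr_fderiv ?_
    ext u; simp
  have h3 := ((h2 (Pi.single β 1)).add
    ((h2 (Pi.single β Complex.I)).const_mul Complex.I)).const_mul (1 / 2 : ℂ)
  have h4 := h3.congr_of_eventuallyEq h1
  rw [mixedDeriv, wirtinger, h4.fderiv]
  simp
  ring

/-- The Levi form of `K` in terms of its real Hessian. -/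
theorem sum_mixedDeriv {K : (ι → ℂ) → ℝ} {ζ : ι → ℂ} (hK : ContDiffAt ℝ ∞ K ζ) (v w : ι → ℂ) :
    -(Complex.I / 2) * ∑ α, ∑ β, mixedDeriv K α β ζ * (v α * conj (w β) - w α * conj (v β))
      = ((1 / 4 * (fderiv ℝ (fderiv ℝ K) ζ v (Complex.I • w)
        - fderiv ℝ (fderiv ℝ K) ζ w (Complex.I • v)) : ℝ) : ℂ) := by
  set Q := fderiv ℝ (fderiv ℝ K) ζ with hQ
  have hsymm : ∀ a b, Q a b = Q b a := fun a b => fderiv_fderiv_symm hK a b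
  -- S is the form with matrix K_{ζ_α ζ̄_β}, written through the real Hessian Q. It is complex
  -- linear in v and antilinear in w, so expansion in the standard basis gives the double sum. In S
  -- v w - S w v the symmetric part of Q cancels.
  set S : (ι → ℂ) → (ι → ℂ) → ℂ := fun v w => (1 / 4) * ((Q v w : ℝ) + Complex.I * (Q v (Complex.I • w) : ℝ)
    - Complex.I * ((Q (Complex.I • v) w : ℝ) + Complex.I * (Q (Complex.I • v) (Complex.I • w) : ℝ)))
    with hS
  have hII : ∀ u : ι → ℂ, Complex.I • Complex.I • u = -u := fun u => by
    rw [smul_smul, Complex.I_mul_I, neg_one_smul]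
  have addL : ∀ a b w, S (a + b) w = S a w + S b w := fun a b w => by
    simp only [hS, map_add, smul_add, add_apply]; push_cast; ring
  have addR : ∀ a v w, S a (v + w) = S a v + S a w := fun a b w => by
    simp only [hS, map_add, smul_add]; push_cast; ring
  have e1 : ∀ (c : ℂ) (u : ι → ℂ), c • u = c.re • u + c.im • (Complex.I • u) := fun c u => by
    ext i; simp only [Pi.add_apply, Pi.smul_apply, Complex.real_smul, smul_eq_mul]
    conv_lhs => rw [← Complex.re_add_im c]
    ring
  have smulL : ∀ (c : ℂ) v w, S (c • v) w = c * S v w := fun c v w => by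
    rw [e1 c]
    simp only [hS, map_add, smul_add, map_smul, add_apply, smul_apply,
      smul_comm Complex.I (_ : ℝ), hII, map_neg, neg_apply]
    conv_rhs => rw [← Complex.re_add_im c]
    simp only [smul_eq_mul]
    push_cast
    ring_nf
    simp only [Complex.I_sq, show Complex.I ^ 3 = -Complex.I by rw [pow_succ, Complex.I_sq]; ring]
    ring
  have smulR : ∀ (c : ℂ) v w, S v (c • w) = conj c * S v w := fun c v w => by
    rw [e1 c]
    simp only [hS, map_add, smul_add, map_smul, smul_comm Complex.I (_ : ℝ), hII,
      map_neg]
    have e2 : conj c = c.re - c.im * Complex.I := by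
      apply Complex.ext <;> simp
    rw [e2]
    simp only [smul_eq_mul]
    push_cast
    ring_nf
    simp only [Complex.I_sq, show Complex.I ^ 3 = -Complex.I by rw [pow_succ, Complex.I_sq]; ring]
    ring
  have sumL : ∀ (f : ι → ι → ℂ) w, S (∑ α, f α) w = ∑ α, S (f α) w := fun f w =>
    map_sum (⟨⟨fun v => S v w, by simpa using smulL 0 0 w⟩, fun a b => addL a b w⟩ : (ι → ℂ) →+ ℂ) f _
  have sumR : ∀ (f : ι → ι → ℂ) v, S v (∑ α, f α) = ∑ α, S v (f α) := fun f v =>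
    map_sum (⟨⟨fun w => S v w, by simpa using smulR 0 v 0⟩, fun a b => addR v a b⟩ : (ι → ℂ) →+ ℂ) f _
  have hv : ∀ v : ι → ℂ, v = ∑ α, v α • Pi.single α (1 : ℂ) := fun v => by
    ext β
    simp only [Finset.sum_apply, Pi.smul_apply]
    rw [Finset.sum_eq_single β (fun b _ hb => by simp [Pi.single_eq_of_ne hb.symm]) (by simp)]
    simp
  have hm : ∀ α β, mixedDeriv K α β ζ = S (Pi.single α 1) (Pi.single β 1) := fun α β => by
    rw [mixedDeriv_eq hK]
    simp only [hS, I_smul_single]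
    rw [hQ]
  have key : ∀ v w, S v w = ∑ α, ∑ β, mixedDeriv K α β ζ * (v α * conj (w β)) := fun v w => by
    conv_lhs => rw [hv v, hv w]
    rw [sumL]
    refine Finset.sum_congr rfl fun α _ => ?_
    rw [sumR]
    refine Finset.sum_congr rfl fun β _ => ?_
    rw [smulL, smulR, hm]
    ring
  have e : ∑ α, ∑ β, mixedDeriv K α β ζ * (v α * conj (w β) - w α * conj (v β)) = S v w - S w v := by
    rw [key, key]
    simp only [mul_sub, Finset.sum_sub_distrib]
  rw [e]
  simp only [hS]
  rw [hsymm w v, hsymm w, hsymm _ v, hsymm (Complex.I • w) (Complex.I • v)]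
  push_cast
  ring_nf
  simp only [Complex.I_sq]
  ring

end ComplexCoordinates

/-! ### The frame ∂/∂Im u, ∂/∂Re u, ∂/∂z̄ -/

section Frame

open Filter

/-- `ℂ²ⁿ` with the coordinates `(u, z)`. -/
abbrev CSpace (n : ℕ) := Fin n ⊕ Fin n → ℂ

variable (n : ℕ)

/-- The involutive frame of `ℂ²ⁿ ∋ (u, z)` spanned by `∂/∂ Im u_i`, `∂/∂ Re u_i` and
`2 ∂/∂ z̄_j`. -/
def frame : (Fin n ⊕ Fin n) ⊕ Fin n → CSpace n × CSpace n
  | .inl (.inl i) => (Pi.single (.inl i) Complex.I, 0)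
  | .inl (.inr i) => (Pi.single (.inl i) 1, 0)
  | .inr j => (Pi.single (.inr j) 1, Pi.single (.inr j) Complex.I)

variable {n} {q₀ : CSpace n}

/-- Each frame vector has its own coordinate functional, Im u_i, Re u_i or z_j, which takes the
value 0 on all the other frame vectors. This is what convolution along that vector needs in order to
respect the other homogeneous equations. -/
theorem frame_locally_solvable (α : (Fin n ⊕ Fin n) ⊕ Fin n)
    (s : Finset ((Fin n ⊕ Fin n) ⊕ Fin n)) (hs : α ∉ s) (g : CSpace n → ℂ)
    (hg : SmoothNear g q₀) (hgs : ∀ β ∈ s, ∀ᶠ q in 𝓝 q₀, cDeriv (frame n β) g q = 0) :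
    ∃ f, SmoothNear f q₀ ∧ (∀ᶠ q in 𝓝 q₀, cDeriv (frame n α) f q = g q) ∧
      ∀ β ∈ s, ∀ᶠ q in 𝓝 q₀, cDeriv (frame n β) f q = 0 := by
  classical
  have hS : ∀ D' ∈ s.image (frame n), ∀ᶠ q in 𝓝 q₀, cDeriv D' g q = 0 := by
    intro D' hD'
    obtain ⟨β, hβ, rfl⟩ := Finset.mem_image.1 hD'
    exact hgs β hβ
  suffices H : ∃ f, SmoothNear f q₀ ∧ (∀ᶠ q in 𝓝 q₀, cDeriv (frame n α) f q = g q) ∧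
      ∀ D' ∈ s.image (frame n), ∀ᶠ q in 𝓝 q₀, cDeriv D' f q = 0 by
    obtain ⟨f, h1, h2, h3⟩ := H
    exact ⟨f, h1, h2, fun β hβ => h3 _ (Finset.mem_image_of_mem _ hβ)⟩
  rcases α with (i | i) | j
  · let P : CSpace n →L[ℝ] ℝ :=
      Complex.imCLM.comp (ContinuousLinearMap.proj (.inl i))
    have hP : P (Pi.single (.inl i) Complex.I) = 1 := by simp [P]
    refine (isFundamental_line hP).exists_solution (P := P) (fun w => ?_) hg _ ?_ hS
    · simp [hP]
    · intro D' hD'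
      obtain ⟨β, hβ, rfl⟩ := Finset.mem_image.1 hD'
      rcases β with (i' | i') | j'
      · have : i ≠ i' := fun h => hs (h ▸ hβ)
        simp [frame, P, this]
      · by_cases h : i = i' <;> simp [frame, P, h]
      · simp [frame, P]
  · let P : CSpace n →L[ℝ] ℝ :=
      Complex.reCLM.comp (ContinuousLinearMap.proj (.inl i))
    have hP : P (Pi.single (.inl i) 1) = 1 := by simp [P]
    refine (isFundamental_line hP).exists_solution (P := P) (fun w => ?_) hg _ ?_ hS
    · simp [hP]
    · intro D' hD'
      obtain ⟨β, hβ, rfl⟩ := Finset.mem_image.1 hD'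
      rcases β with (i' | i') | j'
      · by_cases h : i = i' <;> simp [frame, P, h]
      · have : i ≠ i' := fun h => hs (h ▸ hβ)
        simp [frame, P, this]
      · simp [frame, P]
  · let P : CSpace n →L[ℂ] ℂ := ContinuousLinearMap.proj (.inr j)
    have hP : P (Pi.single (.inr j) 1) = 1 := by simp [P]
    have hfund := isFundamental_dbar hP
    rw [I_smul_single] at hfund
    refine hfund.exists_solution (P := P.restrictScalars ℝ) (fun w => ?_) hg _ ?_ hS
    · simp [hP]
    · intro D' hD'
      obtain ⟨β, hβ, rfl⟩ := Finset.mem_image.1 hD'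
      rcases β with (i' | i') | j'
      · simp [frame, P]
      · simp [frame, P]
      · have : j ≠ j' := fun h => hs (h ▸ hβ)
        simp [frame, P, this]

/-- The value of a 2-form on two complexified vectors. -/
def evalC {E : Type*} [NormedAddCommGroup E] [NormedSpace ℝ E] (κ : E →L[ℝ] E →L[ℝ] ℂ)
    (D D' : E × E) : ℂ :=
  κ D.1 D'.1 + Complex.I * κ D.1 D'.2 + Complex.I * (κ D.2 D'.1 + Complex.I * κ D.2 D'.2)

/-- The functions `c` are the values on the frame of a partial 1-form. Since the frame commutes, the
hypothesis `hκ` says that β + c is closed along the frame, which is the compatibility of the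
equations for f. -/
theorem exists_frame_potential {κ : CSpace n → CSpace n →L[ℝ] CSpace n →L[ℝ] ℂ}
    {β : CSpace n → CSpace n →L[ℝ] ℂ} (hβ : SmoothNear β q₀)
    (hdβ : ∀ᶠ q in 𝓝 q₀, ∀ v w, fderiv ℝ β q v w - fderiv ℝ β q w v = κ q v w)
    {c : (Fin n ⊕ Fin n) ⊕ Fin n → CSpace n → ℂ} (hc : ∀ α, SmoothNear (c α) q₀)
    (hκ : ∀ α γ, ∀ᶠ q in 𝓝 q₀, evalC (κ q) (frame n α) (frame n γ)
      + cDeriv (frame n α) (c γ) q - cDeriv (frame n γ) (c α) q = 0) :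
    ∃ f, SmoothNear f q₀ ∧ ∀ α, ∀ᶠ q in 𝓝 q₀, cDeriv (frame n α) f q
      = β q (frame n α).1 + Complex.I * β q (frame n α).2 + c α q := by
  have hB : ∀ D : CSpace n × CSpace n,
      SmoothNear (fun q => β q D.1 + Complex.I * β q D.2) q₀ := fun D =>
    (hβ.clm_apply (smoothNear_const _)).add
      ((hβ.clm_apply (smoothNear_const D.2)).clm_comp (ContinuousLinearMap.mul ℝ ℂ Complex.I))
  have hdB : ∀ D D' : CSpace n × CSpace n, ∀ᶠ q in 𝓝 q₀, cDeriv D (fun q => β q D'.1 + Complex.I * β q D'.2) q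
      = fderiv ℝ β q D.1 D'.1 + Complex.I * fderiv ℝ β q D.1 D'.2
        + Complex.I * (fderiv ℝ β q D.2 D'.1 + Complex.I * fderiv ℝ β q D.2 D'.2) := by
    intro D D'
    filter_upwards [hβ.differentiable] with q hq
    have h1 : ∀ v, DifferentiableAt ℝ (fun y => β y v) q := fun v =>
      hq.clm_apply (differentiableAt_const v)
    have h2 : ∀ w, fderiv ℝ (fun q => β q D'.1 + Complex.I * β q D'.2) q w
        = fderiv ℝ β q w D'.1 + Complex.I * fderiv ℝ β q w D'.2 := fun w => by
      rw [fderiv_fun_add (h1 _) ((h1 _).const_mul _), fderiv_const_mul (h1 _)]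
      simp [fderiv_clm_apply₁ hq]
    rw [cDeriv, h2, h2]
  refine exists_solution_of_system (D := frame n)
    (B := fun α q => β q (frame n α).1 + Complex.I * β q (frame n α).2 + c α q)
    frame_locally_solvable (fun α => (hB _).add (hc α)) fun α γ => ?_
  filter_upwards [hdβ, hκ α γ, hdB (frame n α) (frame n γ), hdB (frame n γ) (frame n α),
    (hB (frame n α)).differentiable, (hB (frame n γ)).differentiable,
    (hc α).differentiable, (hc γ).differentiable] with q h1 h2 h3 h4 h5 h6 h7 h8
  rw [cDeriv_add _ h6 h8, cDeriv_add _ h5 h7, h3, h4]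
  simp only [evalC, ← h1] at h2
  linear_combination h2

/-- A closed 2-form which vanishes on the frame is of the form `∑ dh_k ∧ dz_k`. -/
theorem exists_eq_sum_d_wedge_dz
    {η : CSpace n → CSpace n →L[ℝ] CSpace n →L[ℝ] ℂ}
    (hη : SmoothNear η q₀) (hc : ClosedNear η q₀)
    (hfr : ∀ α γ, ∀ᶠ q in 𝓝 q₀, evalC (η q) (frame n α) (frame n γ) = 0)
    (hb : ∀ i, ∀ᶠ q in 𝓝 q₀, ∀ v, η q (Pi.single (.inl i) Complex.I) v = 0) :
    ∃ h : Fin n → CSpace n → ℂ, (∀ k, SmoothNear (h k) q₀) ∧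
      (∀ᶠ q in 𝓝 q₀, ∀ v w, η q v w
        = ∑ k, (fderiv ℝ (h k) q v * w (.inr k) - fderiv ℝ (h k) q w * v (.inr k))) ∧
      ∀ᶠ q in 𝓝 q₀, ∀ i k, fderiv ℝ (h k) q (Pi.single (.inl i) Complex.I) = 0 := by
  obtain ⟨β, hβ, hdβ, -⟩ := exists_primitive_of_closed hη hc
  obtain ⟨f, hf, hfα⟩ := exists_frame_potential hβ hdβ (c := fun _ _ => 0)
    (fun _ => smoothNear_const 0) fun α γ => by
      filter_upwards [hfr α γ] with q hq
      simp [hq, cDeriv]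
  -- Here df agrees with β on the frame. Hence lam = β - df still has differential η, and it kills
  -- the frame, so it is a combination of the dz_k. Its coefficients are the required h_k.
  set lam : CSpace n → CSpace n →L[ℝ] ℂ := fun q => β q - fderiv ℝ f q with hlam
  have hlams : SmoothNear lam q₀ := hβ.sub hf.fderiv
  have hlamα : ∀ᶠ q in 𝓝 q₀, ∀ α, lam q (frame n α).1 + Complex.I * lam q (frame n α).2 = 0 := by
    filter_upwards [eventually_all.2 hfα] with q hq α
    have := hq α
    simp only [cDeriv] at this
    simp only [hlam, sub_apply]
    linear_combination -this
  have hdlam : ∀ᶠ q in 𝓝 q₀, ∀ v w, fderiv ℝ lam q v w - fderiv ℝ lam q w v = η q v w := by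
    filter_upwards [hdβ, hβ.differentiable, hf.fderiv.differentiable, hf] with q h1 h2 h3 h4 v w
    rw [hlam, fderiv_fun_sub h2 h3]
    simp only [sub_apply]
    rw [← h1, fderiv_fderiv_symm h4 v w]
    ring
  set h : Fin n → CSpace n → ℂ := fun k q => lam q (Pi.single (.inr k) 1) with hh
  have hs : ∀ k, SmoothNear (h k) q₀ := fun k => hlams.clm_apply (smoothNear_const _)
  have hexp : ∀ᶠ q in 𝓝 q₀, ∀ w, lam q w = ∑ k, h k q * w (.inr k) := by
    filter_upwards [hlamα] with q hq w
    have ha : ∀ i, lam q (Pi.single (.inl i) 1) = 0 := fun i => by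
      simpa [frame] using hq (.inl (.inr i))
    have hb' : ∀ i, lam q (Pi.single (.inl i) Complex.I) = 0 := fun i => by
      simpa [frame] using hq (.inl (.inl i))
    have hz : ∀ j, lam q (Pi.single (.inr j) Complex.I) = Complex.I * h j q := fun j => by
      have := hq (.inr j)
      simp only [frame] at this
      linear_combination (-Complex.I) * this + lam q (Pi.single (.inr j) Complex.I) * Complex.I_sq
    rw [map_eq_sum_re_im (lam q), Fintype.sum_sum_type]
    simp only [ha, hb', hz, smul_zero, add_zero, Finset.sum_const_zero, zero_add]
    refine Finset.sum_congr rfl fun k _ => ?_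
    conv_rhs => rw [← Complex.re_add_im (w (.inr k))]
    simp only [Complex.real_smul, hh]
    ring
  have hmain : ∀ᶠ q in 𝓝 q₀, ∀ v w, η q v w
      = ∑ k, (fderiv ℝ (h k) q v * w (.inr k) - fderiv ℝ (h k) q w * v (.inr k)) := by
    filter_upwards [hdlam, hexp.eventually_nhds, hlams.differentiable,
      eventually_all.2 fun k => (hs k).differentiable] with q h1 h2 h3 h4 v w
    have e : ∀ v w, fderiv ℝ lam q v w = ∑ k, fderiv ℝ (h k) q v * w (.inr k) := fun v w => by
      rw [← fderiv_clm_apply₁ h3]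
      have e1 : (fun y => lam y w) =ᶠ[𝓝 q] fun y => ∑ k, h k y * w (.inr k) := h2.mono fun y hy => hy w
      rw [e1.fderiv_eq, fderiv_fun_sum fun k _ => (h4 k).mul_const _]
      simp only [sum_apply]
      refine Finset.sum_congr rfl fun k _ => ?_
      rw [fderiv_mul_const (h4 k)]
      simp [mul_comm]
    rw [← h1, e, e, Finset.sum_sub_distrib]
  refine ⟨h, hs, hmain, ?_⟩
  -- The coefficient of dz_k in the contraction of η with ∂/∂Im u_i is ∂h_k/∂Im u_i.
  filter_upwards [hmain, eventually_all.2 hb] with q h1 h2 i k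
  have := h2 i (Pi.single (.inr k) 1)
  rw [h1] at this
  simpa [Pi.single_apply] using this

end Frame

/-! ### A Kähler potential adapted to the action -/

section KahlerPotential

open Filter

variable {n : ℕ} {q₀ : CSpace n}

/-- In finite dimension a family of bilinear forms is smooth as soon as its values on constant
vectors are. -/
theorem exists_form_of_components {E : Type*} [NormedAddCommGroup E] [NormedSpace ℝ E]
    [FiniteDimensional ℝ E] (s : E → E → E → ℂ)
    (h1 : ∀ q v v' w, s q (v + v') w = s q v w + s q v' w)
    (h2 : ∀ q (c : ℝ) v w, s q (c • v) w = c • s q v w)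
    (h3 : ∀ q v w w', s q v (w + w') = s q v w + s q v w')
    (h4 : ∀ q (c : ℝ) v w, s q v (c • w) = c • s q v w) :
    ∃ κ : E → E →L[ℝ] E →L[ℝ] ℂ, (∀ q v w, κ q v w = s q v w) ∧
      ∀ q₀, (∀ᶠ q in 𝓝 q₀, ∀ v w, ContDiffAt ℝ ∞ (fun y => s y v w) q) → SmoothNear κ q₀ := by
  let κ : E → E →L[ℝ] E →L[ℝ] ℂ := fun q => LinearMap.toContinuousLinearMap
    ((LinearMap.toContinuousLinearMap : (E →ₗ[ℝ] ℂ) ≃ₗ[ℝ] (E →L[ℝ] ℂ)).toLinearMap.comp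
      (LinearMap.mk₂ ℝ (s q) (h1 q) (h2 q) (h3 q) (h4 q)))
  refine ⟨κ, fun q v w => rfl, fun q₀ h => ?_⟩
  obtain ⟨Ω, hΩ, hΩo, hq₀⟩ := eventually_nhds_iff.1 h
  have : ContDiffOn ℝ ∞ κ Ω := by
    rw [contDiffOn_clm_apply]
    intro v
    rw [contDiffOn_clm_apply]
    exact fun w q hq => (hΩ q hq v w).contDiffWithinAt
  filter_upwards [hΩo.mem_nhds hq₀] with q hq using this.contDiffAt (hΩo.mem_nhds hq)

theorem single_inl_one_im (i j : Fin n) :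
    ((Pi.single (.inl i) (1 : ℂ) : CSpace n) (.inl j)).im = 0 := by
  by_cases h : j = i <;> simp [Pi.single_apply, h]

theorem single_inl_I_im (i j : Fin n) :
    ((Pi.single (.inl i) Complex.I : CSpace n) (.inl j)).im = if j = i then 1 else 0 := by
  by_cases h : j = i <;> simp [Pi.single_apply, h]

/-- The form `σ - ∑ dx_i ∧ d Im u_i`. -/
theorem exists_sub_sum_dx_wedge_db {σ : CSpace n → CSpace n →L[ℝ] CSpace n →L[ℝ] ℂ}
    (hσ : SmoothNear σ q₀) (hc : ClosedNear σ q₀) {x : Fin n → CSpace n → ℝ}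
    (hx : ∀ i, SmoothNear (x i) q₀) :
    ∃ κ : CSpace n → CSpace n →L[ℝ] CSpace n →L[ℝ] ℂ, SmoothNear κ q₀ ∧ ClosedNear κ q₀ ∧
      ∀ q v w, κ q v w = σ q v w - ((∑ i, (fderiv ℝ (x i) q v * (w (.inl i)).im
        - (v (.inl i)).im * fderiv ℝ (x i) q w) : ℝ) : ℂ) := by
  obtain ⟨κ, hκ, hκs⟩ := exists_form_of_components (E := CSpace n)
    (fun q v w => σ q v w - ((∑ i, (fderiv ℝ (x i) q v * (w (.inl i)).im
        - (v (.inl i)).im * fderiv ℝ (x i) q w) : ℝ) : ℂ))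
    (fun q v v' w => by
      simp only [map_add, add_apply, Pi.add_apply, Complex.add_im, add_mul, Finset.sum_add_distrib,
        Finset.sum_sub_distrib]
      push_cast; ring)
    (fun q c v w => by
      simp only [map_smul, smul_apply, Pi.smul_apply, Complex.smul_im, smul_eq_mul, mul_assoc,
        ← mul_sub, ← Finset.mul_sum]
      simp only [Complex.real_smul]
      push_cast; ring)
    (fun q v w w' => by
      simp only [map_add, Pi.add_apply, Complex.add_im, mul_add, Finset.sum_add_distrib,
        Finset.sum_sub_distrib]
      push_cast; ring)
    (fun q c v w => by
      simp only [map_smul, Pi.smul_apply, Complex.smul_im, smul_eq_mul, mul_left_comm _ c,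
        ← mul_sub, ← Finset.mul_sum]
      simp only [Complex.real_smul]
      push_cast; ring)
  have hs : SmoothNear κ q₀ := hκs _ <| by
    filter_upwards [hσ, eventually_all.2 hx] with q h1 h2 v w
    have h3 : ∀ i v, ContDiffAt ℝ ∞ (fun y => fderiv ℝ (x i) y v) q := fun i v =>
      ((h2 i).fderiv_right (m := ∞) (by simp)).clm_apply contDiffAt_const
    have h4 : ContDiffAt ℝ ∞ (fun y => ∑ i, (fderiv ℝ (x i) y v * (w (.inl i)).im
        - (v (.inl i)).im * fderiv ℝ (x i) y w)) q := ContDiffAt.sum fun i _ =>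
      ((h3 i v).mul contDiffAt_const).sub (contDiffAt_const.mul (h3 i w))
    exact ((h1.clm_apply contDiffAt_const).clm_apply contDiffAt_const).sub
      (Complex.ofRealCLM.contDiff.contDiffAt.comp q h4)
  refine ⟨κ, hs, ?_, hκ⟩
  filter_upwards [hc, hσ.differentiable, hs.differentiable, eventually_all.2 hx] with q h1 h2 h3 h4
  set s : CSpace n → CSpace n → CSpace n → ℝ := fun u v w =>
    ∑ i, (fderiv ℝ (fderiv ℝ (x i)) q u v * (w (.inl i)).im
      - (v (.inl i)).im * fderiv ℝ (fderiv ℝ (x i)) q u w) with hsdef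
  have hd : ∀ u v w, fderiv ℝ κ q u v w = fderiv ℝ σ q u v w - (s u v w : ℂ) := by
    intro u v w
    have h5 : ∀ i v, HasFDerivAt (fun y => fderiv ℝ (x i) y v)
        ((fderiv ℝ (fderiv ℝ (x i)) q).flip v) q := fun i v => by
      refine ((((h4 i).fderiv_right (m := ∞) (by simp)).differentiableAt
        (by simp)).hasFDerivAt.clm_apply (hasFDerivAt_const v q)).congr_fderiv ?_
      ext u; simp
    have h6 : DifferentiableAt ℝ (fun y => σ y v w) q :=
      (h2.clm_apply (differentiableAt_const v)).clm_apply (differentiableAt_const w)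
    rw [← fderiv_clm_apply₂ h3, ← fderiv_clm_apply₂ h2]
    have e0 : HasFDerivAt (fun y => ∑ i, (fderiv ℝ (x i) y v * (w (.inl i)).im
        - (v (.inl i)).im * fderiv ℝ (x i) y w)) _ q := HasFDerivAt.fun_sum fun i _ =>
      ((h5 i v).mul_const (w (.inl i)).im).sub ((h5 i w).const_mul (v (.inl i)).im)
    have e : HasFDerivAt (fun y => κ y v w) _ q :=
      (h6.hasFDerivAt.sub (Complex.ofRealCLM.hasFDerivAt.comp q e0)).congr_of_eventuallyEq
          (Eventually.of_forall fun y => hκ y v w)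
    rw [e.fderiv]
    simp [sum_apply, hsdef, mul_comm]
  refine ⟨fun v w => ?_, fun u v w => ?_⟩
  · simp only [hκ]
    have h5 : ∑ i, (fderiv ℝ (x i) q v * (w (.inl i)).im - (v (.inl i)).im * fderiv ℝ (x i) q w)
        = -∑ i, (fderiv ℝ (x i) q w * (v (.inl i)).im - (w (.inl i)).im * fderiv ℝ (x i) q v) := by
      rw [← Finset.sum_neg_distrib]
      exact Finset.sum_congr rfl fun i _ => by ring
    rw [h1.1 v w, h5, Complex.ofReal_neg]
    ring
  · have h7 : ∀ i a b, fderiv ℝ (fderiv ℝ (x i)) q a b = fderiv ℝ (fderiv ℝ (x i)) q b a :=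
      fun i a b => fderiv_fderiv_symm (h4 i) a b
    have h8 : s u v w + s v w u + s w u v = 0 := by
      simp only [hsdef]
      rw [← Finset.sum_add_distrib, ← Finset.sum_add_distrib]
      refine Finset.sum_eq_zero fun i _ => ?_
      rw [h7 i v u, h7 i w u, h7 i w v]
      ring
    have h9 : (s u v w : ℂ) + s v w u + s w u v = 0 := by exact_mod_cast h8
    simp only [hd]
    linear_combination h1.2 u v w - h9

/-- Here σ plays the role of ω₁: real, of type (1,1), and with contraction -dx_i against ∂/∂Im u_i =
-X_i. The closed form κ = σ - ∑ dx_i ∧ d Im u_i is killed by ∂/∂Im u_i, so it has a real primitive β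
with the same property. One solves for f with ∂f/∂Im u_i = 0, ∂f/∂Re u_i = β(∂/∂Re u_i) + √-1 x_i
and df = β on ∂/∂z̄_j. Then K = -4 Im f. -/
theorem exists_kahler_potential {σ : CSpace n → CSpace n →L[ℝ] CSpace n →L[ℝ] ℂ}
    (hσ : SmoothNear σ q₀) (hc : ClosedNear σ q₀) {x : Fin n → CSpace n → ℝ}
    (hx : ∀ i, SmoothNear (x i) q₀) (hreal : ∀ᶠ q in 𝓝 q₀, ∀ v w, (σ q v w).im = 0)
    (hxb : ∀ᶠ q in 𝓝 q₀, ∀ i j, fderiv ℝ (x i) q (Pi.single (.inl j) Complex.I) = 0)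
    (hσx : ∀ᶠ q in 𝓝 q₀, ∀ i w, σ q (Pi.single (.inl i) Complex.I) w = -(fderiv ℝ (x i) q w : ℂ))
    (hσI : ∀ᶠ q in 𝓝 q₀, ∀ v w, σ q (Complex.I • v) (Complex.I • w) = σ q v w) :
    ∃ K : CSpace n → ℝ, SmoothNear K q₀ ∧
      (∀ᶠ q in 𝓝 q₀, ∀ i, fderiv ℝ K q (Pi.single (.inl i) Complex.I) = 0) ∧
      (∀ᶠ q in 𝓝 q₀, ∀ i, fderiv ℝ K q (Pi.single (.inl i) 1) = -4 * x i q) ∧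
      ∀ᶠ q in 𝓝 q₀, ∀ v w, σ q v w = ((1 / 4 * (fderiv ℝ (fderiv ℝ K) q v (Complex.I • w)
        - fderiv ℝ (fderiv ℝ K) q w (Complex.I • v)) : ℝ) : ℂ) := by
  obtain ⟨κ, hκs, hκc, hκ⟩ := exists_sub_sum_dx_wedge_db hσ hc hx
  obtain ⟨β₀, hβ₀, hdβ₀, hβ₀0⟩ := exists_primitive_of_closed hκs hκc
  -- The real part of a primitive is still a primitive, because κ is real.
  let R : ℂ →L[ℝ] ℂ := Complex.ofRealCLM.comp Complex.reCLM
  have hR : ∀ z : ℂ, z.im = 0 → R z = z := fun z hz => Complex.ext rfl (by simp [R, hz])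
  let RL := ContinuousLinearMap.compL ℝ (CSpace n) ℂ ℂ R
  set β : CSpace n → CSpace n →L[ℝ] ℂ := fun q => RL (β₀ q) with hβdef
  have hβ : SmoothNear β q₀ := hβ₀.clm_comp RL
  have hβapp : ∀ q v, β q v = ((β₀ q v).re : ℂ) := fun q v => rfl
  have hκreal : ∀ᶠ q in 𝓝 q₀, ∀ v w, (κ q v w).im = 0 := by
    filter_upwards [hreal] with q h v w
    rw [hκ, Complex.sub_im, h, Complex.ofReal_im, sub_zero]
  have hdβ : ∀ᶠ q in 𝓝 q₀, ∀ v w, fderiv ℝ β q v w - fderiv ℝ β q w v = κ q v w := by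
    filter_upwards [hdβ₀, hβ₀.differentiable, hκreal] with q h1 h2 h3 v w
    have e : HasFDerivAt β _ q := RL.hasFDerivAt.comp q h2.hasFDerivAt
    rw [e.fderiv, ← hR (κ q v w) (h3 v w), ← h1, map_sub]
    rfl
  have hβb : ∀ᶠ q in 𝓝 q₀, ∀ i, β q (Pi.single (.inl i) Complex.I) = 0 := by
    refine eventually_all.2 fun i => ?_
    have : ∀ᶠ q in 𝓝 q₀, ∀ v, κ q (Pi.single (.inl i) Complex.I) v = 0 := by
      filter_upwards [hσx, hxb] with q h1 h2 v
      rw [hκ, h1]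
      simp [h2, single_inl_I_im]
    filter_upwards [hβ₀0 _ this] with q hq
    simp [hβapp, hq]
  -- The term √-1 x_i in the Re u_i equation becomes ∂K/∂Re u_i = -4 x_i, since β is real.
  set c : (Fin n ⊕ Fin n) ⊕ Fin n → CSpace n → ℂ := Sum.elim (Sum.elim (fun _ _ => 0)
    fun i q => Complex.I * (x i q : ℂ)) fun _ _ => 0 with hc'
  have hcs : ∀ α, SmoothNear (c α) q₀ := by
    rintro ((i | i) | j)
    · exact smoothNear_const 0
    · exact ((hx i).clm_comp Complex.ofRealCLM).clm_comp (ContinuousLinearMap.mul ℝ ℂ Complex.I)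
    · exact smoothNear_const 0
  have hdc : ∀ᶠ q in 𝓝 q₀, ∀ i D, cDeriv D (fun q => Complex.I * (x i q : ℂ)) q
      = Complex.I * (fderiv ℝ (x i) q D.1 + Complex.I * fderiv ℝ (x i) q D.2) := by
    filter_upwards [eventually_all.2 fun i => (hx i).differentiable] with q hq i D
    have e : HasFDerivAt (fun q => Complex.I * (x i q : ℂ)) _ q :=
      (Complex.ofRealCLM.hasFDerivAt.comp q (hq i).hasFDerivAt).const_mul Complex.I
    rw [cDeriv, e.fderiv]
    simp
    ring
  obtain ⟨f, hf, hfα⟩ := exists_frame_potential hβ hdβ hcs fun α γ => by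
    filter_upwards [hκc, hσx, hxb, hσI, hdc, hc] with q h1 h2 h3 h4 h5 h6
    have hcz : ∀ D : CSpace n × CSpace n, cDeriv D (fun _ => (0 : ℂ)) q = 0 := fun D => by
      simp [cDeriv]
    have hb : ∀ i v, κ q (Pi.single (.inl i) Complex.I) v = 0 := fun i v => by
      rw [hκ, h2]
      simp [h3, single_inl_I_im]
    have hb' : ∀ i v, κ q v (Pi.single (.inl i) Complex.I) = 0 := fun i v => by
      rw [h1.1, hb, neg_zero]
    -- Type (1,1) turns contraction with ∂/∂Re u_i into contraction with ∂/∂Im u_i, which is known.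
    have hσa : ∀ i w, σ q (Pi.single (.inl i) 1) w = -(fderiv ℝ (x i) q (Complex.I • w) : ℂ) := by
      intro i w
      rw [← h2, ← h4, I_smul_single]
    have hκa : ∀ i w, (∀ j, (w (.inl j)).im = 0) →
        κ q (Pi.single (.inl i) 1) w = -(fderiv ℝ (x i) q (Complex.I • w) : ℂ) := by
      intro i w hw
      rw [hκ, hσa]
      simp [hw, single_inl_one_im]
    -- Both sides come from the value of σ on ∂/∂Im u_i and ∂/∂Re u_j. The symmetry of ∂x_i/∂Re u_j
    -- is the compatibility of the Re u equations with each other.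
    have hxsymm : ∀ i j, fderiv ℝ (x i) q (Pi.single (.inl j) 1)
        = fderiv ℝ (x j) q (Pi.single (.inl i) 1) := by
      intro i j
      have e1 := h2 i (Pi.single (.inl j) 1)
      have e2 := hσa j (Pi.single (.inl i) Complex.I)
      rw [I_smul_single_I, map_neg, h6.1, e1] at e2
      push_cast at e2
      have e3 : (fderiv ℝ (x i) q (Pi.single (.inl j) 1) : ℂ)
        = fderiv ℝ (x j) q (Pi.single (.inl i) 1) := by linear_combination e2
      exact_mod_cast e3
    rcases α with (i | i) | j <;> rcases γ with (i' | i') | j'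
    · simp [evalC, frame, hc', hcz, hb]
    · simp only [evalC, frame, hc', Sum.elim_inl, Sum.elim_inr, hcz, hb, h5, h3, map_zero]
      simp
    · simp [evalC, frame, hc', hcz, hb]
    · simp only [evalC, frame, hc', Sum.elim_inl, Sum.elim_inr, hcz, hb', h5, h3, map_zero]
      simp
    · simp only [evalC, frame, hc', Sum.elim_inl, Sum.elim_inr, h5]
      rw [hκa i (Pi.single (.inl i') 1) fun j => single_inl_one_im i' j, I_smul_single, h3, hxsymm i i']
      simp
    · simp only [evalC, frame, hc', Sum.elim_inl, Sum.elim_inr, hcz, h5]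
      rw [hκa i _ (by simp), hκa i _ (by simp), I_smul_single, I_smul_single_I, map_neg]
      simp
      linear_combination -((fderiv ℝ (x i) q) (Pi.single (Sum.inr j') Complex.I) : ℂ) * Complex.I_sq
    · simp [evalC, frame, hc', hcz, hb']
    · simp only [evalC, frame, hc', Sum.elim_inl, Sum.elim_inr, hcz, h5]
      rw [h1.1, h1.1 (Pi.single (.inr j) Complex.I), hκa i' _ (by simp), hκa i' _ (by simp),
        I_smul_single, I_smul_single_I, map_neg]
      simp
      linear_combination ((fderiv ℝ (x i') q) (Pi.single (Sum.inr j) Complex.I) : ℂ) * Complex.I_sq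
    · simp only [evalC, frame, hc', Sum.elim_inr, hcz, hκ]
      have e1 := h4 (Pi.single (.inr j) 1) (Pi.single (.inr j') 1)
      have e2 := h4 (Pi.single (.inr j) 1) (Pi.single (.inr j') Complex.I)
      simp only [I_smul_single, I_smul_single_I, map_neg] at e1 e2
      simp
      linear_combination (-1 : ℂ) * e1 - Complex.I * e2 +
        (σ q (Pi.single (.inr j) Complex.I) (Pi.single (.inr j') Complex.I)) * Complex.I_sq
  -- the potential
  let T : (CSpace n →L[ℝ] ℂ) →L[ℝ] (CSpace n →L[ℝ] ℝ) :=
    ContinuousLinearMap.compL ℝ (CSpace n) ℂ ℝ Complex.reCLM -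
      (ContinuousLinearMap.compL ℝ (CSpace n) ℂ ℝ Complex.imCLM).comp
        ((ContinuousLinearMap.compL ℝ (CSpace n) (CSpace n) ℂ).flip
          ((Complex.I • ContinuousLinearMap.id ℂ (CSpace n)).restrictScalars ℝ))
  have hT : ∀ L v, T L v = (L v).re - (L (Complex.I • v)).im := fun L v => rfl
  -- The identity is Re df - Im df ∘ √-1 = β + ∑ x_i d Im u_i. Under the exterior derivative, d Re f
  -- drops out, the right side becomes κ + ∑ dx_i ∧ d Im u_i = σ, and with K = -4 Im f the left side
  -- becomes ¼ d(dK ∘ √-1).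
  have hTf : ∀ᶠ q in 𝓝 q₀, ∀ v, T (fderiv ℝ f q) v
      = (β q v).re + ∑ i, x i q * (v (.inl i)).im := by
    filter_upwards [eventually_all.2 hfα, hβb] with q h1 h2 v
    have ha : ∀ i, fderiv ℝ f q (Pi.single (.inl i) 1)
        = β q (Pi.single (.inl i) 1) + Complex.I * x i q := fun i => by
      simpa [frame, cDeriv, hc'] using h1 (.inl (.inr i))
    have hb : ∀ i, fderiv ℝ f q (Pi.single (.inl i) Complex.I) = 0 := fun i => by
      simpa [frame, cDeriv, hc', h2] using h1 (.inl (.inl i))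
    have hz : ∀ j, fderiv ℝ f q (Pi.single (.inr j) 1)
        + Complex.I * fderiv ℝ f q (Pi.single (.inr j) Complex.I)
        = β q (Pi.single (.inr j) 1) + Complex.I * β q (Pi.single (.inr j) Complex.I) := fun j => by
      simpa [frame, cDeriv, hc'] using h1 (.inr j)
    have hβim : ∀ v, (β q v).im = 0 := fun v => by simp [hβapp]
    let imR : Fin n → CSpace n →L[ℝ] ℝ := fun i =>
      Complex.imCLM.comp (ContinuousLinearMap.proj (.inl i))
    have key : T (fderiv ℝ f q) = Complex.reCLM.comp (β q) + ∑ i, x i q • imR i := by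
      refine clm_ext_single (fun α => ?_) fun α => ?_
      · rw [hT, I_smul_single]
        simp only [add_apply, sum_apply]
        rcases α with i | j
        · rw [ha, hb]
          simp [imR, single_inl_one_im]
        · have := congrArg Complex.re (hz j)
          simp [hβim] at this
          simp [imR, ← this]
          ring
      · rw [hT, I_smul_single_I]
        simp only [add_apply, sum_apply]
        rcases α with i | j
        · rw [map_neg, ha, hb]
          simp [imR, single_inl_I_im, hβim, h2]
        · have := congrArg Complex.im (hz j)
          simp [hβim] at this
          simp [imR, ← this]
          ring
    rw [key]
    simp [imR]
  set K : CSpace n → ℝ := fun q => -4 * (f q).im with hK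
  have hKs : SmoothNear K q₀ := hf.clm_comp ((-4 : ℝ) • Complex.imCLM)
  have hdK : ∀ᶠ q in 𝓝 q₀, ∀ v, fderiv ℝ K q v = -4 * (fderiv ℝ f q v).im := by
    filter_upwards [hf.differentiable] with q hq v
    have e : HasFDerivAt K _ q := ((-4 : ℝ) • Complex.imCLM).hasFDerivAt.comp q hq.hasFDerivAt
    rw [e.fderiv]
    simp
  refine ⟨K, hKs, ?_, ?_, ?_⟩
  · filter_upwards [hdK, eventually_all.2 hfα, hβb] with q h1 h2 h3 i
    have := h2 (.inl (.inl i))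
    simp [frame, cDeriv, hc', h3] at this
    simp [h1, this]
  · filter_upwards [hdK, eventually_all.2 hfα] with q h1 h2 i
    have := h2 (.inl (.inr i))
    simp [frame, cDeriv, hc'] at this
    simp [h1, this, hβapp]
  · filter_upwards [hdK.eventually_nhds, hTf.eventually_nhds, hdβ, hβ.differentiable,
      hf, hKs, eventually_all.2 fun i => (hx i).differentiable, hκreal]
      with q h1 h2 h3 h4 h5 h6 h7 h8 v w
    have hfd : DifferentiableAt ℝ (fderiv ℝ f) q :=
      (h5.fderiv_right (m := ∞) (by simp)).differentiableAt (by simp)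
    have hKd : DifferentiableAt ℝ (fderiv ℝ K) q :=
      (h6.fderiv_right (m := ∞) (by simp)).differentiableAt (by simp)
    have e1 : ∀ v w, fderiv ℝ (fderiv ℝ K) q v w = -4 * (fderiv ℝ (fderiv ℝ f) q v w).im := by
      intro v w
      rw [← fderiv_clm_apply₁ hKd]
      have a1 : (fun y => fderiv ℝ K y w) =ᶠ[𝓝 q] fun y => ((-4 : ℝ) • Complex.imCLM) (fderiv ℝ f y w) :=
        h1.mono fun y hy => by simp [hy w]
      have a2 : HasFDerivAt (fun y => ((-4 : ℝ) • Complex.imCLM) (fderiv ℝ f y w)) _ q :=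
        ((-4 : ℝ) • Complex.imCLM).hasFDerivAt.comp q (hfd.hasFDerivAt.clm_apply (hasFDerivAt_const w q))
      rw [a1.fderiv_eq, a2.fderiv]
      simp
    have e2 : ∀ v w, (fderiv ℝ (fderiv ℝ f) q v w).re
        - (fderiv ℝ (fderiv ℝ f) q v (Complex.I • w)).im
        = (fderiv ℝ β q v w).re + ∑ i, fderiv ℝ (x i) q v * (w (.inl i)).im := by
      intro v w
      have a1 : HasFDerivAt (fun y => T (fderiv ℝ f y) w) _ q :=
        (T.hasFDerivAt.comp q hfd.hasFDerivAt).clm_apply (hasFDerivAt_const w q)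
      have a2 : HasFDerivAt (fun y => (β y w).re + ∑ i, x i y * (w (.inl i)).im) _ q :=
        (Complex.reCLM.hasFDerivAt.comp q (h4.hasFDerivAt.clm_apply (hasFDerivAt_const w q))).add
          (HasFDerivAt.fun_sum fun i _ => (h7 i).hasFDerivAt.mul_const (w (.inl i)).im)
      have a3 : (fun y => T (fderiv ℝ f y) w) =ᶠ[𝓝 q]
          fun y => (β y w).re + ∑ i, x i y * (w (.inl i)).im := h2.mono fun y hy => hy w
      have a4 := congrArg (fun L : CSpace n →L[ℝ] ℝ => L v)
        ((a1.congr_of_eventuallyEq a3.symm).unique a2)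
      simp [sum_apply, hT] at a4
      rw [a4]
      congr 1
      exact Finset.sum_congr rfl fun i _ => by ring
    have hsymm : (fderiv ℝ (fderiv ℝ f) q v w) = fderiv ℝ (fderiv ℝ f) q w v :=
      fderiv_fderiv_symm h5 v w
    have e3 : σ q v w = κ q v w + ((∑ i, (fderiv ℝ (x i) q v * (w (.inl i)).im
        - (v (.inl i)).im * fderiv ℝ (x i) q w) : ℝ) : ℂ) := by rw [hκ]; ring
    have e4 : κ q v w = (((fderiv ℝ β q v w).re - (fderiv ℝ β q w v).re : ℝ) : ℂ) := by
      have := congrArg Complex.re (h3 v w)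
      rw [Complex.sub_re] at this
      rw [this]
      exact Complex.ext rfl (by simp [h8])
    rw [e3, e4, ← Complex.ofReal_add]
    congr 1
    rw [e1, e1, Finset.sum_sub_distrib]
    have e5 := e2 v w
    have e6 := e2 w v
    have e7 : ∑ i, (v (.inl i)).im * fderiv ℝ (x i) q w
        = ∑ i, fderiv ℝ (x i) q w * (v (.inl i)).im := Finset.sum_congr rfl fun i _ => mul_comm _ _
    rw [e7]
    rw [hsymm] at e5
    linarith

end KahlerPotential

/-! ### Quaternionic linear algebra at a point -/

section PointwiseAlgebra

open Filter

variable {m : ℕ} {M : Type*} [TopologicalSpace M]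
  [ChartedSpace (EuclideanSpace ℝ (Fin m)) M] [IsManifold (𝓡 m) ∞ M]

namespace HyperkahlerStructure

variable (H : HyperkahlerStructure m M) {p : M}

theorem inner_I_left (a : Fin 3) (v w : TangentSpace (𝓡 m) p) :
    H.g.inner p (H.I a p v) w = -H.g.inner p v (H.I a p w) := by
  rw [← H.I_orthogonal a p v, H.I_sq, map_neg, neg_neg]

/-- From I₁I₂ = I₃ and I₃² = -1 one gets I₁I₂I₁I₂ = -1, hence I₂I₁I₂ = I₁. Applying this to I₂v
gives the anticommutation. -/
theorem I_one_I_zero (v : TangentSpace (𝓡 m) p) :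
    H.I 1 p (H.I 0 p v) = -H.I 2 p v := by
  have h : ∀ w : TangentSpace (𝓡 m) p, H.I 1 p (H.I 0 p (H.I 1 p w)) = H.I 0 p w := fun w => by
    have h1 := H.I_sq 0 p (H.I 1 p (H.I 0 p (H.I 1 p w)))
    rw [H.I_mul p (H.I 0 p (H.I 1 p w)), H.I_mul p w, H.I_sq, map_neg] at h1
    rw [H.I_mul]
    exact (neg_injective h1).symm
  have h2 := h (H.I 1 p v)
  rw [H.I_sq, map_neg, map_neg, H.I_mul] at h2
  rw [← h2, neg_neg]

theorem kahlerForm_swap (a : Fin 3) (v w : TangentSpace (𝓡 m) p) :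
    H.kahlerForm a p v w = -H.kahlerForm a p w v := by
  rw [kahlerForm, kahlerForm, inner_I_left, H.g.symm]

/-- The holomorphic symplectic form `ω₂ + √-1 ω₃`. -/
def holForm (p : M) (v w : TangentSpace (𝓡 m) p) : ℂ :=
  (H.kahlerForm 1 p v w : ℂ) + Complex.I * (H.kahlerForm 2 p v w : ℂ)

theorem holForm_swap (v w : TangentSpace (𝓡 m) p) : H.holForm p v w = -H.holForm p w v := by
  rw [holForm, holForm, kahlerForm_swap, H.kahlerForm_swap 2]
  push_cast; ring

theorem holForm_add_left (v v' w : TangentSpace (𝓡 m) p) :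
    H.holForm p (v + v') w = H.holForm p v w + H.holForm p v' w := by
  simp only [holForm, kahlerForm, map_add, add_apply]
  push_cast; ring

theorem holForm_smul_left (c : ℝ) (v w : TangentSpace (𝓡 m) p) :
    H.holForm p (c • v) w = c * H.holForm p v w := by
  simp only [holForm, kahlerForm, map_smul, smul_apply, smul_eq_mul]
  push_cast; ring

/-- Together with skew-symmetry this says that Ω is of type (2,0) for I₁. -/
theorem holForm_I_left (v w : TangentSpace (𝓡 m) p) :
    H.holForm p (H.I 0 p v) w = Complex.I * H.holForm p v w := by
  have h2 : H.I 2 p (H.I 0 p v) = H.I 1 p v := by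
    rw [← H.I_mul, I_one_I_zero, map_neg, ← H.I_mul, H.I_sq, neg_neg]
  simp only [holForm, kahlerForm, I_one_I_zero, h2, map_neg, neg_apply, Complex.ofReal_neg]
  linear_combination -(H.g.inner p (H.I 2 p v) w : ℂ) * Complex.I_sq

/-- Testing against I₂v gives the real part g(I₂v, I₂v) = g(v, v). -/
theorem eq_zero_of_holForm_eq_zero (v : TangentSpace (𝓡 m) p) (h : ∀ w, H.holForm p v w = 0) :
    v = 0 := by
  by_contra hv
  have h1 := congrArg Complex.re (h (H.I 1 p v))
  have h2 := H.g.pos p v hv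
  simp [holForm, kahlerForm, H.I_orthogonal] at h1
  linarith

theorem kahlerForm_zero_I (v w : TangentSpace (𝓡 m) p) :
    H.kahlerForm 0 p (H.I 0 p v) (H.I 0 p w) = H.kahlerForm 0 p v w :=
  H.I_orthogonal 0 p _ _

/-- A map `G` into the tangent space whose range is isotropic for the three Kähler forms. -/
def IsTriIsotropic {V : Type*} [AddCommGroup V] [Module ℝ V]
    (G : V →ₗ[ℝ] TangentSpace (𝓡 m) p) : Prop :=
  ∀ (a : Fin 3) (c d : V), H.kahlerForm a p (G c) (G d) = 0

section Isotropic

variable {H} {V : Type*} [AddCommGroup V] [Module ℝ V] {G : V →ₗ[ℝ] TangentSpace (𝓡 m) p}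

/-- Isotropy for ω_a says that the range of G is orthogonal to its image under I_a. Moving one
complex structure across the metric reduces g(I₁Gc, I₂Gd) to ω₃(Gc, Gd), and similarly for the other
pairs, so the four images are mutually orthogonal. -/
theorem IsTriIsotropic.inner_zero_one (hG : H.IsTriIsotropic G) (c d : V) :
    H.g.inner p (H.I 0 p (G c)) (H.I 1 p (G d)) = 0 := by
  rw [inner_I_left, H.I_mul, ← neg_neg (H.g.inner p (G c) _), ← inner_I_left, neg_neg]
  exact hG 2 c d

theorem IsTriIsotropic.inner_zero_two (hG : H.IsTriIsotropic G) (c d : V) :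
    H.g.inner p (H.I 0 p (G c)) (H.I 2 p (G d)) = 0 := by
  rw [← H.I_mul, H.I_orthogonal, H.g.symm]
  exact hG 1 d c

theorem IsTriIsotropic.inner_one_two (hG : H.IsTriIsotropic G) (c d : V) :
    H.g.inner p (H.I 1 p (G c)) (H.I 2 p (G d)) = 0 := by
  rw [← neg_neg (H.I 2 p (G d)), ← I_one_I_zero, map_neg, H.I_orthogonal, H.g.symm, neg_eq_zero]
  exact hG 0 d c

/-- `(c₀, c₁, c₂, c₃) ↦ G c₀ + I₁ G c₁ + I₂ G c₂ + I₃ G c₃`. -/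
def quaternionicSpan (H : HyperkahlerStructure m M) (G : V →ₗ[ℝ] TangentSpace (𝓡 m) p) :
    (V × V) × (V × V) →ₗ[ℝ] TangentSpace (𝓡 m) p :=
  (G.coprod ((H.I 0 p).toLinearMap ∘ₗ G)).coprod
    (((H.I 1 p).toLinearMap ∘ₗ G).coprod ((H.I 2 p).toLinearMap ∘ₗ G))

theorem quaternionicSpan_apply (c₀ c₁ c₂ c₃ : V) :
    quaternionicSpan H G ((c₀, c₁), (c₂, c₃)) =
      G c₀ + H.I 0 p (G c₁) + (H.I 1 p (G c₂) + H.I 2 p (G c₃)) := rfl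

theorem IsTriIsotropic.inner_quaternionicSpan (hG : H.IsTriIsotropic G) (c₀ c₁ c₂ c₃ d : V) :
    H.g.inner p (G d) (quaternionicSpan H G ((c₀, c₁), (c₂, c₃))) = H.g.inner p (G d) (G c₀) := by
  have h : ∀ a, H.g.inner p (G d) (H.I a p (G c₁)) = 0 ∧ H.g.inner p (G d) (H.I a p (G c₂)) = 0 ∧
      H.g.inner p (G d) (H.I a p (G c₃)) = 0 := fun a => by
    simp only [H.g.symm p (G d)]
    exact ⟨hG a _ _, hG a _ _, hG a _ _⟩
  rw [quaternionicSpan_apply]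
  simp only [map_add, h]
  simp

theorem IsTriIsotropic.kahlerForm_quaternionicSpan (hG : H.IsTriIsotropic G)
    (c₀ c₁ c₂ c₃ d : V) (a : Fin 3) :
    H.kahlerForm a p (G d) (quaternionicSpan H G ((c₀, c₁), (c₂, c₃)))
      = H.g.inner p (G d) (G (![c₁, c₂, c₃] a)) := by
  have h0 := hG a d c₀
  have h01 := hG.inner_zero_one
  have h02 := hG.inner_zero_two
  have h12 := hG.inner_one_two
  have h10 : ∀ c d, H.g.inner p (H.I 1 p (G c)) (H.I 0 p (G d)) = 0 := fun c d => by
    rw [H.g.symm, h01]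
  have h20 : ∀ c d, H.g.inner p (H.I 2 p (G c)) (H.I 0 p (G d)) = 0 := fun c d => by
    rw [H.g.symm, h02]
  have h21 : ∀ c d, H.g.inner p (H.I 2 p (G c)) (H.I 1 p (G d)) = 0 := fun c d => by
    rw [H.g.symm, h12]
  rw [kahlerForm] at h0 ⊢
  rw [quaternionicSpan_apply]
  simp only [map_add]
  rw [h0]
  fin_cases a <;> simp [h01, h02, h12, h10, h20, h21, H.I_orthogonal]

theorem IsTriIsotropic.injective_quaternionicSpan (hG : H.IsTriIsotropic G)
    (hi : Function.Injective G) : Function.Injective (quaternionicSpan H G) := by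
  rw [← LinearMap.ker_eq_bot, LinearMap.ker_eq_bot']
  rintro ⟨⟨c₀, c₁⟩, c₂, c₃⟩ h
  have key : ∀ c, H.g.inner p (G c) (G c) = 0 → c = 0 := fun c hc => by
    by_contra hne
    exact (H.g.pos p (G c) fun h0 => hne (hi (by rw [h0, map_zero]))).ne' hc
  have e0 := hG.inner_quaternionicSpan c₀ c₁ c₂ c₃ c₀
  have e1 := hG.kahlerForm_quaternionicSpan c₀ c₁ c₂ c₃ c₁ 0
  have e2 := hG.kahlerForm_quaternionicSpan c₀ c₁ c₂ c₃ c₂ 1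
  have e3 := hG.kahlerForm_quaternionicSpan c₀ c₁ c₂ c₃ c₃ 2
  rw [h, map_zero] at e0
  rw [h, kahlerForm, map_zero] at e1 e2 e3
  rw [key c₀ e0.symm, key c₁ e1.symm, key c₂ e2.symm, key c₃ e3.symm]
  rfl

/-- The four orthogonal copies of V have total dimension 4 dim V = m. -/
theorem IsTriIsotropic.surjective_quaternionicSpan [Module.Finite ℝ V] (hG : H.IsTriIsotropic G)
    (hi : Function.Injective G) (hm : m = 4 * Module.finrank ℝ V) :
    Function.Surjective (quaternionicSpan H G) := by
  have : FiniteDimensional ℝ (TangentSpace (𝓡 m) p) :=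
    inferInstanceAs (FiniteDimensional ℝ (EuclideanSpace ℝ (Fin m)))
  refine (LinearMap.injective_iff_surjective_of_finrank_eq_finrank ?_).1
    (hG.injective_quaternionicSpan hi)
  have h : Module.finrank ℝ (TangentSpace (𝓡 m) p) = m :=
    (finrank_euclideanSpace_fin : Module.finrank ℝ (EuclideanSpace ℝ (Fin m)) = m)
  rw [h, Module.finrank_prod, Module.finrank_prod, hm]
  ring

theorem IsTriIsotropic.exists_eq [Module.Finite ℝ V] (hG : H.IsTriIsotropic G)
    (hi : Function.Injective G) (hm : m = 4 * Module.finrank ℝ V) (v : TangentSpace (𝓡 m) p) :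
    ∃ c₀ c₁ c₂ c₃, v = quaternionicSpan H G ((c₀, c₁), (c₂, c₃)) := by
  obtain ⟨⟨⟨c₀, c₁⟩, c₂, c₃⟩, h⟩ := hG.surjective_quaternionicSpan hi hm v
  exact ⟨c₀, c₁, c₂, c₃, h.symm⟩

theorem holForm_quaternionicSpan (c₀ c₁ c₂ c₃ : V)
    (w : TangentSpace (𝓡 m) p) :
    H.holForm p (quaternionicSpan H G ((c₀, c₁), (c₂, c₃))) w =
      H.holForm p (G c₀) w + Complex.I * H.holForm p (G c₁) w +
        (H.holForm p (H.I 1 p (G c₂)) w + Complex.I * H.holForm p (H.I 1 p (G c₃)) w) := by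
  rw [quaternionicSpan_apply, ← H.I_mul]
  simp only [holForm_add_left, holForm_I_left]

theorem IsTriIsotropic.holForm_eq_zero (hG : H.IsTriIsotropic G) (c d : V) :
    H.holForm p (G c) (G d) = 0 := by
  simp [holForm, hG _ c d]

theorem IsTriIsotropic.holForm_I_one_eq_zero (hG : H.IsTriIsotropic G) (c d : V) :
    H.holForm p (H.I 1 p (G c)) (H.I 1 p (G d)) = 0 := by
  have h1 : H.I 2 p (H.I 1 p (G c)) = -H.I 0 p (G c) := by
    rw [← H.I_mul, H.I_sq, map_neg]
  have h2 := hG 1 c d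
  rw [kahlerForm] at h2
  simp only [holForm, kahlerForm, h1, H.I_sq]
  have h3 : H.g.inner p (G c) (H.I 1 p (G d)) = 0 := by
    rw [H.g.symm]; exact hG 1 d c
  simp [h3, hG.inner_zero_one]

/-- If the range of `G` is Lagrangian for the Kähler forms then
`ω₂ + √-1 ω₃ = ∑ τ_i ∧ √-1 (ω₂ + √-1 ω₃)(G e_i, ·)` for some `τ_i`. -/
theorem IsTriIsotropic.exists_holForm_eq_sum [Module.Finite ℝ V] {n : ℕ}
    (b : Module.Basis (Fin n) ℝ V) (hG : H.IsTriIsotropic G)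
    (hi : Function.Injective G) (hm : m = 4 * n) :
    ∃ τ : Fin n → TangentSpace (𝓡 m) p →ₗ[ℝ] ℂ, ∀ v w, H.holForm p v w =
      ∑ i, (τ i v * (Complex.I * H.holForm p (G (b i)) w)
        - τ i w * (Complex.I * H.holForm p (G (b i)) v)) := by
  have hm' : m = 4 * Module.finrank ℝ V := by rw [hm, Module.finrank_eq_card_basis b]; simp
  let e := LinearEquiv.ofBijective (quaternionicSpan H G)
    ⟨hG.injective_quaternionicSpan hi, hG.surjective_quaternionicSpan hi hm'⟩
  let f₀ : TangentSpace (𝓡 m) p →ₗ[ℝ] V :=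
    LinearMap.fst ℝ V V ∘ₗ LinearMap.fst ℝ (V × V) (V × V) ∘ₗ e.symm.toLinearMap
  let f₁ : TangentSpace (𝓡 m) p →ₗ[ℝ] V :=
    LinearMap.snd ℝ V V ∘ₗ LinearMap.fst ℝ (V × V) (V × V) ∘ₗ e.symm.toLinearMap
  -- On Gc₀ + I₁Gc₁ + I₂Gc₂ + I₃Gc₃ the value is (c₁)_i - √-1 (c₀)_i. It is chosen so that ∑ τ_i(v)
  -- √-1 Ω(G e_i, w) = Ω(Gc₀ + I₁Gc₁, w).
  let τ : Fin n → TangentSpace (𝓡 m) p →ₗ[ℝ] ℂ := fun i =>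
    (b.coord i ∘ₗ f₁).smulRight (1 : ℂ) - (b.coord i ∘ₗ f₀).smulRight Complex.I
  have hsum : ∀ c w, H.holForm p (G c) w = ∑ i, (b.coord i c : ℂ) * H.holForm p (G (b i)) w := by
    intro c w
    let L : V →ₗ[ℝ] ℂ :=
      { toFun := fun c => H.holForm p (G c) w
        map_add' := fun c d => by rw [map_add, holForm_add_left]
        map_smul' := fun r c => by rw [map_smul, holForm_smul_left]; simp }
    have h := congrArg L (b.sum_repr c)
    rw [map_sum] at h
    rw [show H.holForm p (G c) w = L c from rfl, ← h]
    exact Finset.sum_congr rfl fun i _ => by rw [map_smul, Complex.real_smul]; rfl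
  refine ⟨τ, fun v w => ?_⟩
  obtain ⟨⟨⟨a₀, a₁⟩, a₂, a₃⟩, rfl⟩ := e.surjective v
  obtain ⟨⟨⟨c₀, c₁⟩, c₂, c₃⟩, rfl⟩ := e.surjective w
  have hτ : ∀ i x₀ x₁ x₂ x₃, τ i (e ((x₀, x₁), (x₂, x₃)))
      = (b.coord i x₁ : ℂ) - (b.coord i x₀ : ℂ) * Complex.I := by
    intro i x₀ x₁ x₂ x₃
    simp [τ, f₀, f₁]
  have he : ∀ x, e x = quaternionicSpan H G x := fun x => rfl
  simp only [hτ]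
  have hX : ∀ x₀ x₁ w, ∑ i, ((b.coord i x₁ : ℂ) - (b.coord i x₀ : ℂ) * Complex.I) *
      (Complex.I * H.holForm p (G (b i)) w)
        = H.holForm p (G x₀) w + Complex.I * H.holForm p (G x₁) w := by
    intro x₀ x₁ w
    rw [hsum x₀, hsum x₁, Finset.mul_sum, ← Finset.sum_add_distrib]
    refine Finset.sum_congr rfl fun i _ => ?_
    linear_combination -(b.coord i x₀ : ℂ) * H.holForm p (G (b i)) w * Complex.I_sq
  rw [Finset.sum_sub_distrib, hX, hX]
  -- Both halves, G + I₁G and I₂G + I₃G, are isotropic for Ω, so only the mixed pairings survive,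
  -- and these are what the τ_i reproduce.
  have h1 : ∀ c d, H.holForm p (G c) (G d) = 0 := hG.holForm_eq_zero
  have h2 : ∀ c d, H.holForm p (H.I 1 p (G c)) (H.I 1 p (G d)) = 0 := hG.holForm_I_one_eq_zero
  have hR : ∀ c x₀ x₁ x₂ x₃, H.holForm p (H.I 1 p (G c)) (e ((x₀, x₁), (x₂, x₃))) =
      -(H.holForm p (G x₀) (H.I 1 p (G c)) + Complex.I * H.holForm p (G x₁) (H.I 1 p (G c))) := by
    intro c x₀ x₁ x₂ x₃
    rw [holForm_swap, he, holForm_quaternionicSpan, h2, h2]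
    ring
  have hL : ∀ c x₀ x₁ x₂ x₃, H.holForm p (G c) (e ((x₀, x₁), (x₂, x₃))) =
      H.holForm p (G c) (H.I 1 p (G x₂)) + Complex.I * H.holForm p (G c) (H.I 1 p (G x₃)) := by
    intro c x₀ x₁ x₂ x₃
    rw [holForm_swap, he, holForm_quaternionicSpan, h1, h1, H.holForm_swap (G c),
      H.holForm_swap (G c)]
    ring
  have h0 := holForm_quaternionicSpan (H := H) (G := G) a₀ a₁ a₂ a₃ (e ((c₀, c₁), c₂, c₃))
  rw [← he] at h0
  rw [h0, hR, hR, hL c₀, hL c₁]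
  ring

end Isotropic

end HyperkahlerStructure

end PointwiseAlgebra

/-! ### Inverse functions and flow boxes for germs of actions -/

section FlowBox

open Filter

variable {V E F : Type*} [NormedAddCommGroup E] [NormedSpace ℝ E] [FiniteDimensional ℝ E]
  [NormedAddCommGroup F] [NormedSpace ℝ F] [FiniteDimensional ℝ F]
  [NormedAddCommGroup V] [NormedSpace ℝ V] [FiniteDimensional ℝ V]

/-- The inverse function theorem, with the source shrunk so that the derivative is invertible
throughout. This makes the inverse smooth on the whole target, not only at one point. -/
theorem exists_openPartialHomeomorph_of_bijective_fderiv {f : E → F} {x₀ : E}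
    (hf : SmoothNear f x₀) (hb : Function.Bijective (fderiv ℝ f x₀)) :
    ∃ e : OpenPartialHomeomorph E F, x₀ ∈ e.source ∧ (e : E → F) = f ∧
      (∀ x ∈ e.source, ContDiffAt ℝ ∞ f x) ∧ ∀ y ∈ e.target, ContDiffAt ℝ ∞ e.symm y := by
  have := FiniteDimensional.complete ℝ E
  have := FiniteDimensional.complete ℝ F
  let L₀ : E ≃L[ℝ] F :=
    (LinearEquiv.ofBijective (fderiv ℝ f x₀).toLinearMap hb).toContinuousLinearEquiv
  have hL₀ : (L₀ : E →L[ℝ] F) = fderiv ℝ f x₀ := by ext; rfl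
  have h0 : ContDiffAt ℝ ∞ f x₀ := hf.self_of_nhds
  have h1 : HasFDerivAt f (L₀ : E →L[ℝ] F) x₀ := by
    rw [hL₀]; exact (h0.differentiableAt (by simp)).hasFDerivAt
  let e₀ := h0.toOpenPartialHomeomorph f h1 (by simp)
  have he₀ : (e₀ : E → F) = f := rfl
  have hx₀ : x₀ ∈ e₀.source := h0.mem_toOpenPartialHomeomorph_source h1 (by simp)
  have hinv : ∀ᶠ x in 𝓝 x₀, fderiv ℝ f x ∈ Set.range ((↑) : (E ≃L[ℝ] F) → E →L[ℝ] F) :=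
    (h0.continuousAt_fderiv (by simp)).eventually (by rw [← hL₀]; exact L₀.nhds)
  obtain ⟨s, hs, hso, hxs⟩ := eventually_nhds_iff.1 (hf.and hinv)
  refine ⟨e₀.restrOpen s hso, ⟨hx₀, hxs⟩, rfl, fun x hx => (hs x hx.2).1, fun y hy => ?_⟩
  have hy' : y ∈ e₀.target := hy.1
  have hys : e₀.symm y ∈ s := ((e₀.restrOpen s hso).map_target hy).2
  obtain ⟨L, hL⟩ := (hs _ hys).2
  exact e₀.contDiffAt_symm hy' (f₀' := L)
    (by rw [hL]; exact ((hs _ hys).1.differentiableAt (by simp)).hasFDerivAt) (hs _ hys).1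

/-- `a` is the germ at `(0, x₀)` of a smooth local action of `V` on `E`. -/
structure IsActionGerm (a : V × E → E) (x₀ : E) : Prop where
  smooth : SmoothNear a (0, x₀)
  zero : ∀ᶠ x in 𝓝 x₀, a (0, x) = x
  add : ∀ᶠ q : V × V × E in 𝓝 (0, 0, x₀), a (q.1, a (q.2.1, q.2.2)) = a (q.1 + q.2.1, q.2.2)

variable {a : V × E → E} {x₀ : E}

theorem IsActionGerm.hasFDerivAt_left (h : IsActionGerm a x₀) :
    HasFDerivAt (fun t => a (t, x₀)) (fderiv ℝ (fun t => a (t, x₀)) 0) 0 := by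
  have : ContDiffAt ℝ ∞ (fun t => a (t, x₀)) 0 :=
    ContDiffAt.comp (0 : V) h.smooth.self_of_nhds (contDiffAt_id.prodMk contDiffAt_const)
  exact (this.differentiableAt (by simp)).hasFDerivAt

/-- If c lies in the kernel, the curve γ(s) = a(s c, x₀) has zero velocity at s = 0. The law γ(s +
r) = a(s c, γ(r)) carries this to every small s. So γ is constant near 0, and freeness gives s c = 0
for small s. -/
theorem IsActionGerm.injective_fderiv (h : IsActionGerm a x₀)
    (hfree : ∀ᶠ t in 𝓝 (0 : V), a (t, x₀) = x₀ → t = 0) :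
    Function.Injective (fderiv ℝ (fun t => a (t, x₀)) 0) := by
  rw [injective_iff_map_eq_zero]
  intro c hc
  let γ : ℝ → E := fun s => a (s • c, x₀)
  have hc0 : Tendsto (fun s : ℝ => s • c) (𝓝 0) (𝓝 (0 : V)) := by
    have : ContinuousAt (fun s : ℝ => s • c) 0 := by fun_prop
    simpa [ContinuousAt] using this
  have hz : a (0, x₀) = x₀ := h.zero.self_of_nhds
  have hγ0 : HasDerivAt γ 0 0 := by
    have h1 : HasFDerivAt (fun t => a (t, x₀)) (fderiv ℝ (fun t => a (t, x₀)) 0) ((0 : ℝ) • c) := by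
      rw [zero_smul]; exact h.hasFDerivAt_left
    have := h1.comp_hasDerivAt (0 : ℝ) ((hasDerivAt_id (0 : ℝ)).smul_const c)
    simp only [one_smul, hc] at this
    exact this
  have hγ : ∀ᶠ s in 𝓝 (0 : ℝ), HasDerivAt γ 0 s := by
    have h1 : ∀ᶠ q : ℝ × ℝ in 𝓝 (0, 0), a (q.1 • c, a (q.2 • c, x₀)) = a (q.1 • c + q.2 • c, x₀) := by
      have h2 : Tendsto (fun q : ℝ × ℝ => (q.1 • c, q.2 • c, x₀)) (𝓝 (0, 0)) (𝓝 (0, 0, x₀)) := by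
        have : ContinuousAt (fun q : ℝ × ℝ => (q.1 • c, q.2 • c, x₀)) (0, 0) := by fun_prop
        simpa [ContinuousAt] using this
      exact h2.eventually h.add
    rw [nhds_prod_eq] at h1
    have h3 : ∀ᶠ s in 𝓝 (0 : ℝ), ContDiffAt ℝ ∞ a (s • c, x₀) := by
      have h2 : Tendsto (fun s : ℝ => (s • c, x₀)) (𝓝 0) (𝓝 (0, x₀)) :=
        hc0.prodMk_nhds tendsto_const_nhds
      exact h2.eventually h.smooth
    filter_upwards [h1.curry, h3] with s hs hs'
    have h4 : HasDerivAt (fun r => a (s • c, γ r)) 0 0 := by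
      have h5 : ContDiffAt ℝ ∞ (fun x => a (s • c, x)) x₀ :=
        ContDiffAt.comp x₀ hs' (contDiffAt_const.prodMk contDiffAt_id)
      have h6 : HasFDerivAt (fun x => a (s • c, x)) (fderiv ℝ (fun x => a (s • c, x)) x₀) (γ 0) := by
        have : γ 0 = x₀ := by simp [γ, hz]
        rw [this]; exact (h5.differentiableAt (by simp)).hasFDerivAt
      have h7 := h6.comp_hasDerivAt (0 : ℝ) hγ0
      rw [map_zero] at h7
      exact h7
    have h7 : HasDerivAt (fun r => γ (s + r)) 0 0 := by
      refine h4.congr_of_eventuallyEq (hs.mono fun r hr => ?_)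
      simp only [γ, add_smul]
      exact hr.symm
    have h9 : HasDerivAt (fun r => γ (s + (r - s))) 0 s := by
      have := (show HasDerivAt (fun r => γ (s + r)) 0 (s - s) by rwa [sub_self]).comp_sub_const s s
      exact this
    simpa using h9
  obtain ⟨ε, hε, hball⟩ := Metric.eventually_nhds_iff_ball.1 hγ
  have hconst : ∀ s ∈ Metric.ball (0 : ℝ) ε, γ s = x₀ := fun s hs => by
    have := (convex_ball (0 : ℝ) ε).is_const_of_fderivWithin_eq_zero (𝕜 := ℝ) (f := γ)
      (fun x hx => (hball x hx).differentiableAt.differentiableWithinAt)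
      (fun x hx => by
        rw [fderivWithin_of_isOpen Metric.isOpen_ball hx]
        ext; simp [(hball x hx).deriv]) hs (Metric.mem_ball_self hε)
    rw [this]; simp [γ, hz]
  have h10 : ∀ᶠ s in 𝓝 (0 : ℝ), s • c = 0 := by
    filter_upwards [hc0.eventually hfree, Metric.ball_mem_nhds 0 hε] with s hs hs'
    exact hs (hconst s hs')
  obtain ⟨s, hs, hs0⟩ := ((h10.filter_mono nhdsWithin_le_nhds).and
    (self_mem_nhdsWithin : {0}ᶜ ∈ 𝓝[≠] (0 : ℝ))).exists
  exact (smul_eq_zero.1 hs).resolve_left hs0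

/-- Take a complement Y of the orbit directions. By the inverse function theorem (t, y) ↦ a(t, x₀ +
y) is a local diffeomorphism. In these coordinates the action law becomes translation of t, and t is
the required function. -/
theorem IsActionGerm.exists_time (h : IsActionGerm a x₀)
    (hi : Function.Injective (fderiv ℝ (fun t => a (t, x₀)) 0)) :
    ∃ τ : E → V, SmoothNear τ x₀ ∧ ∀ᶠ q : V × E in 𝓝 (0, x₀), τ (a q) = τ q.2 + q.1 := by
  set L := fderiv ℝ (fun t => a (t, x₀)) 0 with hL
  have hz : a (0, x₀) = x₀ := h.zero.self_of_nhds
  obtain ⟨Y, hY⟩ := (LinearMap.range L.toLinearMap).exists_isCompl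
  have ha : HasFDerivAt a (fderiv ℝ a (0, x₀)) (0, x₀) :=
    (h.smooth.self_of_nhds.differentiableAt (by simp)).hasFDerivAt
  let Φ : V × Y → E := fun q => a (q.1, x₀ + q.2)
  let ι : V × Y →L[ℝ] V × E := (ContinuousLinearMap.id ℝ V).prodMap Y.subtypeL
  have hΦι : Φ = fun q => a ((0, x₀) + ι q) := by
    funext q; simp only [Φ, ι]; congr 1; ext1 <;> simp
  have hΦs : SmoothNear Φ 0 := by
    have h1 : Tendsto (fun q => (0, x₀) + ι q) (𝓝 0) (𝓝 (0, x₀)) := by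
      have : ContinuousAt (fun q => (0, x₀) + ι q) 0 := by fun_prop
      simpa [ContinuousAt] using this
    rw [hΦι]
    filter_upwards [h1.eventually h.smooth] with q hq
    exact ContDiffAt.comp q hq (contDiffAt_const.add ι.contDiff.contDiffAt)
  have hd1 : ∀ t, fderiv ℝ a (0, x₀) (t, 0) = L t := fun t => by
    have : HasFDerivAt (fun t => a (t, x₀)) _ 0 :=
      HasFDerivAt.comp (0 : V) ha (hasFDerivAt_prodMk_left 0 x₀)
    rw [hL, this.fderiv]; simp
  have hd2 : ∀ x, fderiv ℝ a (0, x₀) (0, x) = x := fun x => by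
    have h1 : HasFDerivAt (fun x => a (0, x)) _ x₀ :=
      HasFDerivAt.comp x₀ ha (hasFDerivAt_prodMk_right 0 x₀)
    have h2 : HasFDerivAt (fun x => a (0, x)) (ContinuousLinearMap.id ℝ E) x₀ :=
      (hasFDerivAt_id x₀).congr_of_eventuallyEq h.zero
    have h3 := congrArg (fun T : E →L[ℝ] E => T x) (h1.unique h2)
    simpa using h3
  have hdΦ : ∀ q, fderiv ℝ Φ 0 q = L q.1 + q.2 := fun q => by
    have h1 : HasFDerivAt (fun q => (0, x₀) + ι q) ι 0 := ι.hasFDerivAt.const_add _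
    have h2 : HasFDerivAt a (fderiv ℝ a (0, x₀)) ((0, x₀) + ι 0) := by
      rw [map_zero, add_zero]; exact ha
    have h3 : HasFDerivAt Φ ((fderiv ℝ a (0, x₀)).comp ι) 0 := by rw [hΦι]; exact HasFDerivAt.comp 0 h2 h1
    rw [h3.fderiv]
    have : (q.1, (q.2 : E)) = (q.1, 0) + (0, (q.2 : E)) := by simp
    change fderiv ℝ a (0, x₀) (q.1, (q.2 : E)) = _
    rw [this, map_add, hd1, hd2]
  have hbij : Function.Bijective (fderiv ℝ Φ 0) := by
    constructor
    · rw [injective_iff_map_eq_zero]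
      rintro ⟨t, y⟩ hq
      rw [hdΦ] at hq
      have h1 : (y : E) ∈ LinearMap.range L.toLinearMap :=
        ⟨-t, by simpa using (neg_eq_of_add_eq_zero_right (show L t + (y : E) = 0 from hq))⟩
      have h2 : (y : E) = 0 :=
        (Submodule.mem_bot ℝ).1 (hY.disjoint.le_bot (Submodule.mem_inf.2 ⟨h1, y.2⟩))
      have h3 : t = 0 := hi (by simpa [h2] using hq)
      ext1
      · exact h3
      · exact Subtype.ext h2
    · intro x
      obtain ⟨u, ⟨t, rfl⟩, y, hy, hx⟩ := (Submodule.mem_sup (R := ℝ) (M := E)).1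
        (show x ∈ LinearMap.range L.toLinearMap ⊔ Y by rw [hY.sup_eq_top]; trivial)
      exact ⟨(t, ⟨y, hy⟩), by rw [hdΦ]; exact hx⟩
  obtain ⟨e, h0, he, -, hes⟩ := exists_openPartialHomeomorph_of_bijective_fderiv hΦs hbij
  have hΦ0 : Φ 0 = x₀ := by simp [Φ, hz]
  have hx₀t : x₀ ∈ e.target := by rw [← hΦ0, ← he]; exact e.map_source h0
  have hsx₀ : e.symm x₀ = 0 := by
    conv_lhs => rw [← hΦ0, ← he]
    exact e.left_inv h0
  refine ⟨fun x => (e.symm x).1, ?_, ?_⟩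
  · filter_upwards [e.open_target.mem_nhds hx₀t] with x hx
    exact contDiff_fst.contDiffAt.comp x (hes x hx)
  have hcont : ContinuousAt e.symm x₀ := e.continuousAt_symm hx₀t
  have hcont2 : ContinuousAt (fun q : V × E => e.symm q.2) (0, x₀) :=
    ContinuousAt.comp (f := fun q : V × E => q.2) (x := ((0 : V), x₀)) hcont continuousAt_snd
  have t1 : Tendsto (fun q : V × E => (q.1, (e.symm q.2).1, x₀ + ((e.symm q.2).2 : E)))
      (𝓝 (0, x₀)) (𝓝 (0, 0, x₀)) := by
    have : ContinuousAt (fun q : V × E => (q.1, (e.symm q.2).1, x₀ + ((e.symm q.2).2 : E))) (0, x₀) :=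
      continuousAt_fst.prodMk ((continuousAt_fst.comp hcont2).prodMk
        (continuousAt_const.add (continuous_subtype_val.continuousAt.comp
          (continuousAt_snd.comp hcont2))))
    simpa [ContinuousAt, hsx₀] using this
  have t2 : Tendsto (fun q : V × E => (q.1 + (e.symm q.2).1, (e.symm q.2).2))
      (𝓝 (0, x₀)) (𝓝 0) := by
    have : ContinuousAt (fun q : V × E => (q.1 + (e.symm q.2).1, (e.symm q.2).2)) (0, x₀) :=
      (continuousAt_fst.add (continuousAt_fst.comp hcont2)).prodMk (continuousAt_snd.comp hcont2)
    simp only [ContinuousAt, hsx₀, Prod.fst_zero, Prod.snd_zero, add_zero, Prod.mk_zero_zero] at this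
    exact this
  filter_upwards [t1.eventually h.add, t2.eventually (e.open_source.mem_nhds h0),
    continuousAt_snd.eventually (e.open_target.mem_nhds hx₀t)] with q h1 h2 h3
  have h4 : a ((e.symm q.2).1, x₀ + ((e.symm q.2).2 : E)) = q.2 := by
    have := e.right_inv h3
    rwa [he] at this
  have h5 : a q = e (q.1 + (e.symm q.2).1, (e.symm q.2).2) := by
    rw [he]
    rwa [h4] at h1
  rw [h5, e.left_inv h2, add_comm]

end FlowBox

/-! ### The infinitesimal action on the manifold -/

section Action

open Filter

variable {m n : ℕ} {M : Type*} [TopologicalSpace M]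
  [ChartedSpace (EuclideanSpace ℝ (Fin m)) M] [IsManifold (𝓡 m) ∞ M]

namespace LocalAction

variable (A : LocalAction m M n)

/-- The infinitesimal action at `p`. -/
def generator (p : M) : EuclideanSpace ℝ (Fin n) →L[ℝ] TangentSpace (𝓡 m) p :=
  mfderiv (𝓡 n) (𝓡 m) (fun t : EuclideanSpace ℝ (Fin n) => A.act t p) 0

theorem contMDiffAt_act {t : EuclideanSpace ℝ (Fin n)} {p : M} (h : (t, p) ∈ A.dom) :
    ContMDiffAt ((𝓡 n).prod (𝓡 m)) (𝓡 m) ∞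
      (fun q : EuclideanSpace ℝ (Fin n) × M => A.act q.1 q.2) (t, p) :=
  A.smooth.contMDiffAt (A.isOpen_dom.mem_nhds h)

theorem mdifferentiableAt_orbit (p : M) :
    MDifferentiableAt (𝓡 n) (𝓡 m) (fun t : EuclideanSpace ℝ (Fin n) => A.act t p) 0 :=
  (ContMDiffAt.comp (0 : EuclideanSpace ℝ (Fin n)) (A.contMDiffAt_act (A.zero_mem p))
    (contMDiffAt_id.prodMk contMDiffAt_const)).mdifferentiableAt (by simp)

theorem field_eq_generator (i : Fin n) (p : M) :
    A.field i p = A.generator p (EuclideanSpace.single i 1) := rfl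

/-- Differentiate the hypothesis along the orbit. It is applied with B = 0 to the invariant moment
map and with B = id to the time function. -/
theorem mfderiv_generator {F : Type*} [NormedAddCommGroup F] [NormedSpace ℝ F] {f : M → F} {p : M}
    (hf : MDifferentiableAt (𝓡 m) 𝓘(ℝ, F) f p) (B : EuclideanSpace ℝ (Fin n) →L[ℝ] F)
    (h : ∀ᶠ t in 𝓝 (0 : EuclideanSpace ℝ (Fin n)), f (A.act t p) = f p + B t)
    (v : EuclideanSpace ℝ (Fin n)) :
    (mfderiv (𝓡 m) 𝓘(ℝ, F) f p (A.generator p v) : F) = B v := by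
  have h1 : HasMFDerivAt (𝓡 n) (𝓡 m) (fun t : EuclideanSpace ℝ (Fin n) => A.act t p) 0
      (mfderiv (𝓡 n) (𝓡 m) (fun t : EuclideanSpace ℝ (Fin n) => A.act t p) 0) :=
    (A.mdifferentiableAt_orbit p).hasMFDerivAt
  have h2 : HasMFDerivAt (𝓡 m) 𝓘(ℝ, F) f (A.act 0 p) (mfderiv (𝓡 m) 𝓘(ℝ, F) f (A.act 0 p)) :=
    MDifferentiableAt.hasMFDerivAt (by rwa [A.act_zero])
  let L : EuclideanSpace ℝ (Fin m) →L[ℝ] F := mfderiv (𝓡 m) 𝓘(ℝ, F) f (A.act 0 p)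
  let G : EuclideanSpace ℝ (Fin n) →L[ℝ] EuclideanSpace ℝ (Fin m) := A.generator p
  have h3 : HasFDerivAt (fun t => f (A.act t p)) (L.comp G) 0 := (h2.comp 0 h1).hasFDerivAt
  have h4 : HasFDerivAt (fun t => f (A.act t p)) B 0 :=
    (B.hasFDerivAt.const_add (f p)).congr_of_eventuallyEq h
  have h5 := congrArg (fun L : EuclideanSpace ℝ (Fin n) →L[ℝ] F => L v) (h3.unique h4)
  -- The chain rule produces the derivative at `A.act 0 p`, in a type that depends on this point.
  have h6 : ∀ q, q = p → (mfderiv (𝓡 m) 𝓘(ℝ, F) f q : EuclideanSpace ℝ (Fin m) →L[ℝ] F)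
      = mfderiv (𝓡 m) 𝓘(ℝ, F) f p := by
    rintro _ rfl; rfl
  have h7 := congrArg (fun L : EuclideanSpace ℝ (Fin m) →L[ℝ] F => L (A.generator p v))
    (h6 _ (A.act_zero p))
  exact h7.symm.trans h5

theorem isActionGerm_chart (p : M) :
    IsActionGerm (fun q : EuclideanSpace ℝ (Fin n) × EuclideanSpace ℝ (Fin m) =>
      chartAt (EuclideanSpace ℝ (Fin m)) p
        (A.act q.1 ((chartAt (EuclideanSpace ℝ (Fin m)) p).symm q.2)))
      (chartAt (EuclideanSpace ℝ (Fin m)) p p) := by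
  set c := chartAt (EuclideanSpace ℝ (Fin m)) p with hc
  have hp : p ∈ c.source := mem_chart_source _ p
  have hpt : c p ∈ c.target := c.map_source hp
  have hcp : c.symm (c p) = p := c.left_inv hp
  have hsym : ContinuousAt c.symm (c p) := c.continuousAt_symm hpt
  have hact : ∀ {t q}, (t, q) ∈ A.dom → ContinuousAt
      (fun q : EuclideanSpace ℝ (Fin n) × M => A.act q.1 q.2) (t, q) := fun h =>
    (A.contMDiffAt_act h).continuousAt
  have t1 : ContinuousAt (fun q : EuclideanSpace ℝ (Fin n) × EuclideanSpace ℝ (Fin m) =>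
      (q.1, c.symm q.2)) (0, c p) :=
    continuousAt_fst.prodMk (ContinuousAt.comp (f := Prod.snd)
      (x := ((0 : EuclideanSpace ℝ (Fin n)), c p)) hsym continuousAt_snd)
  have h0 : ((0 : EuclideanSpace ℝ (Fin n)), c.symm (c p)) ∈ A.dom := A.zero_mem _
  have t2 : ContinuousAt (fun q : EuclideanSpace ℝ (Fin n) × EuclideanSpace ℝ (Fin m) =>
      A.act q.1 (c.symm q.2)) (0, c p) := ContinuousAt.comp
        (g := fun q : EuclideanSpace ℝ (Fin n) × M => A.act q.1 q.2)
        (f := fun q : EuclideanSpace ℝ (Fin n) × EuclideanSpace ℝ (Fin m) => (q.1, c.symm q.2))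
        (x := (0, c p)) (hact h0) t1
  have hs2 : A.act 0 (c.symm (c p)) ∈ c.source := by rwa [A.act_zero, hcp]
  have e1 : ∀ᶠ q : EuclideanSpace ℝ (Fin n) × EuclideanSpace ℝ (Fin m) in 𝓝 (0, c p),
      q.2 ∈ c.target ∧ (q.1, c.symm q.2) ∈ A.dom ∧ A.act q.1 (c.symm q.2) ∈ c.source :=
    (continuousAt_snd.eventually (c.open_target.mem_nhds hpt)).and
      ((t1.eventually (A.isOpen_dom.mem_nhds h0)).and
        (t2.eventually (c.open_source.mem_nhds hs2)))
  refine ⟨?_, ?_, ?_⟩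
  · filter_upwards [e1] with q ⟨h1, h2, h3⟩
    have d1 : ContMDiffAt (𝓡 m) (𝓡 m) ∞ c.symm q.2 :=
      contMDiffOn_chart_symm.contMDiffAt (c.open_target.mem_nhds h1)
    have d2 : ContMDiffAt (𝓡 m) (𝓡 m) ∞ c (A.act q.1 (c.symm q.2)) :=
      contMDiffOn_chart.contMDiffAt (c.open_source.mem_nhds h3)
    have d3 : ContMDiffAt ((𝓡 n).prod (𝓡 m)) ((𝓡 n).prod (𝓡 m)) ∞
        (fun q : EuclideanSpace ℝ (Fin n) × EuclideanSpace ℝ (Fin m) => (q.1, c.symm q.2)) q :=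
      contMDiffAt_fst.prodMk (ContMDiffAt.comp q d1 contMDiffAt_snd)
    have d4 := ContMDiffAt.comp q d2 (ContMDiffAt.comp q (A.contMDiffAt_act h2) d3)
    rw [← contMDiffAt_iff_contDiffAt, modelWithCornersSelf_prod, ← chartedSpaceSelf_prod]
    exact d4
  · filter_upwards [c.open_target.mem_nhds hpt] with x hx
    rw [A.act_zero, c.right_inv hx]
  · have s1 : ContinuousAt (fun q : EuclideanSpace ℝ (Fin n) × EuclideanSpace ℝ (Fin n) ×
        EuclideanSpace ℝ (Fin m) => (q.2.1, q.2.2)) (0, 0, c p) := by fun_prop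
    have s2 : ContinuousAt (fun q : EuclideanSpace ℝ (Fin n) × EuclideanSpace ℝ (Fin n) ×
        EuclideanSpace ℝ (Fin m) => A.act q.2.1 (c.symm q.2.2)) (0, 0, c p) :=
      ContinuousAt.comp (g := fun q : EuclideanSpace ℝ (Fin n) × EuclideanSpace ℝ (Fin m) =>
        A.act q.1 (c.symm q.2)) (f := fun q : EuclideanSpace ℝ (Fin n) ×
        EuclideanSpace ℝ (Fin n) × EuclideanSpace ℝ (Fin m) => (q.2.1, q.2.2))
        (x := (0, 0, c p)) t2 s1
    have s3 : ContinuousAt (fun q : EuclideanSpace ℝ (Fin n) × EuclideanSpace ℝ (Fin n) ×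
        EuclideanSpace ℝ (Fin m) => (q.1, A.act q.2.1 (c.symm q.2.2))) (0, 0, c p) :=
      continuousAt_fst.prodMk s2
    have s4 : Tendsto (fun q : EuclideanSpace ℝ (Fin n) × EuclideanSpace ℝ (Fin n) ×
        EuclideanSpace ℝ (Fin m) => (q.1 + q.2.1, q.2.2)) (𝓝 (0, 0, c p)) (𝓝 (0, c p)) := by
      have : ContinuousAt (fun q : EuclideanSpace ℝ (Fin n) × EuclideanSpace ℝ (Fin n) ×
        EuclideanSpace ℝ (Fin m) => (q.1 + q.2.1, q.2.2)) (0, 0, c p) := by fun_prop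
      simpa [ContinuousAt] using this
    filter_upwards [s1.eventually e1, s4.eventually e1,
      s3.eventually (A.isOpen_dom.mem_nhds (A.zero_mem _))] with q ⟨h1, h2, h3⟩ ⟨_, h4, _⟩ h5
    rw [c.left_inv h3, A.act_add _ _ _ h2 h5 h4]

theorem IsFree.injective_fderiv_chart {A : LocalAction m M n} (hA : A.IsFree) (p : M) :
    Function.Injective (fderiv ℝ (fun t => chartAt (EuclideanSpace ℝ (Fin m)) p
      (A.act t ((chartAt (EuclideanSpace ℝ (Fin m)) p).symm
        (chartAt (EuclideanSpace ℝ (Fin m)) p p)))) 0) := by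
  have hp := mem_chart_source (EuclideanSpace ℝ (Fin m)) p
  refine (A.isActionGerm_chart p).injective_fderiv ?_
  have hcont : ContinuousAt (fun t => A.act t p) 0 := (A.mdifferentiableAt_orbit p).continuousAt
  have h1 : ∀ᶠ t in 𝓝 (0 : EuclideanSpace ℝ (Fin n)),
      A.act t p ∈ (chartAt (EuclideanSpace ℝ (Fin m)) p).source :=
    hcont.eventually ((chartAt (EuclideanSpace ℝ (Fin m)) p).open_source.mem_nhds
      (by simpa only [A.act_zero]))
  filter_upwards [hA p, h1] with t h2 h3 h4
  rw [(chartAt (EuclideanSpace ℝ (Fin m)) p).left_inv hp] at h4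
  exact h2 ((chartAt (EuclideanSpace ℝ (Fin m)) p).injOn h3 hp h4)

theorem IsFree.injective_generator {A : LocalAction m M n} (hA : A.IsFree) (p : M) :
    Function.Injective (A.generator p) := by
  set c := chartAt (EuclideanSpace ℝ (Fin m)) p with hc
  have hp : p ∈ c.source := mem_chart_source _ p
  have hcp : c.symm (c p) = p := c.left_inv hp
  have h := hA.injective_fderiv_chart p
  simp only [← hc, hcp] at h
  have h1 : HasMFDerivAt (𝓡 n) (𝓡 m) (fun t : EuclideanSpace ℝ (Fin n) => A.act t p) 0
      (mfderiv (𝓡 n) (𝓡 m) (fun t : EuclideanSpace ℝ (Fin n) => A.act t p) 0) :=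
    (A.mdifferentiableAt_orbit p).hasMFDerivAt
  have h2 : HasMFDerivAt (𝓡 m) (𝓡 m) c (A.act 0 p) (mfderiv (𝓡 m) (𝓡 m) c (A.act 0 p)) := by
    refine MDifferentiableAt.hasMFDerivAt (ContMDiffAt.mdifferentiableAt (n := ∞) ?_ (by simp))
    exact contMDiffOn_chart.contMDiffAt (c.open_source.mem_nhds (by rwa [A.act_zero]))
  let L : EuclideanSpace ℝ (Fin m) →L[ℝ] EuclideanSpace ℝ (Fin m) :=
    mfderiv (𝓡 m) (𝓡 m) c (A.act 0 p)
  let G : EuclideanSpace ℝ (Fin n) →L[ℝ] EuclideanSpace ℝ (Fin m) := A.generator p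
  have h3 : HasFDerivAt (fun t => c (A.act t p)) (L.comp G) 0 := (h2.comp 0 h1).hasFDerivAt
  rw [h3.fderiv] at h
  exact Function.Injective.of_comp (f := L) h

theorem IsFree.exists_time {A : LocalAction m M n} (hA : A.IsFree) (p : M) :
    ∃ τ : M → EuclideanSpace ℝ (Fin n), (∀ᶠ q in 𝓝 p, ContMDiffAt (𝓡 m) (𝓡 n) ∞ τ q) ∧
      ∀ᶠ q in 𝓝 p, ∀ᶠ t in 𝓝 (0 : EuclideanSpace ℝ (Fin n)), τ (A.act t q) = τ q + t := by
  set c := chartAt (EuclideanSpace ℝ (Fin m)) p with hc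
  have hp : p ∈ c.source := mem_chart_source _ p
  have hcp : c.symm (c p) = p := c.left_inv hp
  have hcc : ContinuousAt c p := c.continuousAt hp
  have h := hA.injective_fderiv_chart p
  obtain ⟨τ, hτ, hτa⟩ := (A.isActionGerm_chart p).exists_time h
  refine ⟨fun q => τ (c q), ?_, ?_⟩
  · filter_upwards [hcc.eventually hτ, c.open_source.mem_nhds hp] with q h1 h2
    exact ContMDiffAt.comp q (contMDiffAt_iff_contDiffAt.2 h1)
      (contMDiffOn_chart.contMDiffAt (c.open_source.mem_nhds h2))
  · rw [nhds_prod_eq] at hτa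
    have h2 := hcc.eventually (Filter.Eventually.curry (Filter.eventually_swap_iff.1 hτa))
    filter_upwards [h2, c.open_source.mem_nhds hp] with q h3 h4
    filter_upwards [h3] with t h5
    simpa only [← hc, Prod.swap_prod_mk, c.left_inv h4] using h5

end LocalAction
end Action

/-! ### Smooth charts and forms read in them -/

section Charts

open Filter

variable {m n : ℕ} {M : Type*} [TopologicalSpace M]
  [ChartedSpace (EuclideanSpace ℝ (Fin m)) M]
  {F : Type*} [NormedAddCommGroup F] [NormedSpace ℝ F]

/-- `ψ` is a diffeomorphism of an open subset of `M` onto an open subset of `F`. -/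
structure IsSmoothChart (ψ : OpenPartialHomeomorph M F) : Prop where
  smooth : ContMDiffOn (𝓡 m) 𝓘(ℝ, F) ∞ ψ ψ.source
  smooth_symm : ContMDiffOn 𝓘(ℝ, F) (𝓡 m) ∞ ψ.symm ψ.target

namespace IsSmoothChart

variable {ψ : OpenPartialHomeomorph M F}

theorem contMDiffAt (h : IsSmoothChart (m := m) ψ) {q : M} (hq : q ∈ ψ.source) :
    ContMDiffAt (𝓡 m) 𝓘(ℝ, F) ∞ ψ q :=
  h.smooth.contMDiffAt (ψ.open_source.mem_nhds hq)

theorem contMDiffAt_symm (h : IsSmoothChart (m := m) ψ) {y : F} (hy : y ∈ ψ.target) :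
    ContMDiffAt 𝓘(ℝ, F) (𝓡 m) ∞ ψ.symm y :=
  h.smooth_symm.contMDiffAt (ψ.open_target.mem_nhds hy)

theorem mdifferentiable (h : IsSmoothChart (m := m) ψ) : ψ.MDifferentiable (𝓡 m) 𝓘(ℝ, F) :=
  ⟨h.smooth.mdifferentiableOn (by simp), h.smooth_symm.mdifferentiableOn (by simp)⟩

theorem restrOpen (h : IsSmoothChart (m := m) ψ) {s : Set M} (hs : IsOpen s) :
    IsSmoothChart (m := m) (ψ.restrOpen s hs) :=
  ⟨h.smooth.mono fun _ hq => hq.1, h.smooth_symm.mono fun _ hy => hy.1⟩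

theorem contDiffAt_comp_symm (h : IsSmoothChart (m := m) ψ) {F' : Type*} [NormedAddCommGroup F']
    [NormedSpace ℝ F'] {f : M → F'} {y : F} (hy : y ∈ ψ.target)
    (hf : ContMDiffAt (𝓡 m) 𝓘(ℝ, F') ∞ f (ψ.symm y)) : ContDiffAt ℝ ∞ (fun y => f (ψ.symm y)) y :=
  contMDiffAt_iff_contDiffAt.1 (ContMDiffAt.comp y hf (h.contMDiffAt_symm hy))

/-- The derivative of a smooth chart. -/
def deriv (h : IsSmoothChart (m := m) ψ) {q : M} (hq : q ∈ ψ.source) :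
    TangentSpace (𝓡 m) q ≃L[ℝ] F :=
  h.mdifferentiable.mfderiv hq

theorem fderiv_comp_symm (h : IsSmoothChart (m := m) ψ) {F' : Type*} [NormedAddCommGroup F']
    [NormedSpace ℝ F'] {f : M → F'} {q : M} (hq : q ∈ ψ.source)
    (hf : MDifferentiableAt (𝓡 m) 𝓘(ℝ, F') f q) (v : F) :
    fderiv ℝ (fun y => f (ψ.symm y)) (ψ q) v
      = mfderiv (𝓡 m) 𝓘(ℝ, F') f q ((h.deriv hq).symm v) := by
  have h1 : HasMFDerivAt 𝓘(ℝ, F) (𝓡 m) ψ.symm (ψ q) (mfderiv 𝓘(ℝ, F) (𝓡 m) ψ.symm (ψ q)) :=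
    (h.mdifferentiable.mdifferentiableAt_symm (ψ.map_source hq)).hasMFDerivAt
  let L : EuclideanSpace ℝ (Fin m) →L[ℝ] F' := mfderiv (𝓡 m) 𝓘(ℝ, F') f q
  have h2 : HasMFDerivAt (𝓡 m) 𝓘(ℝ, F') f (ψ.symm (ψ q)) L := by
    rw [ψ.left_inv hq]; exact hf.hasMFDerivAt
  let S : F →L[ℝ] EuclideanSpace ℝ (Fin m) := mfderiv 𝓘(ℝ, F) (𝓡 m) ψ.symm (ψ q)
  have h3 : HasFDerivAt (fun y => f (ψ.symm y)) (L.comp S) (ψ q) := (h2.comp (ψ q) h1).hasFDerivAt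
  rw [h3.fderiv]
  rfl

/-- The constant vector field `v` on `F`. -/
def constVec (v : F) (y : F) : TangentSpace 𝓘(ℝ, F) y := v

/-- The vector field which is constant in the chart `ψ`. -/
def constField (ψ : OpenPartialHomeomorph M F) (v : F) (q : M) : TangentSpace (𝓡 m) q :=
  mpullback (𝓡 m) 𝓘(ℝ, F) ψ (constVec v) q

theorem constField_apply (h : IsSmoothChart (m := m) ψ) {q : M} (hq : q ∈ ψ.source) (v : F) :
    constField (m := m) ψ v q = (h.deriv hq).symm v :=
  congrArg (fun L : F →L[ℝ] TangentSpace (𝓡 m) q => L v)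
    (ContinuousLinearMap.inverse_equiv (h.deriv hq))

theorem isInvertible (h : IsSmoothChart (m := m) ψ) {q : M} (hq : q ∈ ψ.source) :
    (mfderiv (𝓡 m) 𝓘(ℝ, F) ψ q).IsInvertible := ⟨h.mdifferentiable.mfderiv hq, rfl⟩

variable [IsManifold (𝓡 m) ∞ M]

theorem smoothFieldAt_constField (h : IsSmoothChart (m := m) ψ) {q : M} (hq : q ∈ ψ.source)
    (v : F) : SmoothFieldAt (constField (m := m) ψ v) q :=
  ContMDiffAt.mpullback_vectorField_preimage (n := ∞)
    (contMDiffAt_vectorSpace_iff_contDiffAt.2 contDiffAt_const) (h.contMDiffAt hq)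
    (h.isInvertible hq) (by simp)

/-- Pullback by a diffeomorphism commutes with brackets, and constant fields on a vector space
commute. -/
theorem mlieBracket_constField (h : IsSmoothChart (m := m) ψ) {q : M} (hq : q ∈ ψ.source)
    (v w : F) : mlieBracket (𝓡 m) (constField (m := m) ψ v) (constField (m := m) ψ w) q = 0 := by
  have h1 : ∀ v : F, MDifferentiableAt 𝓘(ℝ, F) 𝓘(ℝ, F).tangent
      (fun y => (⟨y, constVec v y⟩ : TangentBundle 𝓘(ℝ, F) F)) (ψ q) := fun v =>
    ContMDiffAt.mdifferentiableAt (n := ∞)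
      (contMDiffAt_vectorSpace_iff_contDiffAt.2 contDiffAt_const) (by simp)
  have h2 : minSmoothness ℝ 2 ≤ ∞ := by
    rw [minSmoothness_of_isRCLikeNormedField]; exact ENat.LEInfty.out
  have : IsManifold (𝓡 m) (minSmoothness ℝ 2) M := IsManifold.of_le h2
  have : IsManifold 𝓘(ℝ, F) (minSmoothness ℝ 2) F := inferInstance
  have h2 := mpullback_mlieBracket (n := ∞) (h1 v) (h1 w) (h.contMDiffAt hq) h2
  have h3 : mlieBracket 𝓘(ℝ, F) (constVec v) (constVec w) = 0 := by
    rw [← mlieBracketWithin_univ, mlieBracketWithin_eq_lieBracketWithin]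
    ext y
    have h : ∀ v : F, fderivWithin ℝ (fun _ : F => v) Set.univ y = 0 := fun v => by simp
    change fderivWithin ℝ (fun _ : F => w) Set.univ y v
      - fderivWithin ℝ (fun _ : F => v) Set.univ y w = 0
    rw [h, h]
    simp
  refine h2.symm.trans ?_
  have h4 := congrArg (fun X => mpullback (𝓡 m) 𝓘(ℝ, F) ψ X q) h3
  refine h4.trans ?_
  simp

theorem contMDiffAt_kahlerForm (H : HyperkahlerStructure m M) (a : Fin 3) {q : M}
    {X Y : ∀ q : M, TangentSpace (𝓡 m) q} (hX : SmoothFieldAt X q) (hY : SmoothFieldAt Y q) :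
    ContMDiffAt (𝓡 m) 𝓘(ℝ, ℝ) ∞ (fun q => H.kahlerForm a q (X q) (Y q)) q := by
  have h1 : ContMDiffAt (𝓡 m) (𝓡 m).tangent ∞
      (fun q => (⟨q, H.I a q (X q)⟩ : TangentBundle (𝓡 m) M)) q :=
    ContMDiffAt.clm_bundle_apply (H.smooth_I a q) hX
  have h2 : ContMDiffAt (𝓡 m) ((𝓡 m).prod 𝓘(ℝ, ℝ)) ∞ (fun q => TotalSpace.mk' ℝ
      (E := Bundle.Trivial M ℝ) q (H.g.inner q (H.I a q (X q)) (Y q))) q :=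
    ContMDiffAt.clm_bundle_apply₂ (F₃ := ℝ) (E₃ := Bundle.Trivial M ℝ) (H.g.contMDiff q) h1 hY
  rw [contMDiffAt_section] at h2
  exact h2

variable [FiniteDimensional ℝ F]

/-- A Kähler form in a smooth chart. -/
theorem exists_kahlerForm_pullback (H : HyperkahlerStructure m M) (a : Fin 3)
    (h : IsSmoothChart (m := m) ψ) : ∃ σ : F → F →L[ℝ] F →L[ℝ] ℂ,
      (∀ q (hq : q ∈ ψ.source) v w, σ (ψ q) (h.deriv hq v) (h.deriv hq w) = H.kahlerForm a q v w) ∧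
      ∀ y ∈ ψ.target, SmoothNear σ y ∧ ClosedNear σ y := by
  let X : F → ∀ q : M, TangentSpace (𝓡 m) q := constField ψ
  have hXadd : ∀ v w q, X (v + w) q = X v q + X w q := fun v w q =>
    (mfderiv (𝓡 m) 𝓘(ℝ, F) ψ q).inverse.map_add v w
  have hXsmul : ∀ (c : ℝ) v q, X (c • v) q = c • X v q := fun c v q =>
    (mfderiv (𝓡 m) 𝓘(ℝ, F) ψ q).inverse.map_smul c v
  obtain ⟨σ, hσ, hσs⟩ := exists_form_of_components (E := F)
    (fun y v w => (H.kahlerForm a (ψ.symm y) (X v (ψ.symm y)) (X w (ψ.symm y)) : ℂ))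
    (fun y v v' w => by
      simp only [HyperkahlerStructure.kahlerForm, hXadd, map_add, add_apply, Complex.ofReal_add])
    (fun y c v w => by
      simp only [HyperkahlerStructure.kahlerForm, hXsmul, map_smul, smul_apply, smul_eq_mul,
        Complex.ofReal_mul, Complex.real_smul])
    (fun y v w w' => by
      simp only [HyperkahlerStructure.kahlerForm, hXadd, map_add, Complex.ofReal_add])
    (fun y c v w => by
      simp only [HyperkahlerStructure.kahlerForm, hXsmul, map_smul, smul_eq_mul,
        Complex.ofReal_mul, Complex.real_smul])
  have hsm : ∀ q ∈ ψ.source, ∀ v w, ContMDiffAt (𝓡 m) 𝓘(ℝ, ℝ) ∞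
      (fun q => H.kahlerForm a q (X v q) (X w q)) q := fun q hq v w =>
    contMDiffAt_kahlerForm H a (h.smoothFieldAt_constField hq v) (h.smoothFieldAt_constField hq w)
  have hsm' : ∀ y ∈ ψ.target, SmoothNear σ y := fun y hy => hσs y <| by
    filter_upwards [ψ.open_target.mem_nhds hy] with z hz v w
    exact Complex.ofRealCLM.contDiff.contDiffAt.comp z
      (h.contDiffAt_comp_symm hz (hsm _ (ψ.map_target hz) v w))
  refine ⟨σ, fun q hq v w => ?_, fun y hy => ⟨hsm' y hy, ?_⟩⟩
  · have h1 : ∀ v, X (h.deriv hq v) q = v := fun v => by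
      rw [show X (h.deriv hq v) q = _ from h.constField_apply hq _]; simp
    rw [hσ, ψ.left_inv hq, h1, h1]
  · filter_upwards [ψ.open_target.mem_nhds hy] with z hz
    refine ⟨fun v w => by rw [hσ, hσ, H.kahlerForm_swap]; simp, fun u v w => ?_⟩
    obtain ⟨q, hq, rfl⟩ : ∃ q ∈ ψ.source, ψ q = z := ⟨_, ψ.map_target hz, ψ.right_inv hz⟩
    have h1 : ∀ u v w, fderiv ℝ σ (ψ q) u v w
        = (dirDeriv (fun q => H.kahlerForm a q (X v q) (X w q)) (X u q) : ℂ) := by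
      intro u v w
      have d1 : DifferentiableAt ℝ σ (ψ q) :=
        (hsm' _ hz).self_of_nhds.differentiableAt (by simp)
      have d2 : DifferentiableAt ℝ (fun y => H.kahlerForm a (ψ.symm y) (X v (ψ.symm y))
          (X w (ψ.symm y))) (ψ q) :=
        (h.contDiffAt_comp_symm hz (by rw [ψ.left_inv hq]; exact hsm q hq v w)).differentiableAt
          (by simp)
      have d3 : HasFDerivAt (fun y => σ y v w) _ (ψ q) :=
        (Complex.ofRealCLM.hasFDerivAt.comp (ψ q) d2.hasFDerivAt).congr_of_eventuallyEq
          (Eventually.of_forall fun y => hσ y v w)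
      rw [← fderiv_clm_apply₂ d1, d3.fderiv]
      have d4 := h.fderiv_comp_symm hq ((hsm q hq v w).mdifferentiableAt (by simp)) u
      rw [← h.constField_apply hq] at d4
      exact congrArg (fun r : ℝ => (r : ℂ)) d4
    -- On chart-constant fields the bracket terms of the invariant formula vanish, leaving the
    -- cyclic sum of derivatives in `ClosedNear`.
    have h2 := H.closed a q (X u) (X v) (X w) (h.smoothFieldAt_constField hq u)
      (h.smoothFieldAt_constField hq v) (h.smoothFieldAt_constField hq w)
    simp only [X, h.mlieBracket_constField hq, map_zero, zero_apply, sub_zero] at h2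
    rw [h1, h1, h1]
    exact_mod_cast h2

end IsSmoothChart

variable [IsManifold (𝓡 m) ∞ M] [FiniteDimensional ℝ F]

theorem isSmoothChart_chartAt (p : M) :
    IsSmoothChart (m := m) (chartAt (EuclideanSpace ℝ (Fin m)) p) :=
  ⟨contMDiffOn_chart, contMDiffOn_chart_symm⟩

theorem exists_isSmoothChart {φ : M → F} {p : M}
    (hφ : ∀ᶠ q in 𝓝 p, ContMDiffAt (𝓡 m) 𝓘(ℝ, F) ∞ φ q)
    (hb : Function.Injective (mfderiv (𝓡 m) 𝓘(ℝ, F) φ p)) (hm : Module.finrank ℝ F = m)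
    {s : Set M} (hs : s ∈ 𝓝 p) :
    ∃ ψ : OpenPartialHomeomorph M F, IsSmoothChart (m := m) ψ ∧ p ∈ ψ.source ∧ ψ.source ⊆ s ∧
      ∀ q ∈ ψ.source, ψ q = φ q := by
  set c := chartAt (EuclideanSpace ℝ (Fin m)) p with hc
  have hcs : IsSmoothChart (m := m) c := isSmoothChart_chartAt p
  have hp : p ∈ c.source := mem_chart_source _ p
  have hcp : c.symm (c p) = p := c.left_inv hp
  have hpt : c p ∈ c.target := c.map_source hp
  have hf : SmoothNear (fun y => φ (c.symm y)) (c p) := by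
    have h1 : ∀ᶠ y in 𝓝 (c p), ContMDiffAt (𝓡 m) 𝓘(ℝ, F) ∞ φ (c.symm y) :=
      (c.continuousAt_symm hpt).eventually (by rwa [hcp])
    filter_upwards [h1, c.open_target.mem_nhds hpt] with y h2 h3
    exact hcs.contDiffAt_comp_symm h3 h2
  have hd := hcs.fderiv_comp_symm hp (hφ.self_of_nhds.mdifferentiableAt (by simp))
  have hinj : Function.Injective (fderiv ℝ (fun y => φ (c.symm y)) (c p)) := by
    intro v w hvw
    rw [hd, hd] at hvw
    exact (hcs.deriv hp).symm.injective (hb hvw)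
  have hbij : Function.Bijective (fderiv ℝ (fun y => φ (c.symm y)) (c p)) :=
    ⟨hinj, (LinearMap.injective_iff_surjective_of_finrank_eq_finrank
      (f := (fderiv ℝ (fun y => φ (c.symm y)) (c p)).toLinearMap) (by simp [hm])).1 hinj⟩
  obtain ⟨e, he, hef, hes, hes'⟩ := exists_openPartialHomeomorph_of_bijective_fderiv hf hbij
  have hψ : IsSmoothChart (m := m) (c.trans e) := by
    constructor
    · intro q hq
      rw [c.trans_source e] at hq
      have h1 : ContMDiffAt (𝓡 m) 𝓘(ℝ, F) ∞ e (c q) := by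
        rw [hef]; exact contMDiffAt_iff_contDiffAt.2 (hes _ hq.2)
      exact (ContMDiffAt.comp q h1 (hcs.contMDiffAt hq.1)).contMDiffWithinAt
    · intro y hy
      rw [c.trans_target e] at hy
      have h1 : ContMDiffAt 𝓘(ℝ, F) (𝓡 m) ∞ e.symm y :=
        contMDiffAt_iff_contDiffAt.2 (hes' _ hy.1)
      exact (ContMDiffAt.comp y (hcs.contMDiffAt_symm hy.2) h1).contMDiffWithinAt
  refine ⟨_, hψ.restrOpen isOpen_interior (s := interior s), ⟨?_, mem_interior_iff_mem_nhds.2 hs⟩,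
    fun q hq => interior_subset hq.2, fun q hq => ?_⟩
  · rw [c.trans_source e]; exact ⟨hp, he⟩
  · have hq1 := hq.1
    rw [c.trans_source e] at hq1
    change e (c q) = φ q
    simp only [hef, c.left_inv hq1.1]

end Charts

/-! ### The moment map and the orbit directions -/

section MomentMap

open Filter

variable {m n : ℕ} {M : Type*} [TopologicalSpace M]
  [ChartedSpace (EuclideanSpace ℝ (Fin m)) M]

theorem mfderiv_clm_comp {F F' : Type*} [NormedAddCommGroup F] [NormedSpace ℝ F]
    [NormedAddCommGroup F'] [NormedSpace ℝ F'] (L : F →L[ℝ] F') {f : M → F} {q : M}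
    (hf : MDifferentiableAt (𝓡 m) 𝓘(ℝ, F) f q) (v : TangentSpace (𝓡 m) q) :
    (mfderiv (𝓡 m) 𝓘(ℝ, F') (fun y => L (f y)) q v : F')
      = L (mfderiv (𝓡 m) 𝓘(ℝ, F) f q v : F) := by
  have h : HasMFDerivAt 𝓘(ℝ, F) 𝓘(ℝ, F') L (f q) L := L.hasFDerivAt.hasMFDerivAt
  have h1 : HasMFDerivAt (𝓡 m) 𝓘(ℝ, F') (fun y => L (f y)) q _ := h.comp q hf.hasMFDerivAt
  rw [h1.mfderiv]
  rfl

theorem mfderiv_smoothNear_comp {F F' : Type*} [NormedAddCommGroup F] [NormedSpace ℝ F]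
    [NormedAddCommGroup F'] [NormedSpace ℝ F'] {g : F → F'} {f : M → F} {q : M}
    (hg : DifferentiableAt ℝ g (f q))
    (hf : MDifferentiableAt (𝓡 m) 𝓘(ℝ, F) f q) (v : TangentSpace (𝓡 m) q) :
    (mfderiv (𝓡 m) 𝓘(ℝ, F') (fun y => g (f y)) q v : F')
      = fderiv ℝ g (f q) (mfderiv (𝓡 m) 𝓘(ℝ, F) f q v : F) := by
  have h : HasMFDerivAt 𝓘(ℝ, F) 𝓘(ℝ, F') g (f q) (fderiv ℝ g (f q)) :=
    hg.hasFDerivAt.hasMFDerivAt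
  have h1 : HasMFDerivAt (𝓡 m) 𝓘(ℝ, F') (fun y => g (f y)) q _ := h.comp q hf.hasMFDerivAt
  rw [h1.mfderiv]
  rfl

variable [IsManifold (𝓡 m) ∞ M]

/-- Pairing with the range of G under ω_a detects exactly the I_a-component of the quaternionic
decomposition. Thus the common kernel of the dμ_a is tangent to the orbits. -/
theorem HyperkahlerStructure.IsTriIsotropic.exists_eq_of_kahlerForm_eq_zero
    {H : HyperkahlerStructure m M} {p : M} {V : Type*} [AddCommGroup V] [Module ℝ V]
    [Module.Finite ℝ V] {G : V →ₗ[ℝ] TangentSpace (𝓡 m) p} (hG : H.IsTriIsotropic G)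
    (hi : Function.Injective G) (hm : m = 4 * Module.finrank ℝ V) {v : TangentSpace (𝓡 m) p}
    (hv : ∀ a d, H.kahlerForm a p (G d) v = 0) : ∃ c, v = G c := by
  obtain ⟨c₀, c₁, c₂, c₃, rfl⟩ := hG.exists_eq hi hm v
  have key : ∀ c, H.g.inner p (G c) (G c) = 0 → G c = 0 := fun c hc => by
    by_contra hne
    exact (H.g.pos p (G c) hne).ne' hc
  have e1 := hG.kahlerForm_quaternionicSpan c₀ c₁ c₂ c₃ c₁ 0
  have e2 := hG.kahlerForm_quaternionicSpan c₀ c₁ c₂ c₃ c₂ 1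
  have e3 := hG.kahlerForm_quaternionicSpan c₀ c₁ c₂ c₃ c₃ 2
  rw [hv] at e1 e2 e3
  refine ⟨c₀, ?_⟩
  rw [HyperkahlerStructure.quaternionicSpan_apply, key c₁ e1.symm, key c₂ e2.symm, key c₃ e3.symm]
  simp

variable {H : HyperkahlerStructure m M} {A : LocalAction m M n}
  {μ : M → Fin n → EuclideanSpace ℝ (Fin 3)}

/-- The component `(i, a)` of a point of `ℝ³ ⊗ ℝⁿ`. -/
def component (i : Fin n) (a : Fin 3) : (Fin n → EuclideanSpace ℝ (Fin 3)) →L[ℝ] ℝ :=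
  (EuclideanSpace.proj a).comp (ContinuousLinearMap.proj i)

namespace IsTriMomentMap

theorem mdifferentiableAt (hμ : IsTriMomentMap H A μ) (q : M) :
    MDifferentiableAt (𝓡 m) 𝓘(ℝ, Fin n → EuclideanSpace ℝ (Fin 3)) μ q :=
  (hμ.smooth q).mdifferentiableAt (by simp)

theorem mfderiv_apply (hμ : IsTriMomentMap H A μ) (i : Fin n) (a : Fin 3) (q : M)
    (v : TangentSpace (𝓡 m) q) :
    (mfderiv (𝓡 m) 𝓘(ℝ, Fin n → EuclideanSpace ℝ (Fin 3)) μ q v :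
      Fin n → EuclideanSpace ℝ (Fin 3)) i a = H.kahlerForm a q (A.field i q) v := by
  rw [← hμ.deriv_eq]
  exact (mfderiv_clm_comp (component i a) (hμ.mdifferentiableAt q) v).symm

theorem kahlerForm_generator (d : EuclideanSpace ℝ (Fin n)) (a : Fin 3) (q : M)
    (v : TangentSpace (𝓡 m) q) : H.kahlerForm a q (A.generator q d) v =
      ∑ i, d i * H.kahlerForm a q (A.field i q) v := by
  have h : d = ∑ i, d i • EuclideanSpace.single i (1 : ℝ) := by
    ext j
    simp [Finset.sum_apply, Pi.single_apply]
  conv_lhs => rw [h, map_sum]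
  simp only [HyperkahlerStructure.kahlerForm, map_sum, sum_apply, map_smul, smul_apply,
    smul_eq_mul, LocalAction.field_eq_generator]

/-- ω_a(X_i, X_j) is the derivative of (μ_a)_i along X_j, which is zero by invariance. -/
theorem isTriIsotropic (hμ : IsTriMomentMap H A μ) (q : M) :
    H.IsTriIsotropic (A.generator q).toLinearMap := by
  intro a c d
  change H.kahlerForm a q (A.generator q c) (A.generator q d) = 0
  rw [kahlerForm_generator]
  refine Finset.sum_eq_zero fun i _ => ?_
  rw [← hμ.mfderiv_apply, A.mfderiv_generator (hμ.mdifferentiableAt q) 0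
    ((hμ.invariant q).mono fun t ht => by simp [ht])]
  simp

end IsTriMomentMap

end MomentMap

/-! ### First chart: moment map and time function -/

section AdaptedCharts

open Filter

variable {m n : ℕ} {M : Type*} [TopologicalSpace M]
  [ChartedSpace (EuclideanSpace ℝ (Fin m)) M] [IsManifold (𝓡 m) ∞ M]
  {H : HyperkahlerStructure m M} {A : LocalAction m M n}
  {μ : M → Fin n → EuclideanSpace ℝ (Fin 3)}

/-- The map `(x₁, x₂, x₃) ↦ (u, z) = (x₁, √-1 (x₂ + √-1 x₃))` from `ℝ³ ⊗ ℝⁿ` to `ℂ²ⁿ`. -/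
def complexCoord (n : ℕ) : (Fin n → EuclideanSpace ℝ (Fin 3)) →L[ℝ] CSpace n :=
  ContinuousLinearMap.pi (Sum.elim (fun i => Complex.ofRealCLM.comp (component i 0))
    fun i => Complex.I • (Complex.ofRealCLM.comp (component i 1)
      + Complex.I • Complex.ofRealCLM.comp (component i 2)))

theorem complexCoord_inl (w : Fin n → EuclideanSpace ℝ (Fin 3)) (i : Fin n) :
    complexCoord n w (.inl i) = (w i 0 : ℂ) := rfl

theorem complexCoord_inr (w : Fin n → EuclideanSpace ℝ (Fin 3)) (i : Fin n) :
    complexCoord n w (.inr i) = Complex.I * ((w i 1 : ℂ) + Complex.I * (w i 2 : ℂ)) := rfl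

/-- The map `t ↦ (u, z) = (-√-1 t, 0)`. -/
def timeCoord (n : ℕ) : EuclideanSpace ℝ (Fin n) →L[ℝ] CSpace n :=
  ContinuousLinearMap.pi (Sum.elim (fun i => -(Complex.I • Complex.ofRealCLM.comp
    (EuclideanSpace.proj i))) 0)

theorem timeCoord_inl (t : EuclideanSpace ℝ (Fin n)) (i : Fin n) :
    timeCoord n t (.inl i) = -(Complex.I * (t i : ℂ)) := rfl

theorem timeCoord_inr (t : EuclideanSpace ℝ (Fin n)) (i : Fin n) :
    timeCoord n t (.inr i) = 0 := rfl

theorem timeCoord_single (i : Fin n) :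
    timeCoord n (EuclideanSpace.single i 1) = -Pi.single (.inl i) Complex.I := by
  ext (j | j)
  · rw [timeCoord_inl, Pi.neg_apply]
    by_cases h : j = i <;> simp [h]
  · rw [timeCoord_inr, Pi.neg_apply]
    simp

theorem eq_zero_of_complexCoord_add_timeCoord {a : Fin n → EuclideanSpace ℝ (Fin 3)}
    {b : EuclideanSpace ℝ (Fin n)} (h : complexCoord n a + timeCoord n b = 0) : a = 0 ∧ b = 0 := by
  have hr : ∀ i, (a i 0 : ℂ) + -(Complex.I * (b i : ℂ)) = 0 := fun i => congrFun h (.inl i)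
  have hz : ∀ i, Complex.I * ((a i 1 : ℂ) + Complex.I * (a i 2 : ℂ)) + 0 = 0 := fun i =>
    congrFun h (.inr i)
  constructor
  · ext i k
    have e1 := congrArg Complex.re (hr i)
    have e2 := congrArg Complex.re (hz i)
    have e3 := congrArg Complex.im (hz i)
    simp at e1 e2 e3
    fin_cases k
    exacts [e1, e3, e2]
  · ext i
    simpa using congrArg Complex.im (hr i)

theorem finrank_cSpace (n : ℕ) : Module.finrank ℝ (CSpace n) = 4 * n := by
  rw [Module.finrank_pi_fintype]
  simp
  ring

/-- The coordinates are u = μ₁ - √-1 τ and z. A vector annihilated by dμ is tangent to the orbit,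
where dτ is injective, so this is a chart. It straightens the action and has Re u = x, but u need
not be holomorphic yet. -/
theorem exists_chart_of_moment_and_time (hm : m = 4 * n) (hA : A.IsFree)
    (hμ : IsTriMomentMap H A μ) (p : M) :
    ∃ ψ : OpenPartialHomeomorph M (CSpace n), IsSmoothChart (m := m) ψ ∧ p ∈ ψ.source ∧
      ∀ q ∈ ψ.source, (∀ i, (ψ q (.inl i)).re = μ q i 0) ∧
        (∀ i, ψ q (.inr i) = Complex.I * ((μ q i 1 : ℂ) + Complex.I * (μ q i 2 : ℂ))) ∧
        (∀ i (v : TangentSpace (𝓡 m) q), (mfderiv (𝓡 m) 𝓘(ℝ, CSpace n) ψ q v : CSpace n) (.inr i)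
          = Complex.I * H.holForm q (A.field i q) v) ∧
        ∀ i, (mfderiv (𝓡 m) 𝓘(ℝ, CSpace n) ψ q (A.field i q) : CSpace n)
          = -Pi.single (.inl i) Complex.I := by
  obtain ⟨τ, hτ, hτa⟩ := hA.exists_time p
  let φ : M → CSpace n := fun q => complexCoord n (μ q) + timeCoord n (τ q)
  have hφs : ∀ᶠ q in 𝓝 p, ContMDiffAt (𝓡 m) 𝓘(ℝ, CSpace n) ∞ φ q := by
    filter_upwards [hτ] with q hq
    exact ((complexCoord n).contMDiff.contMDiffAt.comp q (hμ.smooth q)).add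
      ((timeCoord n).contMDiff.contMDiffAt.comp q hq)
  have hdφ : ∀ q, ContMDiffAt (𝓡 m) (𝓡 n) ∞ τ q → ∀ v : TangentSpace (𝓡 m) q,
      (mfderiv (𝓡 m) 𝓘(ℝ, CSpace n) φ q v : CSpace n) =
        complexCoord n (mfderiv (𝓡 m) 𝓘(ℝ, Fin n → EuclideanSpace ℝ (Fin 3)) μ q v) +
          timeCoord n (mfderiv (𝓡 m) (𝓡 n) τ q v) := by
    intro q hq v
    have d1 := hμ.mdifferentiableAt q
    have d2 : MDifferentiableAt (𝓡 m) (𝓡 n) τ q := hq.mdifferentiableAt (by simp)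
    have d3 : MDifferentiableAt (𝓡 m) 𝓘(ℝ, CSpace n) (fun q => complexCoord n (μ q)) q :=
      (complexCoord n).mdifferentiableAt.comp q d1
    have d4 : MDifferentiableAt (𝓡 m) 𝓘(ℝ, CSpace n) (fun q => timeCoord n (τ q)) q :=
      (timeCoord n).mdifferentiableAt.comp q d2
    have e := (d3.hasMFDerivAt.add d4.hasMFDerivAt).mfderiv
    rw [← mfderiv_clm_comp (complexCoord n) d1, ← mfderiv_clm_comp (timeCoord n) d2]
    exact congrArg (fun L : EuclideanSpace ℝ (Fin m) →L[ℝ] CSpace n => L v) e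
  have hdτ : ∀ q, ContMDiffAt (𝓡 m) (𝓡 n) ∞ τ q →
      (∀ᶠ t in 𝓝 (0 : EuclideanSpace ℝ (Fin n)), τ (A.act t q) = τ q + t) →
      ∀ c, (mfderiv (𝓡 m) (𝓡 n) τ q (A.generator q c) : EuclideanSpace ℝ (Fin n)) = c :=
    fun q hq ha c => A.mfderiv_generator (hq.mdifferentiableAt (by simp))
      (ContinuousLinearMap.id ℝ _) ha c
  have hinj : Function.Injective (mfderiv (𝓡 m) 𝓘(ℝ, CSpace n) φ p) := by
    rw [injective_iff_map_eq_zero]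
    intro v hv
    obtain ⟨h1, h1'⟩ := eq_zero_of_complexCoord_add_timeCoord
      ((hdφ p hτ.self_of_nhds v).symm.trans hv)
    have h2 : ∀ i (a : Fin 3), H.kahlerForm a p (A.field i p) v = 0 := fun i a => by
      rw [← hμ.mfderiv_apply, h1]
      rfl
    obtain ⟨c, rfl⟩ := (hμ.isTriIsotropic p).exists_eq_of_kahlerForm_eq_zero
      (hA.injective_generator p) (by simp [hm]) (v := v) fun a d => by
        change H.kahlerForm a p (A.generator p d) v = 0
        rw [IsTriMomentMap.kahlerForm_generator]
        exact Finset.sum_eq_zero fun i _ => by rw [h2, mul_zero]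
    have h3 : c = 0 := (hdτ p hτ.self_of_nhds hτa.self_of_nhds c).symm.trans h1'
    change A.generator p c = 0
    rw [h3, map_zero]
  obtain ⟨ψ, hψ, hp, hs, hψφ⟩ := exists_isSmoothChart hφs hinj ((finrank_cSpace n).trans hm.symm)
    (hτ.and hτa)
  refine ⟨ψ, hψ, hp, fun q hq => ?_⟩
  obtain ⟨h1, h2⟩ := hs hq
  have h3 : mfderiv (𝓡 m) 𝓘(ℝ, CSpace n) ψ q = mfderiv (𝓡 m) 𝓘(ℝ, CSpace n) φ q :=
    EventuallyEq.mfderiv_eq (by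
      filter_upwards [ψ.open_source.mem_nhds hq] with y hy using hψφ y hy)
  have h4 : ∀ v : TangentSpace (𝓡 m) q, (mfderiv (𝓡 m) 𝓘(ℝ, CSpace n) ψ q v : CSpace n) =
        complexCoord n (mfderiv (𝓡 m) 𝓘(ℝ, Fin n → EuclideanSpace ℝ (Fin 3)) μ q v) +
          timeCoord n (mfderiv (𝓡 m) (𝓡 n) τ q v) := fun v => by
    rw [← hdφ q h1 v]
    exact congrArg (fun L : EuclideanSpace ℝ (Fin m) →L[ℝ] CSpace n => L v) h3
  refine ⟨fun i => ?_, fun i => ?_, fun i v => ?_, fun i => ?_⟩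
  · rw [hψφ q hq]
    simp [φ, complexCoord_inl, timeCoord_inl]
  · rw [hψφ q hq]
    simp only [φ, Pi.add_apply, complexCoord_inr, timeCoord_inr, add_zero]
  · refine (congrFun (h4 v) (.inr i)).trans ((add_zero _).trans ?_)
    refine (complexCoord_inr _ i).trans ?_
    rw [hμ.mfderiv_apply, hμ.mfderiv_apply]
    rfl
  · have h5 : (mfderiv (𝓡 m) 𝓘(ℝ, Fin n → EuclideanSpace ℝ (Fin 3)) μ q (A.field i q) :
        Fin n → EuclideanSpace ℝ (Fin 3)) = 0 := A.mfderiv_generator (hμ.mdifferentiableAt q) 0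
      ((hμ.invariant q).mono fun t ht => by simp [ht]) (EuclideanSpace.single i 1)
    have h6 : complexCoord n 0 + timeCoord n (EuclideanSpace.single i 1)
        = -Pi.single (.inl i) Complex.I := by rw [map_zero, zero_add, timeCoord_single]
    exact (h4 _).trans ((congrArg₂ (· + ·) (congrArg (complexCoord n) h5)
      (congrArg (timeCoord n) (hdτ q h1 h2 (EuclideanSpace.single i 1)))).trans h6)

end AdaptedCharts

/-! ### Correcting u to reach Darboux form -/

section DarbouxCharts

open Filter

variable {m n : ℕ} {M : Type*} [TopologicalSpace M]
  [ChartedSpace (EuclideanSpace ℝ (Fin m)) M] [IsManifold (𝓡 m) ∞ M]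
  {H : HyperkahlerStructure m M} {A : LocalAction m M n}
  {μ : M → Fin n → EuclideanSpace ℝ (Fin 3)}

/-- The form `∑ du_i ∧ dz_i` on `ℂ²ⁿ ∋ (u, z)`. -/
def symplecticForm (v w : CSpace n) : ℂ :=
  ∑ i, (v (.inl i) * w (.inr i) - w (.inl i) * v (.inr i))

theorem symplecticForm_single_left (i : Fin n) (w : CSpace n) :
    symplecticForm (Pi.single (.inl i) Complex.I) w = Complex.I * w (.inr i) := by
  rw [symplecticForm, Finset.sum_eq_single i]
  · simp
  · intro j _ hj
    simp [hj]
  · simp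

theorem exists_const_symplecticForm (n : ℕ) : ∃ κ : CSpace n →L[ℝ] CSpace n →L[ℝ] ℂ,
    ∀ v w, κ v w = symplecticForm v w := by
  obtain ⟨κ, hκ, -⟩ := exists_form_of_components (E := CSpace n) (fun _ v w => symplecticForm v w)
    (fun q v v' w => by
      simp only [symplecticForm, Pi.add_apply, ← Finset.sum_add_distrib]
      exact Finset.sum_congr rfl fun i _ => by ring)
    (fun q c v w => by
      simp only [symplecticForm, Pi.smul_apply, Finset.smul_sum, Complex.real_smul]
      exact Finset.sum_congr rfl fun i _ => by ring)
    (fun q v w w' => by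
      simp only [symplecticForm, Pi.add_apply, ← Finset.sum_add_distrib]
      exact Finset.sum_congr rfl fun i _ => by ring)
    (fun q c v w => by
      simp only [symplecticForm, Pi.smul_apply, Finset.smul_sum, Complex.real_smul]
      exact Finset.sum_congr rfl fun i _ => by ring)
  exact ⟨κ 0, fun v w => hκ 0 v w⟩

/-- A form in the ideal generated by the dz_i vanishes on two vectors annihilated by every dz_i. -/
theorem evalC_eq_zero_of_eq_sum {κ : CSpace n →L[ℝ] CSpace n →L[ℝ] ℂ} {a : Fin n → CSpace n → ℂ}
    (h : ∀ v w, κ v w = ∑ i, (a i v * w (.inr i) - a i w * v (.inr i))) {D D' : CSpace n × CSpace n}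
    (hD : ∀ j, D.1 (.inr j) + Complex.I * D.2 (.inr j) = 0)
    (hD' : ∀ j, D'.1 (.inr j) + Complex.I * D'.2 (.inr j) = 0) : evalC κ D D' = 0 := by
  simp only [evalC, h, Finset.mul_sum, ← Finset.sum_add_distrib]
  refine Finset.sum_eq_zero fun i _ => ?_
  linear_combination (a i D.1 + Complex.I * a i D.2) * hD' i
    - (a i D'.1 + Complex.I * a i D'.2) * hD i

theorem frame_inr (α : (Fin n ⊕ Fin n) ⊕ Fin n) (j : Fin n) :
    (frame n α).1 (.inr j) + Complex.I * (frame n α).2 (.inr j) = 0 := by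
  rcases α with (i | i) | i
  · simp [frame]
  · simp [frame]
  · by_cases h : j = i
    · subst h; simp [frame]
    · simp [frame, h]

-- The difference η = Ω - ∑ du_i ∧ dz_i is closed. It lies in the ideal of the dz_i, by the
-- pointwise formula Ω = ∑ τ_i ∧ dz_i, so it vanishes on the frame. Its contraction with ∂/∂Im u_i
-- is zero because both terms contract to √-1 dz_i. Hence η = ∑ dh_k ∧ dz_k with h_k independent of
-- Im u.
set_option synthInstance.maxHeartbeats 400000 in
set_option maxHeartbeats 1000000 in
theorem exists_darboux_shift (hm : m = 4 * n) (hA : A.IsFree) (hμ : IsTriMomentMap H A μ)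
    {ψ : OpenPartialHomeomorph M (CSpace n)} (hψ : IsSmoothChart (m := m) ψ)
    (hz : ∀ q (hq : q ∈ ψ.source) i (v : TangentSpace (𝓡 m) q),
      hψ.deriv hq v (.inr i) = Complex.I * H.holForm q (A.field i q) v)
    (hX : ∀ q (hq : q ∈ ψ.source) i, hψ.deriv hq (A.field i q) = -Pi.single (.inl i) Complex.I)
    {ζ₀ : CSpace n} (hζ₀ : ζ₀ ∈ ψ.target) :
    ∃ h : Fin n → CSpace n → ℂ, (∀ k, SmoothNear (h k) ζ₀) ∧
      (∀ᶠ ζ in 𝓝 ζ₀, ∀ i k, fderiv ℝ (h k) ζ (Pi.single (.inl i) Complex.I) = 0) ∧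
      ∀ᶠ ζ in 𝓝 ζ₀, ∀ q (hq : q ∈ ψ.source), ψ q = ζ → ∀ v w : TangentSpace (𝓡 m) q,
        H.holForm q v w = symplecticForm (hψ.deriv hq v) (hψ.deriv hq w) +
          ∑ k, (fderiv ℝ (h k) ζ (hψ.deriv hq v) * hψ.deriv hq w (.inr k)
            - fderiv ℝ (h k) ζ (hψ.deriv hq w) * hψ.deriv hq v (.inr k)) := by
  obtain ⟨σ₁, hσ₁, hs₁⟩ := hψ.exists_kahlerForm_pullback H 1
  obtain ⟨σ₂, hσ₂, hs₂⟩ := hψ.exists_kahlerForm_pullback H 2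
  obtain ⟨κ, hκ⟩ := exists_const_symplecticForm n
  let η : CSpace n → CSpace n →L[ℝ] CSpace n →L[ℝ] ℂ := fun ζ => σ₁ ζ + Complex.I • σ₂ ζ - κ
  have hη : ∀ ζ v w, η ζ v w = σ₁ ζ v w + Complex.I * σ₂ ζ v w - symplecticForm v w := by
    intro ζ v w
    rw [← hκ]; rfl
  have hηq : ∀ q (hq : q ∈ ψ.source) (v w : TangentSpace (𝓡 m) q),
      η (ψ q) (hψ.deriv hq v) (hψ.deriv hq w)
        = H.holForm q v w - symplecticForm (hψ.deriv hq v) (hψ.deriv hq w) := by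
    intro q hq v w
    rw [hη, hσ₁, hσ₂]; rfl
  have hηs : SmoothNear η ζ₀ := by
    filter_upwards [(hs₁ ζ₀ hζ₀).1, (hs₂ ζ₀ hζ₀).1] with ζ h1 h2
    exact (h1.add (h2.const_smul Complex.I)).sub contDiffAt_const
  have hηc : ClosedNear η ζ₀ := by
    filter_upwards [(hs₁ ζ₀ hζ₀).2, (hs₂ ζ₀ hζ₀).2, (hs₁ ζ₀ hζ₀).1.differentiable,
      (hs₂ ζ₀ hζ₀).1.differentiable] with ζ h1 h2 h3 h4
    refine ⟨fun v w => ?_, fun u v w => ?_⟩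
    · rw [hη, hη, h1.1, h2.1]
      simp only [symplecticForm, Finset.sum_sub_distrib]
      ring
    · have e : HasFDerivAt η (fderiv ℝ σ₁ ζ + Complex.I • fderiv ℝ σ₂ ζ) ζ :=
        (h3.hasFDerivAt.add (h4.hasFDerivAt.const_smul Complex.I)).sub_const κ
      rw [e.fderiv]
      have e1 := h1.2 u v w
      have e2 := h2.2 u v w
      simp only [add_apply, smul_apply, smul_eq_mul]
      linear_combination e1 + Complex.I * e2
  have hfr : ∀ α γ, ∀ᶠ ζ in 𝓝 ζ₀, evalC (η ζ) (frame n α) (frame n γ) = 0 := by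
    intro α γ
    filter_upwards [ψ.open_target.mem_nhds hζ₀] with ζ hζ
    obtain ⟨q, hq, rfl⟩ : ∃ q ∈ ψ.source, ψ q = ζ := ⟨_, ψ.map_target hζ, ψ.right_inv hζ⟩
    obtain ⟨τ, hτ⟩ := (hμ.isTriIsotropic q).exists_holForm_eq_sum
      (EuclideanSpace.basisFun (Fin n) ℝ).toBasis (hA.injective_generator q) hm
    refine evalC_eq_zero_of_eq_sum
      (a := fun i v => τ i ((hψ.deriv hq).symm v) - v (.inl i)) (fun v w => ?_)
      (frame_inr α) (frame_inr γ)
    obtain ⟨v, rfl⟩ := (hψ.deriv hq).surjective v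
    obtain ⟨w, rfl⟩ := (hψ.deriv hq).surjective w
    rw [hηq, hτ, symplecticForm, ← Finset.sum_sub_distrib]
    refine Finset.sum_congr rfl fun i _ => ?_
    have e : ∀ v, Complex.I * H.holForm q ((A.generator q).toLinearMap
        ((EuclideanSpace.basisFun (Fin n) ℝ).toBasis i)) v = hψ.deriv hq v (.inr i) := fun v => by
      rw [hz]
      simp [A.field_eq_generator]
    rw [e, e, ContinuousLinearEquiv.symm_apply_apply, ContinuousLinearEquiv.symm_apply_apply]
    ring
  have hb : ∀ i, ∀ᶠ ζ in 𝓝 ζ₀, ∀ v, η ζ (Pi.single (.inl i) Complex.I) v = 0 := by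
    intro i
    filter_upwards [ψ.open_target.mem_nhds hζ₀] with ζ hζ v
    obtain ⟨q, hq, rfl⟩ : ∃ q ∈ ψ.source, ψ q = ζ := ⟨_, ψ.map_target hζ, ψ.right_inv hζ⟩
    obtain ⟨v, rfl⟩ := (hψ.deriv hq).surjective v
    have e : hψ.deriv hq (-A.field i q) = Pi.single (.inl i) Complex.I := by
      rw [map_neg, hX, neg_neg]
    rw [← e, hηq, e, symplecticForm_single_left, hz, ← neg_one_smul ℝ, H.holForm_smul_left]
    push_cast
    linear_combination -(H.holForm q (A.field i q) v) * Complex.I_sq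
  obtain ⟨h, hs, hh, hhb⟩ := exists_eq_sum_d_wedge_dz hηs hηc hfr hb
  refine ⟨h, hs, hhb, ?_⟩
  filter_upwards [hh] with ζ hζ q hq e v w
  subst e
  rw [← hζ, hηq]
  ring

end DarbouxCharts

/-! ### Holomorphic Darboux charts -/

section HolomorphicCharts

open Filter

variable {m n : ℕ} {M : Type*} [TopologicalSpace M]
  [ChartedSpace (EuclideanSpace ℝ (Fin m)) M] [IsManifold (𝓡 m) ∞ M]

/-- The inclusion `u ↦ (u, 0)`. -/
def inlCLM (n : ℕ) : (Fin n → ℂ) →L[ℝ] CSpace n :=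
  ContinuousLinearMap.pi (Sum.elim (fun k => ContinuousLinearMap.proj k) 0)

theorem inlCLM_inl (u : Fin n → ℂ) (k : Fin n) : inlCLM n u (.inl k) = u k := rfl

theorem inlCLM_inr (u : Fin n → ℂ) (k : Fin n) : inlCLM n u (.inr k) = 0 := rfl

/-- The map `(u, z) ↦ (u + h(u, z), z)`. -/
def shear (h : Fin n → CSpace n → ℂ) (ζ : CSpace n) : CSpace n := ζ + inlCLM n fun k => h k ζ

theorem shear_inr (h : Fin n → CSpace n → ℂ) (ζ : CSpace n) (k : Fin n) :
    shear h ζ (.inr k) = ζ (.inr k) := by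
  rw [shear, Pi.add_apply, inlCLM_inr, add_zero]

theorem contDiffAt_shear {h : Fin n → CSpace n → ℂ} {ζ : CSpace n}
    (hh : ∀ k, ContDiffAt ℝ ∞ (h k) ζ) : ContDiffAt ℝ ∞ (shear h) ζ :=
  contDiffAt_id.add ((inlCLM n).contDiff.contDiffAt.comp ζ (contDiffAt_pi.2 hh))

theorem fderiv_shear {h : Fin n → CSpace n → ℂ} {ζ : CSpace n}
    (hh : ∀ k, DifferentiableAt ℝ (h k) ζ) (v : CSpace n) :
    fderiv ℝ (shear h) ζ v = v + inlCLM n fun k => fderiv ℝ (h k) ζ v := by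
  have e : HasFDerivAt (shear h) (ContinuousLinearMap.id ℝ _ +
      (inlCLM n).comp (ContinuousLinearMap.pi fun k => fderiv ℝ (h k) ζ)) ζ :=
    (hasFDerivAt_id ζ).add ((inlCLM n).hasFDerivAt.comp ζ
      (hasFDerivAt_pi.2 fun k => (hh k).hasFDerivAt))
  rw [e.fderiv]
  rfl

theorem symplecticForm_zero_left (w : CSpace n) : symplecticForm 0 w = 0 :=
  Finset.sum_eq_zero fun i _ => by simp

/-- Coordinates `(u, z)` in which `ω₂ + √-1 ω₃ = ∑ du_i ∧ dz_i`, the action is generated by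
`√-1 (∂/∂ū_i - ∂/∂u_i)` and `z` is given by the moment map. -/
structure IsDarbouxChart (H : HyperkahlerStructure m M) (A : LocalAction m M n)
    (μ : M → Fin n → EuclideanSpace ℝ (Fin 3)) (ψ : OpenPartialHomeomorph M (CSpace n)) : Prop
    extends IsSmoothChart (m := m) ψ where
  holForm_eq : ∀ q (hq : q ∈ ψ.source) (v w : TangentSpace (𝓡 m) q),
    H.holForm q v w = symplecticForm (toIsSmoothChart.deriv hq v) (toIsSmoothChart.deriv hq w)
  deriv_field : ∀ q (hq : q ∈ ψ.source) i,
    toIsSmoothChart.deriv hq (A.field i q) = -Pi.single (.inl i) Complex.I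
  moment_z : ∀ q ∈ ψ.source, ∀ i,
    ψ q (.inr i) = Complex.I * ((μ q i 1 : ℂ) + Complex.I * (μ q i 2 : ℂ))

variable {H : HyperkahlerStructure m M} {A : LocalAction m M n}
  {μ : M → Fin n → EuclideanSpace ℝ (Fin 3)}

/-- Replacing u by u + h absorbs the correction ∑ dh_k ∧ dz_k. The new map has injective derivative
because the nondegenerate form Ω factors through it. The old chart ψ₀ and the transition map Θ are
retained: since Re u = x in ψ₀, they later express u through (x, z). -/
theorem exists_isDarbouxChart (hm : m = 4 * n) (hA : A.IsFree) (hμ : IsTriMomentMap H A μ) (p : M) :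
    ∃ (ψ₀ ψ : OpenPartialHomeomorph M (CSpace n)) (Θ : CSpace n → CSpace n),
      p ∈ ψ₀.source ∧ p ∈ ψ.source ∧ IsDarbouxChart H A μ ψ ∧
      (∀ q ∈ ψ₀.source, (∀ i, (ψ₀ q (.inl i)).re = μ q i 0) ∧
        ∀ i, ψ₀ q (.inr i) = Complex.I * ((μ q i 1 : ℂ) + Complex.I * (μ q i 2 : ℂ))) ∧
      (∀ q ∈ ψ.source, q ∈ ψ₀.source ∧ ψ q = Θ (ψ₀ q)) ∧
      SmoothNear Θ (ψ₀ p) ∧ (∀ ζ i, Θ ζ (.inr i) = ζ (.inr i)) ∧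
      ∀ᶠ ζ in 𝓝 (ψ₀ p), ∀ i, fderiv ℝ Θ ζ (Pi.single (.inl i) Complex.I)
        = Pi.single (.inl i) Complex.I := by
  obtain ⟨ψ₀, hψ₀, hp₀, hprop⟩ := exists_chart_of_moment_and_time hm hA hμ p
  obtain ⟨h, hs, hb, hΩ⟩ := exists_darboux_shift hm hA hμ hψ₀
    (fun q hq i v => (hprop q hq).2.2.1 i v) (fun q hq i => (hprop q hq).2.2.2 i)
    (ψ₀.map_source hp₀)
  have hs' : ∀ᶠ ζ in 𝓝 (ψ₀ p), ∀ k, ContDiffAt ℝ ∞ (h k) ζ := eventually_all.2 hs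
  have hcont : ContinuousAt ψ₀ p := ψ₀.continuousAt hp₀
  set φ : M → CSpace n := fun q => shear h (ψ₀ q) with hφ
  have hgood : ∀ᶠ q in 𝓝 p, q ∈ ψ₀.source ∧ (∀ k, ContDiffAt ℝ ∞ (h k) (ψ₀ q)) ∧
      (∀ i k, fderiv ℝ (h k) (ψ₀ q) (Pi.single (.inl i) Complex.I) = 0) ∧
      ∀ (hq : q ∈ ψ₀.source) (v w : TangentSpace (𝓡 m) q),
        H.holForm q v w = symplecticForm (hψ₀.deriv hq v) (hψ₀.deriv hq w) +
          ∑ k, (fderiv ℝ (h k) (ψ₀ q) (hψ₀.deriv hq v) * hψ₀.deriv hq w (.inr k)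
            - fderiv ℝ (h k) (ψ₀ q) (hψ₀.deriv hq w) * hψ₀.deriv hq v (.inr k)) := by
    filter_upwards [ψ₀.open_source.mem_nhds hp₀, hcont.eventually hs', hcont.eventually hb,
      hcont.eventually hΩ] with q h1 h2 h3 h4
    exact ⟨h1, h2, h3, fun hq v w => h4 q hq rfl v w⟩
  have hφs : ∀ᶠ q in 𝓝 p, ContMDiffAt (𝓡 m) 𝓘(ℝ, CSpace n) ∞ φ q := by
    filter_upwards [hgood] with q hq
    exact ContMDiffAt.comp q (contMDiffAt_iff_contDiffAt.2 (contDiffAt_shear hq.2.1))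
      (hψ₀.contMDiffAt hq.1)
  have hdφ : ∀ q (hq : q ∈ ψ₀.source), (∀ k, ContDiffAt ℝ ∞ (h k) (ψ₀ q)) →
      ∀ v : TangentSpace (𝓡 m) q, (mfderiv (𝓡 m) 𝓘(ℝ, CSpace n) φ q v : CSpace n)
        = hψ₀.deriv hq v + inlCLM n fun k => fderiv ℝ (h k) (ψ₀ q) (hψ₀.deriv hq v) := by
    intro q hq hk v
    rw [← fderiv_shear fun k => (hk k).differentiableAt (by simp)]
    exact mfderiv_smoothNear_comp ((contDiffAt_shear hk).differentiableAt (by simp))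
      ((hψ₀.contMDiffAt hq).mdifferentiableAt (by simp)) v
  have hΩφ : ∀ q (hq : q ∈ ψ₀.source), (∀ k, ContDiffAt ℝ ∞ (h k) (ψ₀ q)) →
      (∀ (v w : TangentSpace (𝓡 m) q),
        H.holForm q v w = symplecticForm (hψ₀.deriv hq v) (hψ₀.deriv hq w) +
          ∑ k, (fderiv ℝ (h k) (ψ₀ q) (hψ₀.deriv hq v) * hψ₀.deriv hq w (.inr k)
            - fderiv ℝ (h k) (ψ₀ q) (hψ₀.deriv hq w) * hψ₀.deriv hq v (.inr k))) →
      ∀ v w : TangentSpace (𝓡 m) q, H.holForm q v w = symplecticForm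
        (mfderiv (𝓡 m) 𝓘(ℝ, CSpace n) φ q v : CSpace n)
        (mfderiv (𝓡 m) 𝓘(ℝ, CSpace n) φ q w : CSpace n) := by
    intro q hq hk hh v w
    rw [hh, hdφ q hq hk, hdφ q hq hk, symplecticForm, symplecticForm, ← Finset.sum_add_distrib]
    refine Finset.sum_congr rfl fun k _ => ?_
    simp only [Pi.add_apply, inlCLM_inl, inlCLM_inr]
    ring
  have hinj : Function.Injective (mfderiv (𝓡 m) 𝓘(ℝ, CSpace n) φ p) := by
    rw [injective_iff_map_eq_zero]
    intro v hv
    obtain ⟨-, h2, -, h4⟩ := hgood.self_of_nhds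
    refine H.eq_zero_of_holForm_eq_zero v fun w => ?_
    rw [hΩφ p hp₀ h2 (h4 hp₀), hv]
    exact symplecticForm_zero_left _
  obtain ⟨ψ, hψ, hp, hsub, hψφ⟩ := exists_isSmoothChart hφs hinj
    ((finrank_cSpace n).trans hm.symm) hgood
  have hd : ∀ q (hq : q ∈ ψ.source), ∀ v : TangentSpace (𝓡 m) q,
      hψ.deriv hq v = (mfderiv (𝓡 m) 𝓘(ℝ, CSpace n) φ q v : CSpace n) := by
    intro q hq v
    have h3 : mfderiv (𝓡 m) 𝓘(ℝ, CSpace n) ψ q = mfderiv (𝓡 m) 𝓘(ℝ, CSpace n) φ q :=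
      EventuallyEq.mfderiv_eq (by
        filter_upwards [ψ.open_source.mem_nhds hq] with y hy using hψφ y hy)
    exact congrArg (fun L : EuclideanSpace ℝ (Fin m) →L[ℝ] CSpace n => L v) h3
  refine ⟨ψ₀, ψ, shear h, hp₀, hp, ⟨hψ, fun q hq v w => ?_, fun q hq i => ?_, fun q hq i => ?_⟩,
    fun q hq => ⟨(hprop q hq).1, (hprop q hq).2.1⟩, fun q hq => ⟨(hsub hq).1, hψφ q hq⟩,
    hs'.mono fun ζ hζ => contDiffAt_shear hζ, shear_inr h, ?_⟩
  · obtain ⟨h1, h2, -, h4⟩ := hsub hq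
    rw [hd, hd]
    exact hΩφ q h1 h2 (h4 h1) v w
  · obtain ⟨h1, h2, h3, h4⟩ := hsub hq
    have e : hψ₀.deriv h1 (A.field i q) = -Pi.single (.inl i) Complex.I := (hprop q h1).2.2.2 i
    rw [hd, hdφ q h1 h2, e]
    simp only [map_neg, h3, neg_zero]
    exact (congrArg _ (map_zero (inlCLM n))).trans (add_zero _)
  · rw [hψφ q hq, hφ]
    simp only [shear_inr, (hprop q (hsub hq).1).2.1]
  · filter_upwards [hs', hb] with ζ h1 h2 i
    rw [fderiv_shear fun k => (h1 k).differentiableAt (by simp)]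
    simp only [h2]
    exact (congrArg _ (map_zero (inlCLM n))).trans (add_zero _)

namespace IsDarbouxChart

variable {ψ : OpenPartialHomeomorph M (CSpace n)}

theorem deriv_inr (h : IsDarbouxChart H A μ ψ) {q : M} (hq : q ∈ ψ.source)
    (v : TangentSpace (𝓡 m) q) (i : Fin n) :
    h.deriv hq v (.inr i) = Complex.I * H.holForm q (A.field i q) v := by
  have e : h.deriv hq (-A.field i q) = Pi.single (.inl i) Complex.I := by
    rw [map_neg, h.deriv_field, neg_neg]
  have e2 := h.holForm_eq q hq (-A.field i q) v
  rw [e, symplecticForm_single_left, ← neg_one_smul ℝ, H.holForm_smul_left] at e2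
  push_cast at e2
  linear_combination Complex.I * e2 + h.deriv hq v (.inr i) * Complex.I_sq

/-- Ω is complex linear for I₁ and dz_i = √-1 Ω(X_i, ·), so z is holomorphic. Pairing with the
vector dual to dz_i in Ω = ∑ du_i ∧ dz_i then isolates du_i and gives its complex linearity. -/
theorem deriv_I (h : IsDarbouxChart H A μ ψ) {q : M} (hq : q ∈ ψ.source)
    (v : TangentSpace (𝓡 m) q) : h.deriv hq (H.I 0 q v) = Complex.I • h.deriv hq v := by
  have hz : ∀ i, h.deriv hq (H.I 0 q v) (.inr i) = Complex.I * h.deriv hq v (.inr i) := fun i => by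
    rw [h.deriv_inr, h.deriv_inr, H.holForm_swap, H.holForm_I_left, H.holForm_swap _ v]
    ring
  ext (i | i)
  · obtain ⟨w, hw⟩ := (h.deriv hq).surjective (Pi.single (.inr i) 1)
    have e := h.holForm_eq q hq (H.I 0 q v) w
    rw [H.holForm_I_left, h.holForm_eq q hq, hw, symplecticForm, symplecticForm,
      Finset.sum_eq_single i, Finset.sum_eq_single i] at e
    · simpa using e.symm
    · intro j _ hj; simp [hj]
    · simp
    · intro j _ hj; simp [hj]
    · simp
  · exact hz i

end IsDarbouxChart

end HolomorphicCharts

/-! ### Infinitesimal data for the Legendre transform -/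

section LegendrePotential

open Filter

variable {m n : ℕ}

/-- `K` is a potential on `N ⊆ ℂ²ⁿ ∋ (u, z)`, invariant under imaginary translations of `u`, with
`∂K/∂Re u_i = -4 x_i`, whose Kähler form behaves like that of a tri-Hamiltonian action. -/
structure IsLegendrePotential (K : CSpace n → ℝ) (x : Fin n → CSpace n → ℝ)
    (N : Set (CSpace n)) : Prop where
  smooth : ∀ ζ ∈ N, ContDiffAt ℝ ∞ K ζ
  smooth_x : ∀ ζ ∈ N, ∀ i, ContDiffAt ℝ ∞ (x i) ζ
  fderiv_im : ∀ ζ ∈ N, ∀ i, fderiv ℝ K ζ (Pi.single (.inl i) Complex.I) = 0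
  fderiv_re : ∀ ζ ∈ N, ∀ i, fderiv ℝ K ζ (Pi.single (.inl i) 1) = -4 * x i ζ
  fderiv_x_im : ∀ ζ ∈ N, ∀ i j, fderiv ℝ (x i) ζ (Pi.single (.inl j) Complex.I) = 0
  re_eq_zero : ∀ ζ ∈ N, ∀ l : CSpace n, (∀ i, l (.inr i) = 0) → (∀ i, fderiv ℝ (x i) ζ l = 0) →
    ∀ i, (l (.inl i)).re = 0
  exists_vectors : ∀ ζ ∈ N, ∀ v : Fin n → ℝ, ∃ (r : ℝ) (l w : CSpace n), (v ≠ 0 → 0 < r) ∧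
    (∀ i, fderiv ℝ (x i) ζ l = v i) ∧ (∀ i, l (.inr i) = 0) ∧ ∑ i, (l (.inl i)).re * v i = r ∧
    (∀ i, fderiv ℝ (x i) ζ w = 0) ∧ (∀ i, fderiv ℝ (x i) ζ (Complex.I • w) = 0) ∧
    (∀ i, w (.inr i) = v i) ∧ fderiv ℝ (fderiv ℝ K) ζ w w
      + fderiv ℝ (fderiv ℝ K) ζ (Complex.I • w) (Complex.I • w) = -4 * r

theorem IsLegendrePotential.mono {K : CSpace n → ℝ} {x : Fin n → CSpace n → ℝ}
    {N N' : Set (CSpace n)} (h : IsLegendrePotential K x N) (hN : N' ⊆ N) :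
    IsLegendrePotential K x N' :=
  ⟨fun ζ hζ => h.smooth ζ (hN hζ), fun ζ hζ => h.smooth_x ζ (hN hζ),
    fun ζ hζ => h.fderiv_im ζ (hN hζ), fun ζ hζ => h.fderiv_re ζ (hN hζ),
    fun ζ hζ => h.fderiv_x_im ζ (hN hζ), fun ζ hζ => h.re_eq_zero ζ (hN hζ),
    fun ζ hζ => h.exists_vectors ζ (hN hζ)⟩

variable {M : Type*} [TopologicalSpace M]
  [ChartedSpace (EuclideanSpace ℝ (Fin m)) M] [IsManifold (𝓡 m) ∞ M]
  {H : HyperkahlerStructure m M} {A : LocalAction m M n}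
  {μ : M → Fin n → EuclideanSpace ℝ (Fin 3)}

theorem LocalAction.generator_eq_sum (A : LocalAction m M n) (q : M)
    (c : EuclideanSpace ℝ (Fin n)) : A.generator q c = ∑ i, c i • A.field i q := by
  have h : c = ∑ i, c i • EuclideanSpace.single i (1 : ℝ) := by
    ext j
    simp [Finset.sum_apply, Pi.single_apply]
  conv_lhs => rw [h, map_sum]
  simp only [map_smul, A.field_eq_generator]

/-- The Gram matrix of the generating fields is invertible. -/
theorem LocalAction.exists_inner_eq (H : HyperkahlerStructure m M) (hA : A.IsFree) (q : M)
    (v : Fin n → ℝ) : ∃ c : EuclideanSpace ℝ (Fin n),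
      (∀ i, H.g.inner q (A.field i q) (A.generator q c) = v i) ∧
      H.g.inner q (A.generator q c) (A.generator q c) = ∑ i, c i * v i := by
  have hsum : ∀ c w, H.g.inner q (A.generator q c) w = ∑ i, c i * H.g.inner q (A.field i q) w := by
    intro c w
    rw [A.generator_eq_sum, map_sum, sum_apply]
    simp only [map_smul, smul_apply, smul_eq_mul]
  let L : EuclideanSpace ℝ (Fin n) →ₗ[ℝ] (Fin n → ℝ) :=
    LinearMap.pi fun i => ((H.g.inner q (A.field i q)).toLinearMap ∘ₗ (A.generator q).toLinearMap)
  have hL : ∀ c i, L c i = H.g.inner q (A.field i q) (A.generator q c) := fun c i => rfl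
  have hinj : Function.Injective L := by
    rw [injective_iff_map_eq_zero]
    intro c hc
    by_contra hne
    have h1 : A.generator q c ≠ 0 := fun h0 => hne (hA.injective_generator q (by rw [h0, map_zero]))
    refine (H.g.pos q _ h1).ne' ?_
    rw [hsum]
    exact Finset.sum_eq_zero fun i _ => by rw [← hL, hc, Pi.zero_apply, mul_zero]
  obtain ⟨c, hc⟩ := (LinearMap.injective_iff_surjective_of_finrank_eq_finrank (by simp)).1 hinj v
  refine ⟨c, fun i => by rw [← hL, hc], ?_⟩
  rw [hsum]
  exact Finset.sum_congr rfl fun i _ => by rw [← hL, hc]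

namespace IsDarbouxChart

variable {ψ : OpenPartialHomeomorph M (CSpace n)}

theorem deriv_generator (h : IsDarbouxChart H A μ ψ) {q : M} (hq : q ∈ ψ.source)
    (c : EuclideanSpace ℝ (Fin n)) : (∀ k, h.deriv hq (A.generator q c) (.inl k)
      = -(Complex.I * c k)) ∧ ∀ k, h.deriv hq (A.generator q c) (.inr k) = 0 := by
  rw [A.generator_eq_sum, map_sum]
  simp only [map_smul, h.deriv_field]
  constructor
  · intro k
    rw [Finset.sum_apply, Finset.sum_eq_single k]
    · simp [mul_comm]
    · intro j _ hj; simp [hj.symm]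
    · simp
  · intro k
    simp

theorem fderiv_x (h : IsDarbouxChart H A μ ψ) (hμ : IsTriMomentMap H A μ) {q : M}
    (hq : q ∈ ψ.source) (i : Fin n) (v : TangentSpace (𝓡 m) q) :
    fderiv ℝ (fun ζ => μ (ψ.symm ζ) i 0) (ψ q) (h.deriv hq v)
      = H.kahlerForm 0 q (A.field i q) v := by
  have h1 : MDifferentiableAt (𝓡 m) 𝓘(ℝ, ℝ) (fun q => μ q i 0) q :=
    (component i 0).mdifferentiableAt.comp q (hμ.mdifferentiableAt q)
  rw [← hμ.deriv_eq i 0 q v]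
  refine (h.toIsSmoothChart.fderiv_comp_symm hq h1 _).trans ?_
  rw [ContinuousLinearEquiv.symm_apply_apply]
  rfl

theorem contDiffAt_x (h : IsDarbouxChart H A μ ψ) (hμ : IsTriMomentMap H A μ) {ζ : CSpace n}
    (hζ : ζ ∈ ψ.target) (i : Fin n) : ContDiffAt ℝ ∞ (fun ζ => μ (ψ.symm ζ) i 0) ζ :=
  h.toIsSmoothChart.contDiffAt_comp_symm (f := fun q => μ q i 0) hζ
    ((component i 0).contMDiff.contMDiffAt.comp _ (hμ.smooth _))

/-- With dx = dz = 0 all components of dμ vanish, so the vector is tangent to the orbit, and orbit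
directions are purely imaginary in u. This stands in for the invertibility of ∂x/∂Re u. -/
theorem re_eq_zero (h : IsDarbouxChart H A μ ψ) (hm : m = 4 * n) (hA : A.IsFree)
    (hμ : IsTriMomentMap H A μ) {q : M} (hq : q ∈ ψ.source) {l : CSpace n}
    (hl : ∀ i, l (.inr i) = 0)
    (hx : ∀ i, fderiv ℝ (fun ζ => μ (ψ.symm ζ) i 0) (ψ q) l = 0) (i : Fin n) :
    (l (.inl i)).re = 0 := by
  obtain ⟨v, rfl⟩ := (h.deriv hq).surjective l
  have h1 : ∀ i (a : Fin 3), H.kahlerForm a q (A.field i q) v = 0 := by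
    intro i
    have e0 := hx i
    have e1 := hl i
    rw [h.fderiv_x hμ] at e0
    rw [h.deriv_inr, mul_eq_zero, or_iff_right Complex.I_ne_zero] at e1
    have e2 := congrArg Complex.re e1
    have e3 := congrArg Complex.im e1
    simp [HyperkahlerStructure.holForm] at e2 e3
    intro a
    fin_cases a
    exacts [e0, e2, e3]
  obtain ⟨c, rfl⟩ := (hμ.isTriIsotropic q).exists_eq_of_kahlerForm_eq_zero
    (hA.injective_generator q) (by simp [hm]) (v := v) fun a d => by
      change H.kahlerForm a q (A.generator q d) v = 0
      rw [IsTriMomentMap.kahlerForm_generator]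
      exact Finset.sum_eq_zero fun i _ => by rw [h1, mul_zero]
  have e := (h.deriv_generator hq c).1 i
  exact (congrArg Complex.re e).trans (by simp)

/-- Let Y be the combination of the generating fields with g(X_i, Y) = v_i, and r = |Y|². Then l is
the coordinate vector of I₁Y and w = -I₃Y, so that I₁w = I₂Y. The same r appears for l and for w,
and this is what cancels in the Laplacian of F. -/
theorem exists_vectors (h : IsDarbouxChart H A μ ψ) (hA : A.IsFree)
    (hμ : IsTriMomentMap H A μ) {q : M} (hq : q ∈ ψ.source) (v : Fin n → ℝ) :
    ∃ (r : ℝ) (l : CSpace n) (w : TangentSpace (𝓡 m) q), (v ≠ 0 → 0 < r) ∧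
    (∀ i, fderiv ℝ (fun ζ => μ (ψ.symm ζ) i 0) (ψ q) l = v i) ∧ (∀ i, l (.inr i) = 0) ∧
    ∑ i, (l (.inl i)).re * v i = r ∧
    (∀ i, fderiv ℝ (fun ζ => μ (ψ.symm ζ) i 0) (ψ q) (h.deriv hq w) = 0) ∧
    (∀ i, fderiv ℝ (fun ζ => μ (ψ.symm ζ) i 0) (ψ q) (Complex.I • h.deriv hq w) = 0) ∧
    (∀ i, h.deriv hq w (.inr i) = v i) ∧ H.kahlerForm 0 q w (H.I 0 q w) = r := by
  obtain ⟨c, hc, hcc⟩ := A.exists_inner_eq H hA q v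
  have hG := hμ.isTriIsotropic q
  have hfield : ∀ i, A.field i q = (A.generator q).toLinearMap (EuclideanSpace.single i 1) :=
    fun i => rfl
  have h01 := fun i => hG.inner_zero_one (EuclideanSpace.single i 1) c
  have h02 := fun i => hG.inner_zero_two (EuclideanSpace.single i 1) c
  have h12 := fun i => hG.inner_one_two (EuclideanSpace.single i 1) c
  have hII : H.I 0 q (-H.I 2 q (A.generator q c)) = H.I 1 q (A.generator q c) := by
    rw [← H.I_mul, map_neg, H.I_sq, neg_neg]
  refine ⟨_, h.deriv hq (H.I 0 q (A.generator q c)), -H.I 2 q (A.generator q c), fun hv => ?_,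
    fun i => ?_, fun i => ?_, ?_, fun i => ?_, fun i => ?_, fun i => ?_,
    (H.I_orthogonal 0 q _ _).trans (c := H.g.inner q (A.generator q c) (A.generator q c)) ?_⟩
  · refine H.g.pos q _ fun h0 => hv ?_
    ext i
    rw [← hc, h0, map_zero, Pi.zero_apply]
  · rw [h.fderiv_x hμ, HyperkahlerStructure.kahlerForm, H.I_orthogonal, hc]
  · rw [h.deriv_I, Pi.smul_apply, (h.deriv_generator hq c).2, smul_zero]
  · rw [hcc]
    refine Finset.sum_congr rfl fun i _ => ?_
    rw [h.deriv_I, Pi.smul_apply, (h.deriv_generator hq c).1]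
    simp
  · rw [h.fderiv_x hμ, HyperkahlerStructure.kahlerForm, map_neg, neg_eq_zero]
    exact h02 i
  · rw [← h.deriv_I, hII, h.fderiv_x hμ]
    exact h01 i
  · have e : H.holForm q (A.field i q) (-H.I 2 q (A.generator q c)) = -(Complex.I * v i) := by
      rw [← hc i, HyperkahlerStructure.holForm, HyperkahlerStructure.kahlerForm,
        HyperkahlerStructure.kahlerForm, map_neg, map_neg, H.I_orthogonal]
      have e1 : H.g.inner q (H.I 1 q (A.field i q)) (H.I 2 q (A.generator q c)) = 0 := h12 i
      rw [e1]
      push_cast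
      ring
    rw [h.deriv_inr, e]
    linear_combination -(v i : ℂ) * Complex.I_sq
  · simp only [map_neg, neg_apply, neg_neg, H.I_orthogonal]

theorem exists_isLegendrePotential (h : IsDarbouxChart H A μ ψ) (hm : m = 4 * n) (hA : A.IsFree)
    (hμ : IsTriMomentMap H A μ) {p : M} (hp : p ∈ ψ.source) :
    ∃ K : CSpace n → ℝ, ∃ N ∈ 𝓝 (ψ p), N ⊆ ψ.target ∧
      IsLegendrePotential K (fun i ζ => μ (ψ.symm ζ) i 0) N ∧
      ∀ ζ ∈ N, ∀ q (hq : q ∈ ψ.source), ψ q = ζ → ∀ v w : TangentSpace (𝓡 m) q,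
        H.kahlerForm 0 q v w =
          1 / 4 * (fderiv ℝ (fderiv ℝ K) ζ (h.deriv hq v) (Complex.I • h.deriv hq w)
            - fderiv ℝ (fderiv ℝ K) ζ (h.deriv hq w) (Complex.I • h.deriv hq v)) := by
  obtain ⟨σ, hσ, hs⟩ := h.toIsSmoothChart.exists_kahlerForm_pullback H 0
  have htgt := ψ.map_source hp
  have hx : ∀ i, SmoothNear (fun ζ => μ (ψ.symm ζ) i 0) (ψ p) := fun i => by
    filter_upwards [ψ.open_target.mem_nhds htgt] with ζ hζ using h.contDiffAt_x hμ hζ i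
  have hrep : ∀ ζ ∈ ψ.target, ∃ q, ∃ hq : q ∈ ψ.source, ψ q = ζ := fun ζ hζ =>
    ⟨_, ψ.map_target hζ, ψ.right_inv hζ⟩
  have hsing : ∀ q (hq : q ∈ ψ.source) i,
      h.deriv hq (-A.field i q) = Pi.single (.inl i) Complex.I := fun q hq i => by
    rw [map_neg, h.deriv_field, neg_neg]
  have hxb : ∀ ζ ∈ ψ.target, ∀ i j,
      fderiv ℝ (fun ζ => μ (ψ.symm ζ) i 0) ζ (Pi.single (.inl j) Complex.I) = 0 := by
    intro ζ hζ i j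
    obtain ⟨q, hq, rfl⟩ := hrep ζ hζ
    rw [← hsing q hq, h.fderiv_x hμ, HyperkahlerStructure.kahlerForm, map_neg, neg_eq_zero]
    exact hμ.isTriIsotropic q 0 (EuclideanSpace.single i 1) (EuclideanSpace.single j 1)
  obtain ⟨K, hK, hKb, hKa, hKσ⟩ := exists_kahler_potential (hs _ htgt).1 (hs _ htgt).2 hx
    (by
      filter_upwards [ψ.open_target.mem_nhds htgt] with ζ hζ v w
      obtain ⟨q, hq, rfl⟩ := hrep ζ hζ
      obtain ⟨v, rfl⟩ := (h.deriv hq).surjective v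
      obtain ⟨w, rfl⟩ := (h.deriv hq).surjective w
      rw [hσ, Complex.ofReal_im])
    (by filter_upwards [ψ.open_target.mem_nhds htgt] with ζ hζ using hxb ζ hζ)
    (by
      filter_upwards [ψ.open_target.mem_nhds htgt] with ζ hζ i w
      obtain ⟨q, hq, rfl⟩ := hrep ζ hζ
      obtain ⟨w, rfl⟩ := (h.deriv hq).surjective w
      rw [← hsing q hq, hσ, h.fderiv_x hμ, HyperkahlerStructure.kahlerForm, map_neg, map_neg,
        neg_apply, Complex.ofReal_neg, HyperkahlerStructure.kahlerForm])
    (by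
      filter_upwards [ψ.open_target.mem_nhds htgt] with ζ hζ v w
      obtain ⟨q, hq, rfl⟩ := hrep ζ hζ
      obtain ⟨v, rfl⟩ := (h.deriv hq).surjective v
      obtain ⟨w, rfl⟩ := (h.deriv hq).surjective w
      rw [← h.deriv_I, ← h.deriv_I, hσ, hσ, H.kahlerForm_zero_I])
  have hform : ∀ ζ, (∀ v w, σ ζ v w = ((1 / 4 * (fderiv ℝ (fderiv ℝ K) ζ v (Complex.I • w)
      - fderiv ℝ (fderiv ℝ K) ζ w (Complex.I • v)) : ℝ) : ℂ)) → ∀ q (hq : q ∈ ψ.source), ψ q = ζ →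
      ∀ v w : TangentSpace (𝓡 m) q, H.kahlerForm 0 q v w =
          1 / 4 * (fderiv ℝ (fderiv ℝ K) ζ (h.deriv hq v) (Complex.I • h.deriv hq w)
            - fderiv ℝ (fderiv ℝ K) ζ (h.deriv hq w) (Complex.I • h.deriv hq v)) := by
    rintro _ h1 q hq rfl v w
    have e := h1 (h.deriv hq v) (h.deriv hq w)
    rw [hσ] at e
    exact_mod_cast e
  refine ⟨K, _, (hK.and (hKb.and (hKa.and hKσ))).and (ψ.open_target.mem_nhds htgt),
    fun ζ hζ => hζ.2, ⟨fun ζ hζ => hζ.1.1, fun ζ hζ => h.contDiffAt_x hμ hζ.2,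
      fun ζ hζ => hζ.1.2.1, fun ζ hζ => hζ.1.2.2.1, fun ζ hζ => hxb ζ hζ.2, fun ζ hζ l h1 h2 => ?_,
      fun ζ hζ v => ?_⟩,
    fun ζ hζ => hform ζ hζ.1.2.2.2⟩
  · obtain ⟨q, hq, rfl⟩ := hrep ζ hζ.2
    exact h.re_eq_zero hm hA hμ hq h1 h2
  · obtain ⟨q, hq, rfl⟩ := hrep ζ hζ.2
    obtain ⟨r, l, w, h1, h2, h3, h4, h5, h6, h7, h8⟩ := h.exists_vectors hA hμ hq v
    refine ⟨r, l, h.deriv hq w, h1, h2, h3, h4, h5, h6, h7, ?_⟩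
    -- As (√-1)² = -1, evaluating ω₁(w, I₁w) by the potential gives -¼ of the sum of D²K over w and
    -- √-1 w.
    have e := hform _ hζ.1.2.2.2 q hq rfl w (H.I 0 q w)
    rw [h8, h.deriv_I, smul_smul, Complex.I_mul_I, neg_one_smul, map_neg] at e
    linarith

end IsDarbouxChart

end LegendrePotential

/-! ### The dual function: derivatives, harmonicity, convexity -/

section LegendreSection

open Filter

theorem Convex.eq_of_fderiv_apply_eq_zero {E G : Type*} [NormedAddCommGroup E] [NormedSpace ℝ E]
    [NormedAddCommGroup G] [NormedSpace ℝ G] {N : Set E} (hN : Convex ℝ N) {f : E → G}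
    {a b : E} (ha : a ∈ N) (hb : b ∈ N) (hf : ∀ y ∈ N, DifferentiableAt ℝ f y)
    (h : ∀ y ∈ N, fderiv ℝ f y (b - a) = 0) : f b = f a := by
  have hmem : ∀ t ∈ Set.Icc (0 : ℝ) 1, a + t • (b - a) ∈ N := fun t ht =>
    hN.add_smul_sub_mem ha hb ht
  have hd : ∀ t ∈ Set.Icc (0 : ℝ) 1, HasDerivAt (fun t : ℝ => f (a + t • (b - a))) 0 t := by
    intro t ht
    have h1 : HasDerivAt (fun t : ℝ => a + t • (b - a)) (b - a) t := by
      simpa using ((hasDerivAt_id t).smul_const (b - a)).const_add a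
    have h2 := (hf _ (hmem t ht)).hasFDerivAt.comp_hasDerivAt t h1
    rwa [h _ (hmem t ht)] at h2
  have := constant_of_has_deriv_right_zero (f := fun t : ℝ => f (a + t • (b - a)))
    (fun t ht => (hd t ht).continuousAt.continuousWithinAt)
    (fun t ht => (hd t (Set.Ico_subset_Icc_self ht)).hasDerivWithinAt) 1 (by simp)
  simpa using this

variable {n : ℕ}

/-- The map `(x, z) ↦ (0, z)` from `ℝⁿ × ℂⁿ` to `ℂ²ⁿ`. -/
def zPart (n : ℕ) : (Fin n → EuclideanSpace ℝ (Fin 3)) →L[ℝ] CSpace n :=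
  ContinuousLinearMap.pi (Sum.elim 0 fun i => Complex.ofRealCLM.comp (component i 1)
      + Complex.I • Complex.ofRealCLM.comp (component i 2))

theorem zPart_inl (w : Fin n → EuclideanSpace ℝ (Fin 3)) (i : Fin n) :
    zPart n w (.inl i) = 0 := rfl

theorem zPart_inr (w : Fin n → EuclideanSpace ℝ (Fin 3)) (i : Fin n) :
    zPart n w (.inr i) = (w i 1 : ℂ) + Complex.I * (w i 2 : ℂ) := rfl

/-- `ξ` is a section over `U ⊆ ℝⁿ × ℂⁿ` of the map `ζ = (u, z) ↦ (x(ζ), z)` on `N`. -/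
structure IsLegendreSection (x : Fin n → CSpace n → ℝ) (N : Set (CSpace n))
    (ξ : (Fin n → EuclideanSpace ℝ (Fin 3)) → CSpace n)
    (U : Set (Fin n → EuclideanSpace ℝ (Fin 3))) : Prop where
  isOpen : IsOpen U
  smooth : ∀ w ∈ U, ContDiffAt ℝ ∞ ξ w
  mem : ∀ w ∈ U, ξ w ∈ N
  z_eq : ∀ w ∈ U, ∀ i, ξ w (.inr i) = zPart n w (.inr i)
  x_eq : ∀ w ∈ U, ∀ i, x i (ξ w) = w i 0

/-- The Legendre transform of `K` with respect to the variables `Re u`. -/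
def legendreDual (K : CSpace n → ℝ) (ξ : (Fin n → EuclideanSpace ℝ (Fin 3)) → CSpace n)
    (w : Fin n → EuclideanSpace ℝ (Fin 3)) : ℝ :=
  K (ξ w) + 4 * ∑ i, (ξ w (.inl i)).re * w i 0

/-- The differential of the function `legendreDual`. -/
def legendreDualDeriv (K : CSpace n → ℝ) (ξ : (Fin n → EuclideanSpace ℝ (Fin 3)) → CSpace n)
    (w : Fin n → EuclideanSpace ℝ (Fin 3)) : (Fin n → EuclideanSpace ℝ (Fin 3)) →L[ℝ] ℝ :=
  4 • ∑ i, (ξ w (.inl i)).re • component i 0 + (fderiv ℝ K (ξ w)).comp (zPart n)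

theorem map_eq_sum_re_of_inr_eq_zero {F : Type*} [NormedAddCommGroup F] [NormedSpace ℝ F]
    (T : CSpace n →L[ℝ] F) (hT : ∀ i, T (Pi.single (.inl i) Complex.I) = 0) {l : CSpace n}
    (hl : ∀ i, l (.inr i) = 0) :
    T l = ∑ i, (l (.inl i)).re • T (Pi.single (.inl i) 1) := by
  rw [map_eq_sum_re_im, Fintype.sum_sum_type]
  simp [hT, hl]

variable {K : CSpace n → ℝ} {x : Fin n → CSpace n → ℝ} {N : Set (CSpace n)}
  {ξ : (Fin n → EuclideanSpace ℝ (Fin 3)) → CSpace n}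
  {U : Set (Fin n → EuclideanSpace ℝ (Fin 3))} {w : Fin n → EuclideanSpace ℝ (Fin 3)}

namespace IsLegendrePotential

theorem fderiv_fderiv_im (h : IsLegendrePotential K x N) (hN : IsOpen N) {ζ : CSpace n}
    (hζ : ζ ∈ N) (i : Fin n) (l : CSpace n) :
    fderiv ℝ (fderiv ℝ K) ζ l (Pi.single (.inl i) Complex.I) = 0 := by
  have hd : DifferentiableAt ℝ (fderiv ℝ K) ζ :=
    ((h.smooth ζ hζ).fderiv_right (m := ∞) (by simp)).differentiableAt (by simp)
  rw [← fderiv_clm_apply₁ hd]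
  have e : (fun y => fderiv ℝ K y (Pi.single (.inl i) Complex.I)) =ᶠ[𝓝 ζ] fun _ => 0 := by
    filter_upwards [hN.mem_nhds hζ] with y hy using h.fderiv_im y hy i
  rw [e.fderiv_eq]
  simp

theorem fderiv_fderiv_re (h : IsLegendrePotential K x N) (hN : IsOpen N) {ζ : CSpace n}
    (hζ : ζ ∈ N) (i : Fin n) (l : CSpace n) :
    fderiv ℝ (fderiv ℝ K) ζ l (Pi.single (.inl i) 1) = -4 * fderiv ℝ (x i) ζ l := by
  have hd : DifferentiableAt ℝ (fderiv ℝ K) ζ :=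
    ((h.smooth ζ hζ).fderiv_right (m := ∞) (by simp)).differentiableAt (by simp)
  rw [← fderiv_clm_apply₁ hd]
  have e : (fun y => fderiv ℝ K y (Pi.single (.inl i) 1)) =ᶠ[𝓝 ζ] fun y => -4 * x i y := by
    filter_upwards [hN.mem_nhds hζ] with y hy using h.fderiv_re y hy i
  rw [e.fderiv_eq, fderiv_const_mul ((h.smooth_x ζ hζ i).differentiableAt (by simp))]
  simp

/-- In the u-directions dK is -4 ∑ x_i d Re u_i. Consequently a vector with dx = 0 is D²K-orthogonal
to all u-directions. -/
theorem fderiv_fderiv_of_inr_eq_zero (h : IsLegendrePotential K x N) (hN : IsOpen N) {ζ : CSpace n}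
    (hζ : ζ ∈ N) (l : CSpace n) {d : CSpace n} (hd : ∀ i, d (.inr i) = 0) :
    fderiv ℝ (fderiv ℝ K) ζ l d = -4 * ∑ i, (d (.inl i)).re * fderiv ℝ (x i) ζ l := by
  rw [map_eq_sum_re_of_inr_eq_zero _ (fun i => h.fderiv_fderiv_im hN hζ i l) hd, Finset.mul_sum]
  refine Finset.sum_congr rfl fun i _ => ?_
  rw [h.fderiv_fderiv_re hN hζ, smul_eq_mul]
  ring

theorem fderiv_fderiv_symm_apply (h : IsLegendrePotential K x N) {ζ : CSpace n}
    (hζ : ζ ∈ N) (v w : CSpace n) :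
    fderiv ℝ (fderiv ℝ K) ζ v w = fderiv ℝ (fderiv ℝ K) ζ w v :=
  ((h.smooth ζ hζ).isSymmSndFDerivAt (by simp [ENat.LEInfty.out])) v w

/-- On vectors annihilated by the `dx_i`, the second derivative of `K` depends only on `dz`. -/
theorem fderiv_fderiv_congr (h : IsLegendrePotential K x N) (hN : IsOpen N) {ζ : CSpace n}
    (hζ : ζ ∈ N) {l l' : CSpace n} (hx : ∀ i, fderiv ℝ (x i) ζ l = 0)
    (hx' : ∀ i, fderiv ℝ (x i) ζ l' = 0) (hz : ∀ i, l (.inr i) = l' (.inr i)) :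
    fderiv ℝ (fderiv ℝ K) ζ l l = fderiv ℝ (fderiv ℝ K) ζ l' l' := by
  have hd : ∀ i, (l - l') (.inr i) = 0 := fun i => by rw [Pi.sub_apply, hz, sub_self]
  have h1 := h.fderiv_fderiv_of_inr_eq_zero hN hζ l hd
  have h2 := h.fderiv_fderiv_of_inr_eq_zero hN hζ l' hd
  simp only [hx, hx', mul_zero, Finset.sum_const_zero] at h1 h2
  rw [map_sub] at h1 h2
  have h3 := h.fderiv_fderiv_symm_apply hζ l l'
  linarith

/-- `K` and `x` are invariant under imaginary translations of `u`. -/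
theorem eq_of_re_eq (h : IsLegendrePotential K x N) (hc : Convex ℝ N) {ζ ζ' : CSpace n}
    (hζ : ζ ∈ N) (hζ' : ζ' ∈ N) (hre : ∀ i, (ζ (.inl i)).re = (ζ' (.inl i)).re)
    (hz : ∀ i, ζ (.inr i) = ζ' (.inr i)) : K ζ = K ζ' ∧ ∀ i, x i ζ = x i ζ' := by
  have h0 : ∀ T : CSpace n →L[ℝ] ℝ, (∀ i, T (Pi.single (.inl i) Complex.I) = 0) →
      T (ζ - ζ') = 0 := fun T hT => by
    rw [map_eq_sum_re_of_inr_eq_zero T hT fun i => by rw [Pi.sub_apply, hz, sub_self]]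
    simp [hre]
  exact ⟨hc.eq_of_fderiv_apply_eq_zero hζ' hζ (fun y hy => (h.smooth y hy).differentiableAt
      (by simp)) fun y hy => h0 _ (h.fderiv_im y hy),
    fun i => hc.eq_of_fderiv_apply_eq_zero hζ' hζ (fun y hy => (h.smooth_x y hy i).differentiableAt
      (by simp)) fun y hy => h0 _ (h.fderiv_x_im y hy i)⟩

end IsLegendrePotential

namespace IsLegendreSection

theorem fderiv_inr (s : IsLegendreSection x N ξ U) (hw : w ∈ U)
    (δ : Fin n → EuclideanSpace ℝ (Fin 3)) (i : Fin n) :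
    fderiv ℝ ξ w δ (.inr i) = zPart n δ (.inr i) := by
  have hd := (s.smooth w hw).differentiableAt (by simp)
  let P : CSpace n →L[ℝ] ℂ := ContinuousLinearMap.proj (.inr i)
  have e1 : (fun y => P (ξ y)) =ᶠ[𝓝 w] fun y => P (zPart n y) := by
    filter_upwards [s.isOpen.mem_nhds hw] with y hy using s.z_eq y hy i
  have e2 := e1.fderiv_eq (𝕜 := ℝ)
  exact DFunLike.congr_fun (((P.hasFDerivAt.comp w hd.hasFDerivAt).fderiv.symm.trans e2).trans
    (P.hasFDerivAt.comp w (zPart n).hasFDerivAt).fderiv) δ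

theorem fderiv_x (s : IsLegendreSection x N ξ U) (h : IsLegendrePotential K x N) (hw : w ∈ U)
    (δ : Fin n → EuclideanSpace ℝ (Fin 3)) (i : Fin n) :
    fderiv ℝ (x i) (ξ w) (fderiv ℝ ξ w δ) = δ i 0 := by
  have hd := (s.smooth w hw).differentiableAt (by simp)
  have hx := (h.smooth_x _ (s.mem w hw) i).differentiableAt (by simp)
  have e1 : (fun y => x i (ξ y)) =ᶠ[𝓝 w] fun y => component i 0 y := by
    filter_upwards [s.isOpen.mem_nhds hw] with y hy using s.x_eq y hy i
  have e2 := e1.fderiv_eq (𝕜 := ℝ)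
  exact DFunLike.congr_fun (((hx.hasFDerivAt.comp w hd.hasFDerivAt).fderiv.symm.trans e2).trans
    (component i 0).hasFDerivAt.fderiv) δ

theorem contDiffAt_legendreDual (s : IsLegendreSection x N ξ U) (h : IsLegendrePotential K x N)
    (hw : w ∈ U) : ContDiffAt ℝ ∞ (legendreDual K ξ) w := by
  have hξ := s.smooth w hw
  have h1 : ∀ i : Fin n, ContDiffAt ℝ ∞ (fun y => (ξ y (.inl i)).re) w := fun i =>
    (Complex.reCLM.comp (ContinuousLinearMap.proj (R := ℝ) (φ := fun _ : Fin n ⊕ Fin n => ℂ)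
      (.inl i))).contDiff.contDiffAt.comp w hξ
  exact ((h.smooth _ (s.mem w hw)).comp w hξ).add (contDiffAt_const.mul (ContDiffAt.sum fun i _ =>
    (h1 i).mul (component i 0).contDiff.contDiffAt))

theorem hasFDerivAt_re (s : IsLegendreSection x N ξ U) (hw : w ∈ U) (i : Fin n) :
    HasFDerivAt (fun y => (ξ y (.inl i)).re) ((Complex.reCLM.comp
      (ContinuousLinearMap.proj (R := ℝ) (φ := fun _ : Fin n ⊕ Fin n => ℂ) (.inl i))).comp
      (fderiv ℝ ξ w)) w :=
  (Complex.reCLM.comp (ContinuousLinearMap.proj (R := ℝ) (φ := fun _ : Fin n ⊕ Fin n => ℂ)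
      (.inl i))).hasFDerivAt.comp w ((s.smooth w hw).differentiableAt (by simp)).hasFDerivAt

/-- The envelope property: the variation of u contributes (∂K/∂Re u_i + 4 x_i) d Re u_i = 0, so no
derivative of ξ survives. -/
theorem fderiv_legendreDual (s : IsLegendreSection x N ξ U) (h : IsLegendrePotential K x N)
    (hw : w ∈ U) : fderiv ℝ (legendreDual K ξ) w = legendreDualDeriv K ξ w := by
  have hd := (s.smooth w hw).differentiableAt (by simp)
  have hK := (h.smooth _ (s.mem w hw)).differentiableAt (by simp)
  have h1 := (hK.hasFDerivAt.comp w hd.hasFDerivAt).add ((HasFDerivAt.fun_sum (u := Finset.univ)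
    fun i _ => (s.hasFDerivAt_re hw i).mul (component i 0).hasFDerivAt).const_mul 4)
  refine (h1.fderiv : fderiv ℝ (legendreDual K ξ) w = _).trans ?_
  ext δ
  have e : fderiv ℝ K (ξ w) (fderiv ℝ ξ w δ) - fderiv ℝ K (ξ w) (zPart n δ)
      = -4 * ∑ i, (fderiv ℝ ξ w δ (.inl i)).re * w i 0 := by
    rw [← map_sub, map_eq_sum_re_of_inr_eq_zero _ (h.fderiv_im _ (s.mem w hw)) fun i => by
      rw [Pi.sub_apply, s.fderiv_inr hw, sub_self], Finset.mul_sum]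
    refine Finset.sum_congr rfl fun i _ => ?_
    rw [h.fderiv_re _ (s.mem w hw), s.x_eq w hw, Pi.sub_apply, zPart_inl, sub_zero, smul_eq_mul]
    ring
  have hc : ∀ (i : Fin n) (y : Fin n → EuclideanSpace ℝ (Fin 3)), component i 0 y = y i 0 :=
    fun _ _ => rfl
  simp only [legendreDualDeriv, add_apply, smul_apply, sum_apply, ContinuousLinearMap.comp_apply,
    smul_eq_mul, nsmul_eq_mul, Finset.sum_add_distrib, hc, ContinuousLinearMap.proj_apply,
    Complex.reCLM_apply]
  simp only [mul_comm (w _ 0)]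
  push_cast
  linarith

theorem fderiv_fderiv_legendreDual (s : IsLegendreSection x N ξ U) (h : IsLegendrePotential K x N)
    (hw : w ∈ U) (δ δ' : Fin n → EuclideanSpace ℝ (Fin 3)) :
    fderiv ℝ (fderiv ℝ (legendreDual K ξ)) w δ δ' =
      4 * ∑ i, (fderiv ℝ ξ w δ (.inl i)).re * δ' i 0
        + fderiv ℝ (fderiv ℝ K) (ξ w) (fderiv ℝ ξ w δ) (zPart n δ') := by
  have hd := (s.smooth w hw).differentiableAt (by simp)
  have hF : DifferentiableAt ℝ (fderiv ℝ (legendreDual K ξ)) w :=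
    ((s.contDiffAt_legendreDual h hw).fderiv_right (m := ∞)
      (by simp)).differentiableAt (by simp)
  have hK : DifferentiableAt ℝ (fderiv ℝ K) (ξ w) :=
    ((h.smooth _ (s.mem w hw)).fderiv_right (m := ∞)
      (by simp)).differentiableAt (by simp)
  rw [← fderiv_clm_apply₁ hF]
  have e : (fun y => fderiv ℝ (legendreDual K ξ) y δ') =ᶠ[𝓝 w]
      fun y => 4 * ∑ i, (ξ y (.inl i)).re * δ' i 0 + fderiv ℝ K (ξ y) (zPart n δ') := by
    filter_upwards [s.isOpen.mem_nhds hw] with y hy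
    rw [s.fderiv_legendreDual h hy]
    simp only [legendreDualDeriv, add_apply, smul_apply, sum_apply, ContinuousLinearMap.comp_apply,
      smul_eq_mul, nsmul_eq_mul]
    push_cast
    rfl
  have h1 := ((HasFDerivAt.fun_sum (u := Finset.univ)
    fun i _ => (s.hasFDerivAt_re hw i).mul_const (δ' i 0)).const_mul 4).add
    ((hK.hasFDerivAt.comp w hd.hasFDerivAt).clm_apply (hasFDerivAt_const (zPart n δ') w))
  rw [e.fderiv_eq]
  refine (DFunLike.congr_fun h1.fderiv δ).trans ?_
  simp [mul_comm]

theorem partialX_legendreDual (s : IsLegendreSection x N ξ U) (h : IsLegendrePotential K x N)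
    (hw : w ∈ U) (i : Fin n) :
    partialX (legendreDual K ξ) i w = 4 * (ξ w (.inl i)).re := by
  have h0 : zPart n (Pi.single i (EuclideanSpace.single 0 1)) = 0 := by
    ext α
    rcases α with j | j
    · rw [zPart_inl, Pi.zero_apply]
    · rw [zPart_inr]
      by_cases hij : j = i
      · subst hij; simp
      · simp [hij]
  rw [partialX, s.fderiv_legendreDual h hw, legendreDualDeriv, add_apply,
    ContinuousLinearMap.comp_apply, h0, map_zero, add_zero, smul_apply, sum_apply,
    Finset.sum_eq_single i]
  · rw [smul_apply, smul_eq_mul, nsmul_eq_mul]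
    have : component i 0 (Pi.single i (EuclideanSpace.single 0 1)) = 1 := by
      change (Pi.single i (EuclideanSpace.single 0 1) : Fin n → EuclideanSpace ℝ (Fin 3)) i 0 = 1
      simp
    rw [this, mul_one]
    norm_num
  · intro j _ hj
    have : component j 0 (Pi.single i (EuclideanSpace.single 0 1)) = 0 := by
      change (Pi.single i (EuclideanSpace.single 0 1) : Fin n → EuclideanSpace ℝ (Fin 3)) j 0 = 0
      simp [hj]
    rw [smul_apply, this, smul_zero]
  · simp

/-- The Laplacian of `legendreDual` along `ℝ³ ⊗ ℝ v` vanishes. -/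
theorem sum_fderiv_fderiv_legendreDual (s : IsLegendreSection x N ξ U)
    (h : IsLegendrePotential K x N) (hN : IsOpen N) (hw : w ∈ U) (v : Fin n → ℝ) :
    ∑ k : Fin 3, fderiv ℝ (fderiv ℝ (legendreDual K ξ)) w
      (fun i => v i • EuclideanSpace.single k 1) (fun i => v i • EuclideanSpace.single k 1) = 0 := by
  obtain ⟨r, l, y, -, hl, hlz, hlr, hy, hIy, hyz, hQ⟩ := h.exists_vectors _ (s.mem w hw) v
  set δ : Fin 3 → Fin n → EuclideanSpace ℝ (Fin 3) :=
    fun k i => v i • EuclideanSpace.single k 1 with hδ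
  have hζ := s.mem w hw
  have hx : ∀ k i, fderiv ℝ (x i) (ξ w) (fderiv ℝ ξ w (δ k)) = δ k i 0 := fun k i =>
    s.fderiv_x h hw (δ k) i
  have hz : ∀ k i, fderiv ℝ ξ w (δ k) (.inr i) = zPart n (δ k) (.inr i) := fun k i =>
    s.fderiv_inr hw (δ k) i
  -- The lift of the x-direction has the same dx and dz as l, hence the same real part of du. It
  -- contributes 4r to the Laplacian.
  have e0 : ∑ i, (fderiv ℝ ξ w (δ 0) (.inl i)).re * v i = r := by
    rw [← hlr]
    refine Finset.sum_congr rfl fun i _ => ?_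
    have := h.re_eq_zero _ hζ (fderiv ℝ ξ w (δ 0) - l)
      (fun i => by rw [Pi.sub_apply, hz, hlz, zPart_inr]; simp [hδ])
      (fun i => by rw [map_sub, hx, hl]; simp [hδ]) i
    rw [Pi.sub_apply, Complex.sub_re, sub_eq_zero] at this
    rw [this]
  have hdiag : ∀ k : Fin 3, (∀ i, δ k i 0 = 0) →
      fderiv ℝ (fderiv ℝ K) (ξ w) (fderiv ℝ ξ w (δ k)) (zPart n (δ k))
        = fderiv ℝ (fderiv ℝ K) (ξ w) (fderiv ℝ ξ w (δ k)) (fderiv ℝ ξ w (δ k)) := by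
    intro k hk
    have := h.fderiv_fderiv_of_inr_eq_zero hN hζ (fderiv ℝ ξ w (δ k))
      (d := fderiv ℝ ξ w (δ k) - zPart n (δ k)) (fun i => by rw [Pi.sub_apply, hz, sub_self])
    simp only [hx, hk, mul_zero, Finset.sum_const_zero] at this
    rw [map_sub] at this
    linarith
  have h1 : ∀ i, δ 1 i 0 = 0 := fun i => by simp [hδ]
  have h2 : ∀ i, δ 2 i 0 = 0 := fun i => by simp [hδ]
  have q0 : zPart n (δ 0) = 0 := by
    ext α
    rcases α with j | j
    · rw [zPart_inl, Pi.zero_apply]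
    · rw [zPart_inr]; simp [hδ]
  -- The lifts of the two z-directions have dx = 0 and the same dz as y and √-1 y, so D²K takes the
  -- same values on them. Together they contribute -4r.
  have q1 := h.fderiv_fderiv_congr hN hζ (fun i => (hx 1 i).trans (h1 i)) hy
    fun i => by rw [hz, hyz, zPart_inr]; simp [hδ]
  have q2 := h.fderiv_fderiv_congr hN hζ (fun i => (hx 2 i).trans (h2 i)) hIy
    fun i => by rw [hz, Pi.smul_apply, hyz, zPart_inr]; simp [hδ]
  change ∑ k : Fin 3, fderiv ℝ (fderiv ℝ (legendreDual K ξ)) w (δ k) (δ k) = 0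
  rw [Fin.sum_univ_three]
  simp only [s.fderiv_fderiv_legendreDual h hw, hdiag 1 h1, hdiag 2 h2, q1, q2, q0, map_zero,
    h1, h2, mul_zero, Finset.sum_const_zero]
  have e0' : ∑ i, (fderiv ℝ ξ w (δ 0) (.inl i)).re * δ 0 i 0 = r := by
    rw [← e0]
    exact Finset.sum_congr rfl fun i _ => by simp [hδ]
  rw [e0']
  linarith

theorem isPolyharmonicOn (s : IsLegendreSection x N ξ U)
    (h : IsLegendrePotential K x N) (hN : IsOpen N) :
    IsPolyharmonicOn (legendreDual K ξ) U := by
  intro a v q hq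
  let T : EuclideanSpace ℝ (Fin 3) →L[ℝ] Fin n → EuclideanSpace ℝ (Fin 3) :=
    ContinuousLinearMap.pi fun i => v i • ContinuousLinearMap.id ℝ _
  have hA : ∀ q, HasFDerivAt (fun q : EuclideanSpace ℝ (Fin 3) => (fun i => a i + v i • q)) T q :=
    fun q => T.hasFDerivAt.const_add a
  have hAs : ContDiff ℝ ∞ (fun q : EuclideanSpace ℝ (Fin 3) => (fun i => a i + v i • q)) :=
    contDiff_const.add T.contDiff
  have hop : IsOpen {q : EuclideanSpace ℝ (Fin 3) | (fun i => a i + v i • q) ∈ U} :=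
    s.isOpen.preimage hAs.continuous
  have hf1 : ∀ q ∈ {q : EuclideanSpace ℝ (Fin 3) | (fun i => a i + v i • q) ∈ U},
      fderiv ℝ (fun q => legendreDual K ξ (fun i => a i + v i • q)) q
        = (fderiv ℝ (legendreDual K ξ) (fun i => a i + v i • q)).comp T := fun q hq =>
    (HasFDerivAt.comp (g := legendreDual K ξ) q
      ((s.contDiffAt_legendreDual h hq).differentiableAt (by simp)).hasFDerivAt (hA q)).fderiv
  refine ⟨((s.contDiffAt_legendreDual h hq).comp q hAs.contDiffAt).of_le ENat.LEInfty.out, ?_⟩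
  filter_upwards [hop.mem_nhds hq] with y hy
  rw [InnerProductSpace.laplacian_eq_iteratedFDeriv_orthonormalBasis _
    (EuclideanSpace.basisFun (Fin 3) ℝ), Pi.zero_apply,
    ← s.sum_fderiv_fderiv_legendreDual h hN hy v]
  refine Finset.sum_congr rfl fun k _ => ?_
  have hF : DifferentiableAt ℝ (fderiv ℝ (legendreDual K ξ)) (fun i => a i + v i • y) :=
    ((s.contDiffAt_legendreDual h hy).fderiv_right (m := ∞) (by simp)).differentiableAt (by simp)
  have e : fderiv ℝ (fun q => legendreDual K ξ (fun i => a i + v i • q)) =ᶠ[𝓝 y]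
      fun q => (fderiv ℝ (legendreDual K ξ) (fun i => a i + v i • q)).comp T := by
    filter_upwards [hop.mem_nhds hy] with q hq using hf1 q hq
  have h2 := (hF.hasFDerivAt.comp y (hA y)).clm_comp (hasFDerivAt_const T y)
  rw [iteratedFDeriv_two_apply, e.fderiv_eq]
  have h3 := DFunLike.congr_fun (DFunLike.congr_fun h2.fderiv (EuclideanSpace.basisFun (Fin 3) ℝ k))
    (EuclideanSpace.basisFun (Fin 3) ℝ k)
  refine h3.trans ?_
  have hT : T (EuclideanSpace.single k 1) = fun i => v i • EuclideanSpace.single k (1 : ℝ) := rfl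
  simp [hT]

/-- The matrix is ∂Re u_j/∂x_i, symmetric as a quarter of a Hessian. Its quadratic form at v is ∑ Re
l_i v_i = r > 0, since the lift of v and l have the same real part in u. -/
theorem posDef (s : IsLegendreSection x N ξ U) (h : IsLegendrePotential K x N) (hw : w ∈ U) :
    (Matrix.of fun i j : Fin n => (1 / 4) * partialX (partialX (legendreDual K ξ) j) i w).PosDef := by
  set e : Fin n → Fin n → EuclideanSpace ℝ (Fin 3) :=
    fun i => Pi.single i (EuclideanSpace.single 0 (1 : ℝ)) with he
  have hz0 : ∀ i j, zPart n (e i) (.inr j) = 0 := by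
    intro i j
    rw [zPart_inr]
    by_cases hij : j = i
    · subst hij; simp [he]
    · simp [he, hij]
  have hF : DifferentiableAt ℝ (fderiv ℝ (legendreDual K ξ)) w :=
    ((s.contDiffAt_legendreDual h hw).fderiv_right (m := ∞) (by simp)).differentiableAt (by simp)
  have hM : ∀ i j, (1 / 4) * partialX (partialX (legendreDual K ξ) j) i w
      = (fderiv ℝ ξ w (e i) (.inl j)).re := by
    intro i j
    have e1 : partialX (legendreDual K ξ) j =ᶠ[𝓝 w] fun y => 4 * (ξ y (.inl j)).re := by
      filter_upwards [s.isOpen.mem_nhds hw] with y hy using s.partialX_legendreDual h hy j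
    have e2 := DFunLike.congr_fun ((s.hasFDerivAt_re hw j).const_mul 4).fderiv (e i)
    rw [partialX, e1.fderiv_eq]
    refine (congrArg (fun t => 1 / 4 * t) e2).trans ?_
    simp
  have hsymm : ∀ i j, partialX (partialX (legendreDual K ξ) j) i w
      = partialX (partialX (legendreDual K ξ) i) j w := by
    intro i j
    have h1 : ∀ i j, partialX (partialX (legendreDual K ξ) j) i w
        = fderiv ℝ (fderiv ℝ (legendreDual K ξ)) w (e i) (e j) := fun i j =>
      fderiv_clm_apply₁ hF (e i) (e j)
    rw [h1, h1]
    exact (s.contDiffAt_legendreDual h hw).isSymmSndFDerivAt (by simp [ENat.LEInfty.out]) _ _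
  refine Matrix.PosDef.of_dotProduct_mulVec_pos ?_ fun {v} hv => ?_
  · ext i j
    simp only [Matrix.conjTranspose_apply, Matrix.of_apply, star_trivial]
    rw [hsymm]
  · obtain ⟨r, l, y, hr, hl, hlz, hlr, -⟩ := h.exists_vectors _ (s.mem w hw) v
    have h1 := h.re_eq_zero _ (s.mem w hw) (∑ i, v i • fderiv ℝ ξ w (e i) - l)
      (fun j => by
        simp only [Pi.sub_apply, Finset.sum_apply, Pi.smul_apply, s.fderiv_inr hw, hz0, hlz]
        simp)
      (fun j => by
        simp only [map_sub, map_sum, map_smul, s.fderiv_x h hw, hl]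
        rw [Finset.sum_eq_single j]
        · simp [he]
        · intro b _ hb; simp [he, hb.symm]
        · simp)
    have h2 : ∀ j, ∑ i, v i * (fderiv ℝ ξ w (e i) (.inl j)).re = (l (.inl j)).re := fun j => by
      have := h1 j
      simp only [Pi.sub_apply, Finset.sum_apply, Pi.smul_apply, Complex.sub_re, Complex.re_sum,
        Complex.real_smul, Complex.re_ofReal_mul, sub_eq_zero] at this
      exact this
    refine (hr hv).trans_eq ?_
    rw [← hlr]
    simp only [star_trivial, dotProduct, Matrix.mulVec, Matrix.of_apply, hM, ← h2,
      Finset.sum_mul, Finset.mul_sum]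
    rw [Finset.sum_comm]
    exact Finset.sum_congr rfl fun i _ => Finset.sum_congr rfl fun j _ => by ring

/-- Since F_{x_i} = 4 Re u_i, the equation F_{x_i} = 2(u_i + ū_i) says that ξ(x', z) and ζ differ
only in Im u. On the convex set N neither x nor K sees Im u, which gives both the uniqueness of x
and the formula for K. -/
theorem isLegendreTransform (s : IsLegendreSection x N ξ U)
    (h : IsLegendrePotential K x N) (hc : Convex ℝ N) {W : Set (CSpace n)} (hW : W ⊆ N)
    (hξ : ∀ w ∈ U, ξ w ∈ W)
    (hζ : ∀ ζ ∈ W, ptXZ (fun i => x i ζ) (fun i => ζ (.inr i)) ∈ U ∧ ∀ i,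
      (ξ (ptXZ (fun i => x i ζ) (fun i => ζ (.inr i))) (.inl i)).re = (ζ (.inl i)).re) :
    IsLegendreTransform (legendreDual K ξ) U W (fun ζ i => x i ζ) K := by
  have hpt : ∀ (t : Fin n → ℝ) (z : Fin n → ℂ) i, zPart n (ptXZ t z) (.inr i) = z i := by
    intro t z i
    rw [zPart_inr]
    simp [ptXZ, mul_comm Complex.I, Complex.re_add_im]
  have hpx : ∀ (t : Fin n → ℝ) (z : Fin n → ℂ) i, ptXZ t z i 0 = t i := fun t z i => by simp [ptXZ]
  refine ⟨fun w hw => s.posDef h hw, fun ζ hζW => (hζ ζ hζW).1, fun ζ hζW i => ?_,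
    fun ζ hζW x' hx' he => ?_, fun w hw => ⟨ξ w, hξ w hw, ?_⟩, fun ζ hζW => ?_⟩
  · obtain ⟨h1, h2⟩ := hζ ζ hζW
    rw [s.partialX_legendreDual h h1, h2, Complex.add_conj]
    push_cast
    ring
  · have hre : ∀ i, (ξ (ptXZ x' (fun i => ζ (.inr i))) (.inl i)).re = (ζ (.inl i)).re := by
      intro i
      have := he i
      rw [s.partialX_legendreDual h hx', Complex.add_conj] at this
      have h3 : 4 * (ξ (ptXZ x' (fun i => ζ (.inr i))) (.inl i)).re = 2 * (2 * (ζ (.inl i)).re) := by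
        exact_mod_cast this
      linarith
    have := (h.eq_of_re_eq hc (s.mem _ hx') (hW hζW) hre
      fun i => by rw [s.z_eq _ hx', hpt]).2
    ext i
    rw [← this, s.x_eq _ hx', hpx]
  · ext i k
    fin_cases k
    · simp [ptXZ, s.x_eq w hw]
    · simp [ptXZ, s.z_eq w hw, zPart_inr]
    · simp [ptXZ, s.z_eq w hw, zPart_inr]
  · obtain ⟨h1, h2⟩ := hζ ζ hζW
    have := (h.eq_of_re_eq hc (s.mem _ h1) (hW hζW) h2 fun i => by rw [s.z_eq _ h1, hpt]).1
    rw [legendreDual, this]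
    simp only [h2, hpx, Complex.add_conj]
    push_cast
    simp only [Finset.mul_sum]
    rw [add_sub_assoc, ← Finset.sum_sub_distrib, Finset.sum_eq_zero, add_zero]
    intro i _
    ring

end IsLegendreSection

end LegendreSection

/-! ### Assembly on a common neighbourhood -/

section Assembly

open Filter

variable {m n : ℕ}

/-- The linear map `(x, z) ↦ (x, z)` from `ℝⁿ × ℂⁿ` to `ℂ²ⁿ`. -/
def realPlane (n : ℕ) : (Fin n → EuclideanSpace ℝ (Fin 3)) →L[ℝ] CSpace n :=
  ContinuousLinearMap.pi (Sum.elim (fun i => Complex.ofRealCLM.comp (component i 0)) fun i =>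
    (ContinuousLinearMap.proj (R := ℝ) (φ := fun _ : Fin n ⊕ Fin n => ℂ) (.inr i)).comp (zPart n))

/-- The affine map `(x, z) ↦ (x + √-1 Im u₀, z)`, where `ζ₀ = (u₀, z₀)`. -/
def affineSection (ζ₀ : CSpace n) (w : Fin n → EuclideanSpace ℝ (Fin 3)) : CSpace n :=
  realPlane n w + Sum.elim (fun i => Complex.I * ((ζ₀ (.inl i)).im : ℂ)) 0

theorem affineSection_inl (ζ₀ : CSpace n) (w : Fin n → EuclideanSpace ℝ (Fin 3)) (i : Fin n) :
    affineSection ζ₀ w (.inl i) = (w i 0 : ℂ) + Complex.I * ((ζ₀ (.inl i)).im : ℂ) := rfl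

theorem affineSection_inr (ζ₀ : CSpace n) (w : Fin n → EuclideanSpace ℝ (Fin 3)) (i : Fin n) :
    affineSection ζ₀ w (.inr i) = zPart n w (.inr i) := add_zero _

theorem contDiff_affineSection (ζ₀ : CSpace n) : ContDiff ℝ ∞ (affineSection ζ₀) :=
  (realPlane n).contDiff.add contDiff_const

theorem zPart_ptXZ (t : Fin n → ℝ) (z : Fin n → ℂ) (i : Fin n) :
    zPart n (ptXZ t z) (.inr i) = z i := by
  rw [zPart_inr]
  simp [ptXZ, mul_comm Complex.I, Complex.re_add_im]

/-- Composing an affine section with a map `Θ` which commutes with imaginary translations of `u`. -/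
theorem isLegendreSection_comp_affineSection {x : Fin n → CSpace n → ℝ} {N : Set (CSpace n)}
    {Θ : CSpace n → CSpace n} {ζ₀ : CSpace n} {r : ℝ}
    (hΘ : ∀ ζ ∈ Metric.ball ζ₀ r, ContDiffAt ℝ ∞ Θ ζ) (hz : ∀ ζ i, Θ ζ (.inr i) = ζ (.inr i))
    (hN : ∀ ζ ∈ Metric.ball ζ₀ r, Θ ζ ∈ N)
    (hx : ∀ ζ ∈ Metric.ball ζ₀ r, ∀ i, x i (Θ ζ) = (ζ (.inl i)).re) :
    IsLegendreSection x N (fun w => Θ (affineSection ζ₀ w))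
      (affineSection ζ₀ ⁻¹' Metric.ball ζ₀ r) where
  isOpen := Metric.isOpen_ball.preimage (contDiff_affineSection ζ₀).continuous
  smooth w hw := (hΘ _ hw).comp w (contDiff_affineSection ζ₀).contDiffAt
  mem w hw := hN _ hw
  z_eq w hw i := by rw [hz, affineSection_inr]
  x_eq w hw i := by rw [hx _ hw, affineSection_inl]; simp

/-- Balls for the sup norm are polydiscs, so replacing Im u by its value at the centre does not
leave the ball. -/
theorem affineSection_ptXZ_mem_ball {ζ₀ ζ : CSpace n} {r : ℝ} (hζ : ζ ∈ Metric.ball ζ₀ r) :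
    affineSection ζ₀ (ptXZ (fun i => (ζ (.inl i)).re) fun i => ζ (.inr i)) ∈ Metric.ball ζ₀ r := by
  refine lt_of_le_of_lt ?_ (Metric.mem_ball.1 hζ)
  rw [dist_pi_le_iff dist_nonneg]
  rintro (i | i)
  · refine le_trans ?_ (dist_le_pi_dist ζ ζ₀ (.inl i))
    rw [affineSection_inl, dist_eq_norm, dist_eq_norm]
    have e : ((ptXZ (fun i => (ζ (.inl i)).re) (fun i => ζ (.inr i)) i 0 : ℝ) : ℂ)
        + Complex.I * ((ζ₀ (.inl i)).im : ℂ) - ζ₀ (.inl i)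
        = (((ζ (.inl i) - ζ₀ (.inl i)).re : ℝ) : ℂ) := by
      apply Complex.ext <;> simp [ptXZ]
    rw [e, Complex.norm_real]
    exact Complex.abs_re_le_norm _
  · rw [affineSection_inr, zPart_ptXZ]
    exact dist_le_pi_dist ζ ζ₀ (.inr i)

/-- Θ - id has zero derivative along Im u, so on the convex ball it takes the same value at two
points that differ only in Im u. -/
theorem re_comp_affineSection {Θ : CSpace n → CSpace n} {ζ₀ ζ : CSpace n} {r : ℝ}
    (hΘ : ∀ ζ ∈ Metric.ball ζ₀ r, ContDiffAt ℝ ∞ Θ ζ)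
    (hb : ∀ ζ ∈ Metric.ball ζ₀ r, ∀ i, fderiv ℝ Θ ζ (Pi.single (.inl i) Complex.I)
      = Pi.single (.inl i) Complex.I) (hζ : ζ ∈ Metric.ball ζ₀ r) (i : Fin n) :
    (Θ (affineSection ζ₀ (ptXZ (fun i => (ζ (.inl i)).re) fun i => ζ (.inr i))) (.inl i)).re
      = (Θ ζ (.inl i)).re := by
  set ζ' := affineSection ζ₀ (ptXZ (fun i => (ζ (.inl i)).re) fun i => ζ (.inr i)) with hζ'
  have hre : ∀ i, (ζ' (.inl i)).re = (ζ (.inl i)).re := fun i => by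
    rw [hζ', affineSection_inl]; simp [ptXZ]
  have h1 : Θ ζ' - ζ' = Θ ζ - ζ := by
    refine (convex_ball ζ₀ r).eq_of_fderiv_apply_eq_zero (f := fun y => Θ y - y) hζ
      (affineSection_ptXZ_mem_ball hζ) (fun y hy => ((hΘ y hy).differentiableAt (by simp)).sub
        differentiableAt_id) fun y hy => ?_
    have e := (((hΘ y hy).differentiableAt (by simp)).hasFDerivAt.sub (hasFDerivAt_id y)).fderiv
    refine (DFunLike.congr_fun e _).trans ?_
    rw [map_eq_sum_re_of_inr_eq_zero _ (fun i => by rw [sub_apply, hb y hy]; exact sub_self _)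
      fun i => by rw [Pi.sub_apply, hζ', affineSection_inr, zPart_ptXZ, sub_self]]
    refine Finset.sum_eq_zero fun i _ => ?_
    rw [Pi.sub_apply, Complex.sub_re, hre, sub_self, zero_smul]
  have h2 := congrArg Complex.re (congrFun h1 (.inl i))
  simp only [Pi.sub_apply, Complex.sub_re, hre] at h2
  linarith

variable {M : Type*} [TopologicalSpace M]
  [ChartedSpace (EuclideanSpace ℝ (Fin m)) M] [IsManifold (𝓡 m) ∞ M]
  {H : HyperkahlerStructure m M} {A : LocalAction m M n}
  {μ : M → Fin n → EuclideanSpace ℝ (Fin 3)} {ψ : OpenPartialHomeomorph M (CSpace n)}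

theorem IsDarbouxChart.restrOpen (h : IsDarbouxChart H A μ ψ) {s : Set M} (hs : IsOpen s) :
    IsDarbouxChart H A μ (ψ.restrOpen s hs) :=
  ⟨h.toIsSmoothChart.restrOpen hs, fun q hq => h.holForm_eq q hq.1,
    fun q hq => h.deriv_field q hq.1, fun q hq => h.moment_z q hq.1⟩

theorem IsDarbouxChart.isGivenByPotential (h : IsDarbouxChart H A μ ψ) {K : CSpace n → ℝ}
    (hK : ∀ ζ ∈ ψ.target, ContDiffAt ℝ ∞ K ζ)
    (hform : ∀ q (hq : q ∈ ψ.source), ∀ v w : TangentSpace (𝓡 m) q, H.kahlerForm 0 q v w =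
      1 / 4 * (fderiv ℝ (fderiv ℝ K) (ψ q) (h.deriv hq v) (Complex.I • h.deriv hq w)
        - fderiv ℝ (fderiv ℝ K) (ψ q) (h.deriv hq w) (Complex.I • h.deriv hq v))) :
    IsGivenByPotential H A μ ψ (fun ζ i => μ (ψ.symm ζ) i 0) K where
  smooth := h.smooth
  smooth_symm := h.smooth_symm
  holomorphic q hq v α := congrFun (h.deriv_I hq v) α
  smooth_K := fun ζ hζ => (hK ζ hζ).contDiffWithinAt
  kahlerForm_one q hq v w := by
    rw [hform q hq, ← sum_mixedDeriv (hK _ (ψ.map_source hq))]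
    rfl
  kahlerForm_two_three q hq v w := h.holForm_eq q hq v w
  field_u q hq i j := by
    refine (congrFun (h.deriv_field q hq i) (.inl j)).trans ?_
    by_cases hij : i = j
    · subst hij; simp
    · simp [hij, Ne.symm hij]
  field_z q hq i j := by
    refine (congrFun (h.deriv_field q hq i) (.inr j)).trans ?_
    simp
  moment_x q hq i := by
    change μ (ψ.symm (ψ q)) i 0 = _
    rw [ψ.left_inv hq]
  moment_z q hq i := h.moment_z q hq i

end Assembly

/-- Because the first chart has Re u = x, the map (x, z) ↦ Θ(x + √-1 Im u₀, z) is an explicit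
section of ζ ↦ (x(ζ), z). No further inversion is needed to define F on an open set. -/
theorem exists_legendreTransform {m n : ℕ} (hm : m = 4 * n) {M : Type*} [TopologicalSpace M]
    [ChartedSpace (EuclideanSpace ℝ (Fin m)) M] [IsManifold (𝓡 m) ∞ M]
    (H : HyperkahlerStructure m M)
    (A : LocalAction m M n) (hA : A.IsFree)
    (μ : M → Fin n → EuclideanSpace ℝ (Fin 3)) (hμ : IsTriMomentMap H A μ) (p : M) :
    ∃ (U : Set (Fin n → EuclideanSpace ℝ (Fin 3)))
      (F : (Fin n → EuclideanSpace ℝ (Fin 3)) → ℝ)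
      (ψ : OpenPartialHomeomorph M (Fin n ⊕ Fin n → ℂ))
      (x : (Fin n ⊕ Fin n → ℂ) → Fin n → ℝ) (K : (Fin n ⊕ Fin n → ℂ) → ℝ),
      IsOpen U ∧ ContDiffOn ℝ ∞ F U ∧ IsPolyharmonicOn F U ∧
      p ∈ ψ.source ∧
      IsLegendreTransform F U ψ.target x K ∧
      IsGivenByPotential H A μ ψ x K := by
  obtain ⟨ψ₀, ψ, Θ, hp₀, hp, hψ, h₀, hΘ₀, hΘs, hΘz, hΘb⟩ := exists_isDarbouxChart hm hA hμ p
  obtain ⟨K, N, hN, hNt, hK, hform⟩ := hψ.exists_isLegendrePotential hm hA hμ hp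
  obtain ⟨r₁, hr₁, hball₁⟩ := Metric.mem_nhds_iff.1 hN
  have hΘp : Θ (ψ₀ p) = ψ p := (hΘ₀ p hp).2.symm
  have hcont : ContinuousAt Θ (ψ₀ p) := hΘs.self_of_nhds.continuousAt
  have hΘball : ∀ᶠ ζ in 𝓝 (ψ₀ p), Θ ζ ∈ Metric.ball (ψ p) r₁ :=
    hcont.eventually_mem (hΘp.symm ▸ Metric.ball_mem_nhds (ψ p) hr₁)
  have hsymm : ContinuousAt ψ₀.symm (ψ₀ p) := ψ₀.continuousAt_symm (ψ₀.map_source hp₀)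
  have hev : ∀ᶠ ζ in 𝓝 (ψ₀ p), ContDiffAt ℝ ∞ Θ ζ ∧
      (∀ i, fderiv ℝ Θ ζ (Pi.single (.inl i) Complex.I) = Pi.single (.inl i) Complex.I) ∧
      Θ ζ ∈ Metric.ball (ψ p) r₁ ∧ ζ ∈ ψ₀.target ∧ ψ₀.symm ζ ∈ ψ.source := by
    filter_upwards [hΘs, hΘb, hΘball,
      ψ₀.open_target.mem_nhds (ψ₀.map_source hp₀),
      hsymm.eventually ((ψ₀.left_inv hp₀).symm ▸ ψ.open_source.mem_nhds hp)] with ζ h1 h2 h3 h4 h5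
    exact ⟨h1, h2, h3, h4, h5⟩
  obtain ⟨r, hr, hball⟩ := Metric.mem_nhds_iff.1 hev
  set B := Metric.ball (ψ₀ p) r with hB
  -- The neighbourhood is a polydisc in the first chart, so its image in the Darboux chart is Θ(B)
  -- and U is the preimage of the same polydisc.
  let V : Set M := ψ₀.source ∩ ψ₀ ⁻¹' B
  have hV : IsOpen V := ψ₀.isOpen_inter_preimage Metric.isOpen_ball
  set x : Fin n → CSpace n → ℝ := fun i ζ => μ (ψ.symm ζ) i 0 with hxdef
  have hψΘ : ∀ ζ ∈ B, ψ (ψ₀.symm ζ) = Θ ζ := fun ζ hζ => by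
    rw [(hΘ₀ _ (hball hζ).2.2.2.2).2, ψ₀.right_inv (hball hζ).2.2.2.1]
  have hx : ∀ ζ ∈ B, ∀ i, x i (Θ ζ) = (ζ (.inl i)).re := by
    intro ζ hζ i
    obtain ⟨-, -, -, h4, h5⟩ := hball hζ
    rw [hxdef, ← hψΘ ζ hζ]
    change μ (ψ.symm (ψ (ψ₀.symm ζ))) i 0 = _
    rw [ψ.left_inv h5, ← (h₀ _ (ψ₀.map_target h4)).1 i, ψ₀.right_inv h4]
  have htarget : (ψ.restrOpen V hV).target = Θ '' B := by
    rw [← OpenPartialHomeomorph.image_source_eq_target]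
    ext ζ'
    constructor
    · rintro ⟨q, hq, rfl⟩
      exact ⟨ψ₀ q, hq.2.2, (hΘ₀ q hq.1).2.symm⟩
    · rintro ⟨ζ, hζ, rfl⟩
      obtain ⟨-, -, -, h4, h5⟩ := hball hζ
      refine ⟨ψ₀.symm ζ, ⟨h5, ψ₀.map_target h4, ?_⟩, hψΘ ζ hζ⟩
      change ψ₀ (ψ₀.symm ζ) ∈ B
      rwa [ψ₀.right_inv h4]
  -- The section takes values in a ball around ψ p, not merely in N, since convexity is needed for
  -- invariance under imaginary translations.
  have hs := isLegendreSection_comp_affineSection (x := x) (N := Metric.ball (ψ p) r₁)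
    (fun ζ hζ => (hball hζ).1) hΘz (fun ζ hζ => (hball hζ).2.2.1) hx
  have hK₁ := hK.mono hball₁
  have hWN : ∀ ζ ∈ (ψ.restrOpen V hV).target, ζ ∈ Metric.ball (ψ p) r₁ := by
    rw [htarget]
    rintro _ ⟨ζ, hζ, rfl⟩
    exact (hball hζ).2.2.1
  refine ⟨_, legendreDual K fun w => Θ (affineSection (ψ₀ p) w), ψ.restrOpen V hV,
    fun ζ i => x i ζ, K, hs.isOpen,
    fun w hw => (hs.contDiffAt_legendreDual hK₁ hw).contDiffWithinAt,
    hs.isPolyharmonicOn hK₁ Metric.isOpen_ball, ⟨hp, hp₀, Metric.mem_ball_self hr⟩,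
    hs.isLegendreTransform hK₁ (convex_ball _ _) hWN ?_ ?_,
    (hψ.restrOpen hV).isGivenByPotential (fun ζ hζ => hK₁.smooth ζ (hWN ζ hζ))
      fun q hq v w => hform _ (hball₁ (hWN _ ((ψ.restrOpen V hV).map_source hq))) q hq.1 rfl v w⟩
  · rw [htarget]
    exact fun w hw => ⟨_, hw, rfl⟩
  · rw [htarget]
    rintro _ ⟨ζ, hζ, rfl⟩
    simp only [hx ζ hζ, hΘz]
    exact ⟨affineSection_ptXZ_mem_ball hζ, re_comp_affineSection (fun ζ hζ => (hball hζ).1)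
      (fun ζ hζ => (hball hζ).2.1) hζ⟩

end

theorem mainTheorem8 (n : ℕ) {M : Type*} [TopologicalSpace M] [T2Space M]
    [ChartedSpace (EuclideanSpace ℝ (Fin (4 * n))) M] [IsManifold (𝓡 (4 * n)) ∞ M]
    (H : HyperkahlerStructure (4 * n) M)
    (A : LocalAction (4 * n) M n) (hA : A.IsFree)
    (μ : M → Fin n → EuclideanSpace ℝ (Fin 3)) (hμ : IsTriMomentMap H A μ) (p : M) :
    ∃ (U : Set (Fin n → EuclideanSpace ℝ (Fin 3)))
      (F : (Fin n → EuclideanSpace ℝ (Fin 3)) → ℝ)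
      (ψ : OpenPartialHomeomorph M (Fin n ⊕ Fin n → ℂ))
      (x : (Fin n ⊕ Fin n → ℂ) → Fin n → ℝ) (K : (Fin n ⊕ Fin n → ℂ) → ℝ),
      IsOpen U ∧ ContDiffOn ℝ ∞ F U ∧ IsPolyharmonicOn F U ∧
      p ∈ ψ.source ∧
      IsLegendreTransform F U ψ.target x K ∧
      IsGivenByPotential H A μ ψ x K := by
  exact exists_legendreTransform rfl H A hA μ hμ p
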